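/- Let $\mathbb{R}_+=(0,\infty)$. For $\lambda\ge 1$ let $\Delta_\lambda=-\frac{d^2}{dx^2}+\frac{\lambda(\lambda-1)}{x^2}$, and let $h_\lambda f(x)=\int_0^\infty\sqrt{xy}\,J_{\lambda-1/2}(xy)f(y)\,dy$ be the Hankel transform, $J_\nu$ being the Bessel function of the first kind. For $0<\sigma<1$ and $\phi\in C_c^\infty(\mathbb{R}_+)$ put $\Delta_\lambda^\sigma\phi=h_\lambda\big(y^{2\sigma}h_\lambda\phi\big)$. For more general functions $u$, $\Delta_\lambda^\sigma u$ is defined by transposition, as the functional $\phi\mapsto\int_0^\infty u\,\Delta_\lambda^\sigma\phi\,dx$. If there is a continuous function $g$ on $\mathbb{R}_+$ with $\int_0^\infty u\,\Delta_\lambda^\sigma\phi\,dx=\int_0^\infty g\,\phi\,dx$ (the first integral being absolutely convergent) for all $\phi\in C_c^\infty(\mathbb{R}_+)$, then $g$ is unique, we say that $\Delta_\lambda^\sigma u$ is a continuous function on $\mathbb{R}_+$, and we write $\Delta_\lambda^\sigma u(x)=g(x)$. For $0<\alpha<1$, $C^\alpha_+$ is the space of continuous functions $f:\mathbb{R}_+\to\mathbb{R}$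 with $$\sup_{x\ne y}\frac{|f(x)-f(y)|}{|x-y|^\alpha}+\sup_{x>0}x^{-\alpha}|f(x)|<\infty,$$ and $L_0$ is the space of measurable $f:\mathbb{R}_+\to\mathbb{R}$ with $\int_0^\infty\frac{|f(x)|}{1+x}\,dx<\infty$. Let $u\in L^\infty(\mathbb{R}_+)$ be real valued. (i) If $\lambda\ge1$ and $u\in C^\alpha_+\cap L_0$ for some $0<\alpha<1$, then $\Delta_\lambda^\sigma u$ is a continuous function on $\mathbb{R}_+$ for every $0<\sigma<\alpha/2$, and $$\lim_{\sigma\to0^+}\Delta_\lambda^\sigma u(x)=u(x)\quad\text{for all }x\in\mathbb{R}_+.$$ (ii) If $\lambda\ge2$, $u\in C^2(\mathbb{R}_+)$ and $u'\in L^\infty(\mathbb{R}_+)$, then $\Delta_\lambda^\sigma u$ is a continuous function on $\mathbb{R}_+$ for every $1/2\le\sigma<1$, and $$\lim_{\sigma\to1^-}\Delta_\lambda^\sigma u(x)=\Delta_\lambda u(x)\quad\text{for all }x\in\mathbb{R}_+.$$ -/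

import Mathlib

open MeasureTheory Filter Topology Set
open scoped ENNReal ContDiff

noncomputable section

namespace FracBessel

/-- The Bessel function of the first kind `J_ν(z)`, for `z > 0`, by its power series. -/
def besselJ (ν z : ℝ) : ℝ :=
  ∑' k : ℕ, (-1 : ℝ) ^ k / ((k.factorial : ℝ) * Real.Gamma ((k : ℝ) + ν + 1))
    * (z / 2) ^ (2 * (k : ℝ) + ν)

/-- The Hankel transform on `(0, ∞)`:
`h_λ f (x) = ∫₀^∞ √(xy) J_{λ - 1/2}(xy) f(y) dy`. -/
def hankel (lam : ℝ) (f : ℝ → ℝ) (x : ℝ) : ℝ :=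
  ∫ y in Ioi (0 : ℝ), Real.sqrt (x * y) * besselJ (lam - 1 / 2) (x * y) * f y

/-- The fractional Bessel operator on test functions:
`Δ_λ^σ φ = h_λ (y^{2σ} h_λ φ)`. -/
def fracTest (lam σ : ℝ) (φ : ℝ → ℝ) : ℝ → ℝ :=
  hankel lam (fun y => y ^ (2 * σ) * hankel lam φ y)

/-- The test functions `C_c^∞((0, ∞))`. -/
structure IsTest (φ : ℝ → ℝ) : Prop where
  smooth : ContDiff ℝ ∞ φ
  compact : HasCompactSupport φ
  support : tsupport φ ⊆ Ioi 0

/-- The functional `Δ_λ^σ u`, defined by transposition as `φ ↦ ∫₀^∞ u Δ_λ^σ φ`, is on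
`(0, ∞)` the continuous function `g`. Integrability of `u Δ_λ^σ φ` is part of the notion. -/
structure IsFracBessel (lam σ : ℝ) (u g : ℝ → ℝ) : Prop where
  continuousOn : ContinuousOn g (Ioi 0)
  integrable : ∀ φ : ℝ → ℝ, IsTest φ →
    IntegrableOn (fun x => u x * fracTest lam σ φ x) (Ioi 0)
  pairing : ∀ φ : ℝ → ℝ, IsTest φ →
    ∫ x in Ioi (0 : ℝ), u x * fracTest lam σ φ x = ∫ x in Ioi (0 : ℝ), g x * φ x

/-- The continuous function representing `Δ_λ^σ u` is unique on `(0, ∞)`. -/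
theorem IsFracBessel.eqOn {lam σ : ℝ} {u g₁ g₂ : ℝ → ℝ}
    (h₁ : IsFracBessel lam σ u g₁) (h₂ : IsFracBessel lam σ u g₂) :
    EqOn g₁ g₂ (Ioi 0) := by
  have hint : ∀ g : ℝ → ℝ, ContinuousOn g (Ioi 0) → ∀ φ : ℝ → ℝ, IsTest φ →
      Integrable (fun x => g x * φ x) := by
    intro g hg φ hφ
    apply Continuous.integrable_of_hasCompactSupport
    · rw [continuous_iff_continuousAt]
      intro x
      by_cases hx : x ∈ tsupport φ
      · exact (hg.continuousAt (isOpen_Ioi.mem_nhds (hφ.support hx))).mul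
          hφ.smooth.continuous.continuousAt
      · have hz : (fun y => g y * φ y) =ᶠ[𝓝 x] fun _ => 0 := by
          filter_upwards [(isClosed_tsupport φ).isOpen_compl.mem_nhds hx] with y hy
          rw [image_eq_zero_of_notMem_tsupport hy, mul_zero]
        exact continuousAt_const.congr hz.symm
    · exact hφ.compact.mul_left
  have hae : ∀ᵐ x, x ∈ Ioi (0 : ℝ) → g₁ x - g₂ x = 0 := by
    apply isOpen_Ioi.ae_eq_zero_of_integral_contDiff_smul_eq_zero
    · exact (h₁.continuousOn.sub h₂.continuousOn).locallyIntegrableOn measurableSet_Ioi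
    · intro φ hs hc hsup
      have hφ : IsTest φ := ⟨hs, hc, hsup⟩
      have key := (h₁.pairing φ hφ).symm.trans (h₂.pairing φ hφ)
      have ext : ∀ g : ℝ → ℝ,
          ∫ x in Ioi (0 : ℝ), g x * φ x = ∫ x, g x * φ x := by
        intro g
        apply setIntegral_eq_integral_of_forall_compl_eq_zero
        intro x hx
        rw [image_eq_zero_of_notMem_tsupport (fun h => hx (hsup h)), mul_zero]
      rw [ext, ext] at key
      have : (fun x => φ x • (g₁ x - g₂ x)) = fun x => g₁ x * φ x - g₂ x * φ x := by
        funext x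
        simp only [smul_eq_mul]
        ring
      rw [this, integral_sub (hint g₁ h₁.continuousOn φ hφ) (hint g₂ h₂.continuousOn φ hφ),
        key, sub_self]
  refine Measure.eqOn_open_of_ae_eq (μ := volume) ?_ isOpen_Ioi h₁.continuousOn h₂.continuousOn
  rw [EventuallyEq, ae_restrict_iff' measurableSet_Ioi]
  filter_upwards [hae] with x hx h
  exact sub_eq_zero.mp (hx h)

open Classical in
/-- The function `Δ_λ^σ u` on `(0, ∞)`: the continuous function which represents the functional
`Δ_λ^σ u`, if there is one (it is then unique on `(0, ∞)`), and `0` otherwise. -/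
def fracBessel (lam σ : ℝ) (u : ℝ → ℝ) : ℝ → ℝ :=
  if h : ∃ g, IsFracBessel lam σ u g then h.choose else 0

/-- The Bessel operator `Δ_λ u = -u'' + λ(λ-1) x⁻² u`. -/
def bessel (lam : ℝ) (u : ℝ → ℝ) (x : ℝ) : ℝ :=
  -deriv (deriv u) x + lam * (lam - 1) / x ^ 2 * u x

/-- The Hölder class `C^α_+` on `(0, ∞)`: continuous functions for which both suprema in the norm
`sup |f(x) - f(y)| / |x - y|^α + sup x^{-α} |f(x)|` are finite. -/
structure HolderPlus (α : ℝ) (f : ℝ → ℝ) : Prop where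
  continuousOn : ContinuousOn f (Ioi 0)
  seminorm : ∃ C : ℝ, ∀ x > 0, ∀ y > 0, x ≠ y → |f x - f y| / |x - y| ^ α ≤ C
  weight : ∃ C : ℝ, ∀ x > 0, x ^ (-α) * |f x| ≤ C

/-- The weighted space `L_ρ`: `∫₀^∞ |f(x)| (1 + x)^{-1-2ρ} dx < ∞`. -/
def MemLrho (ρ : ℝ) (f : ℝ → ℝ) : Prop :=
  IntegrableOn (fun x => f x / (1 + x) ^ (1 + 2 * ρ)) (Ioi 0)

end FracBessel

end

noncomputable section

namespace FracBessel

/-! Everything goes through the heat semigroup e^{-tΔ_λ}, written `heat l t`. Inserting the identity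
∫₀^∞ (1 - e^{-tz²}) t^{-1-σ} dt = c_σ z^{2σ}, c_σ = `subordConst σ`, into the Hankel transform gives
c_σ Δ_λ^σ φ = ∫₀^∞ (φ - e^{-tΔ_λ}φ) t^{-1-σ} dt for test functions (`subordConst_mul_fracTest`). The
semigroup is symmetric, so transposition carries the formula over to a bounded continuous u as soon
as u - e^{-tΔ_λ}u = O(t^β) as t → 0, locally uniformly, for some β > σ (`isFracBessel_fracHeat`).
For Hölder u one may take β = α/2, for C² functions β = 1.

The two limits are then Abelian. As σ → 0 the weight σ t^{-1-σ} only sees t → ∞; as σ → 1 the weight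
(1 - σ) t^{-σ} only sees t → 0. Hence σ c_σ → 1 and (1 - σ) c_σ → 1, while the integrals, scaled
alike, tend to lim_{t→∞} (u - e^{-tΔ_λ}u)(x) and lim_{t→0} (u - e^{-tΔ_λ}u)(x)/t. The first is u(x),
since u ∈ L_0 forces e^{-tΔ_λ}u(x) → 0 (`tendsto_heat_atTop`); the second is Δ_λ u(x), the generator
of the semigroup (`tendsto_sub_heat_div`).

All facts about the semigroup are read off its kernel. By Weber's integral it is the Gauss kernel at
x - y times `heatFactor l z` with z = xy/(2t). Poisson's representation writes this factor as an
average of truncated powers against a Gamma density, whence 0 ≤ factor ≤ 1, 1 - factor ≤ λ²/(2z),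
and z(1 - factor) → λ(λ-1)/2. So the semigroup is dominated by the Gaussian one, and the deficit of
the factor produces the potential λ(λ-1)/x². -/

/-! ### Power series of Bessel functions and the Hankel kernel -/

/-- The entire function `∑ₖ wᵏ / (k! Γ(k + ν + 1))` underlying the Bessel functions of order `ν`. -/
def bes (ν w : ℝ) : ℝ := ∑' k : ℕ, w ^ k / ((k.factorial : ℝ) * Real.Gamma ((k : ℝ) + ν + 1))

/-- A positive lower bound for `Γ (k + ν + 1)`, uniformly in `k`. -/
lemma exists_le_Gamma {ν : ℝ} (hν : 0 ≤ ν) :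
    ∃ c > 0, ∀ k : ℕ, c ≤ Real.Gamma ((k : ℝ) + ν + 1) := by
  -- For k ≥ 1 the argument is at least 2, where Γ increases from Γ(2) = 1. The term k = 0 stands
  -- apart because Γ is not monotone on [1, 2].
  refine ⟨min (Real.Gamma (ν + 1)) 1, lt_min (Real.Gamma_pos_of_pos (by linarith)) one_pos, ?_⟩
  intro k
  rcases k with _ | k
  · simp
  · refine (min_le_right _ _).trans ?_
    have := Real.Gamma_strictMonoOn_Ici.monotoneOn (a := 2) (b := ((k + 1 : ℕ) : ℝ) + ν + 1)
      (by simp) (by simp only [mem_Ici]; push_cast; have : (0 : ℝ) ≤ k := k.cast_nonneg; linarith)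
      (by push_cast; have : (0 : ℝ) ≤ k := k.cast_nonneg; linarith)
    simpa [Real.Gamma_two] using this

lemma summable_bes {ν : ℝ} (hν : 0 ≤ ν) (w : ℝ) :
    Summable fun k : ℕ => w ^ k / ((k.factorial : ℝ) * Real.Gamma ((k : ℝ) + ν + 1)) := by
  obtain ⟨c, hc, h⟩ := exists_le_Gamma hν
  refine Summable.of_norm_bounded ((Real.summable_pow_div_factorial |w|).div_const c) ?_
  intro k
  have h0 : 0 < Real.Gamma ((k : ℝ) + ν + 1) := hc.trans_le (h k)
  have h1 : (0 : ℝ) < k.factorial := by positivity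
  rw [norm_div, norm_mul, norm_pow, Real.norm_eq_abs, Real.norm_eq_abs, Real.norm_eq_abs,
    abs_of_pos h0, abs_of_pos h1, div_div]
  gcongr
  exact h k

lemma bes_zero (ν : ℝ) : bes ν 0 = (Real.Gamma (ν + 1))⁻¹ := by
  rw [bes, tsum_eq_single 0]
  · simp
  · intro k hk; simp [hk]

lemma bes_nonneg {ν : ℝ} (hν : 0 ≤ ν) {w : ℝ} (hw : 0 ≤ w) : 0 ≤ bes ν w := by
  refine tsum_nonneg fun k => ?_
  have : 0 < Real.Gamma ((k : ℝ) + ν + 1) := Real.Gamma_pos_of_pos (by positivity)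
  positivity

/-- Γ(k+ν+2) = (k+ν+1) Γ(k+ν+1) and k+ν+1 = (ν+1) + k split each coefficient in two; the part with
the factor k loses its term k = 0 and becomes the series of order ν + 2 after a shift of index. -/
lemma bes_contiguous {ν : ℝ} (hν : 0 ≤ ν) (w : ℝ) :
    bes ν w = (ν + 1) * bes (ν + 1) w + w * bes (ν + 2) w := by
  have h1 := (summable_bes (ν := ν + 1) (by linarith) w).hasSum.mul_left (ν + 1)
  have h2 := (summable_bes (ν := ν + 2) (by linarith) w).hasSum.mul_left w
  have h3 : HasSum (fun k : ℕ => (k : ℝ) * w ^ k /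
      ((k.factorial : ℝ) * Real.Gamma ((k : ℝ) + ν + 2))) (w * bes (ν + 2) w) := by
    rw [hasSum_nat_add_iff' 1 |>.symm]
    simp only [Finset.range_one, Finset.sum_singleton, Nat.cast_zero, zero_mul, zero_div, sub_zero]
    convert! h2 using 2 with k
    have h0 : Real.Gamma ((k : ℝ) + (ν + 2) + 1) ≠ 0 :=
      (Real.Gamma_pos_of_pos (by positivity)).ne'
    have hk : ((k : ℝ) + 1) ≠ 0 := by positivity
    have hf : (k.factorial : ℝ) ≠ 0 := by positivity
    rw [Nat.factorial_succ, show ((k + 1 : ℕ) : ℝ) + ν + 2 = (k : ℝ) + (ν + 2) + 1 by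
      push_cast; ring, pow_succ]
    push_cast
    field_simp
  refine HasSum.tsum_eq ?_
  convert! h1.add h3 using 2 with k
  have h0 : Real.Gamma ((k : ℝ) + ν + 1) ≠ 0 := (Real.Gamma_pos_of_pos (by positivity)).ne'
  have hk : ((k : ℝ) + ν + 1) ≠ 0 := by positivity
  have hf : (k.factorial : ℝ) ≠ 0 := by positivity
  have hG : Real.Gamma ((k : ℝ) + ν + 2) = ((k : ℝ) + ν + 1) * Real.Gamma ((k : ℝ) + ν + 1) := by
    rw [← Real.Gamma_add_one hk]; ring_nf
  rw [show (k : ℝ) + (ν + 1) + 1 = (k : ℝ) + ν + 2 by ring, hG]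
  field_simp
  ring

/-- Termwise differentiation: k/k! = 1/(k-1)! shifts the index, and the shift inside Γ raises the
order by one. -/
lemma hasDerivAt_bes {ν : ℝ} (hν : 0 ≤ ν) (w : ℝ) : HasDerivAt (bes ν) (bes (ν + 1) w) w := by
  obtain ⟨c, hc, h⟩ := exists_le_Gamma hν
  set R : ℝ := |w| + 1
  have hR : 0 ≤ R := by positivity
  -- A majorant of the derivatives on |w| < R. The truncated exponent k - 1 at k = 0 is harmless
  -- because the factor k vanishes.
  have hu : Summable fun k : ℕ => (k : ℝ) * R ^ (k - 1) / ((k.factorial : ℝ) * c) := by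
    rw [← summable_nat_add_iff 1]
    convert! (Real.summable_pow_div_factorial R).div_const c using 2 with k
    have hk : ((k : ℝ) + 1) ≠ 0 := by positivity
    have hf : (k.factorial : ℝ) ≠ 0 := by positivity
    rw [Nat.factorial_succ]
    push_cast
    field_simp
  have key := hasDerivAt_tsum_of_isPreconnected (𝕜 := ℝ) (t := Ioo (-R) R) (y := w) (y₀ := 0)
    (g := fun (k : ℕ) w => w ^ k / ((k.factorial : ℝ) * Real.Gamma ((k : ℝ) + ν + 1)))
    (g' := fun (k : ℕ) w => (k : ℝ) * w ^ (k - 1) /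
      ((k.factorial : ℝ) * Real.Gamma ((k : ℝ) + ν + 1)))
    hu isOpen_Ioo isPreconnected_Ioo
    (fun k y _ => (hasDerivAt_pow k y).div_const _) ?_ ?_ (summable_bes hν 0) ?_
  · convert! key using 1
    rw [Summable.tsum_eq_zero_add]
    · simp only [Nat.cast_zero, zero_mul, zero_div, zero_add]
      refine tsum_congr fun k => ?_
      have h0 : Real.Gamma ((k : ℝ) + (ν + 1) + 1) ≠ 0 :=
        (Real.Gamma_pos_of_pos (by positivity)).ne'
      have hk : ((k : ℝ) + 1) ≠ 0 := by positivity
      have hf : (k.factorial : ℝ) ≠ 0 := by positivity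
      rw [Nat.factorial_succ, show ((k + 1 : ℕ) : ℝ) + ν + 1 = (k : ℝ) + (ν + 1) + 1 by
        push_cast; ring]
      push_cast
      field_simp
    · refine Summable.of_norm_bounded hu fun k => ?_
      have h0 : 0 < Real.Gamma ((k : ℝ) + ν + 1) := hc.trans_le (h k)
      rw [norm_div, norm_mul, norm_mul, norm_pow, Real.norm_of_nonneg h0.le, RCLike.norm_natCast,
        RCLike.norm_natCast, Real.norm_eq_abs]
      gcongr
      · simp [R]
      · exact h k
  · intro k y hy
    have h0 : 0 < Real.Gamma ((k : ℝ) + ν + 1) := hc.trans_le (h k)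
    rw [norm_div, norm_mul, norm_mul, norm_pow, Real.norm_of_nonneg h0.le, RCLike.norm_natCast,
      RCLike.norm_natCast, Real.norm_eq_abs]
    gcongr
    · exact (abs_lt.2 hy).le
    · exact h k
  · constructor <;> simp only [R] <;> have := abs_nonneg w <;> linarith
  · constructor <;> simp only [R]
    · linarith [neg_abs_le w]
    · linarith [le_abs_self w]

lemma continuous_bes {ν : ℝ} (hν : 0 ≤ ν) : Continuous (bes ν) :=
  continuous_iff_continuousAt.2 fun w => (hasDerivAt_bes hν w).continuousAt

/-- The kernel `√z J_{λ-1/2}(z)` of the Hankel transform. -/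
def hker (l z : ℝ) : ℝ := 2 ^ (1 / 2 - l) * z ^ l * bes (l - 1 / 2) (-(z ^ 2 / 4))

/-- Extracting √z (z/2)^(l-1/2) leaves an entire function of z², so continuity, derivatives and
bounds of the kernel reduce to those of `bes`. -/
lemma sqrt_mul_besselJ (l : ℝ) {z : ℝ} (hz : 0 < z) :
    Real.sqrt z * besselJ (l - 1 / 2) z = hker l z := by
  rw [besselJ, hker, bes, ← tsum_mul_left, ← tsum_mul_left]
  refine tsum_congr fun k => ?_
  have h2 : (z / 2) ^ (2 * (k : ℝ) + (l - 1 / 2)) =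
      z ^ (2 * k) / 4 ^ k * (z ^ (l - 1 / 2) * 2 ^ (1 / 2 - l)) := by
    rw [Real.rpow_add (by positivity), Real.div_rpow hz.le (by norm_num),
      Real.div_rpow hz.le (by norm_num), show (2 : ℝ) * (k : ℝ) = ((2 * k : ℕ) : ℝ) by push_cast; ring,
      Real.rpow_natCast, Real.rpow_natCast, pow_mul 2, show (1 / 2 - l : ℝ) = -(l - 1 / 2) by ring,
      Real.rpow_neg (by norm_num), show (2 : ℝ) ^ 2 = 4 by norm_num]
    ring
  have h3 : z ^ l = Real.sqrt z * z ^ (l - 1 / 2) := by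
    rw [Real.sqrt_eq_rpow, ← Real.rpow_add hz]; ring_nf
  rw [h2, h3, neg_pow (z ^ 2 / 4), div_pow, ← pow_mul]
  ring

lemma continuous_hker {l : ℝ} (hl : 1 ≤ l) : Continuous (hker l) := by
  unfold hker
  refine (continuous_const.mul (continuous_id.rpow_const fun x => Or.inr (by linarith))).mul ?_
  exact (continuous_bes (by linarith)).comp (by fun_prop)

lemma hankel_eq (l : ℝ) (f : ℝ → ℝ) {x : ℝ} (hx : 0 < x) :
    hankel l f x = ∫ y in Ioi (0 : ℝ), hker l (x * y) * f y := by
  refine setIntegral_congr_fun measurableSet_Ioi fun y hy => ?_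
  simp only [sqrt_mul_besselJ l (mul_pos hx hy)]

/-- The classical raising relation (z^{-ν} J_ν)' = -z^{-ν} J_{ν+1} with ν = l - 1/2. Together with
the lowering relation that follows it yields Bessel's equation. -/
lemma hasDerivAt_hker_mul_rpow {l : ℝ} (hl : 1 ≤ l) {z : ℝ} (hz : 0 < z) :
    HasDerivAt (fun z => z ^ (-l) * hker l z) (-(z ^ (-l) * hker (l + 1) z)) z := by
  have h1 : HasDerivAt (fun z : ℝ => 2 ^ (1 / 2 - l) * bes (l - 1 / 2) (-(z ^ 2 / 4)))
      (2 ^ (1 / 2 - l) * (bes (l + 1 / 2) (-(z ^ 2 / 4)) * (-(2 * z / 4)))) z := by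
    refine HasDerivAt.const_mul _ ?_
    have hd : HasDerivAt (fun z : ℝ => -(z ^ 2 / 4)) (-(2 * z / 4)) z := by
      simpa using ((hasDerivAt_pow 2 z).div_const 4).fun_neg
    have := (hasDerivAt_bes (ν := l - 1 / 2) (by linarith) (-(z ^ 2 / 4))).comp z hd
    rw [show l - 1 / 2 + 1 = l + 1 / 2 by ring] at this
    exact this
  have h2 : (fun z => z ^ (-l) * hker l z) =ᶠ[𝓝 z]
      fun z : ℝ => 2 ^ (1 / 2 - l) * bes (l - 1 / 2) (-(z ^ 2 / 4)) := by
    filter_upwards [lt_mem_nhds hz] with y hy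
    have : y ^ l ≠ 0 := (Real.rpow_pos_of_pos hy l).ne'
    rw [hker, Real.rpow_neg hy.le]
    field_simp
  refine (h1.congr_of_eventuallyEq h2).congr_deriv ?_
  have : z ^ l ≠ 0 := (Real.rpow_pos_of_pos hz l).ne'
  rw [hker, Real.rpow_neg hz.le, Real.rpow_add hz, Real.rpow_one,
    show (1 / 2 - (l + 1) : ℝ) = (1 / 2 - l) - 1 by ring, Real.rpow_sub_one (by norm_num : (2:ℝ) ≠ 0),
    show l + 1 - 1 / 2 = l + 1 / 2 by ring]
  field_simp
  ring

/-- The lowering relation (z^{ν+1} J_{ν+1})' = z^{ν+1} J_ν with ν = l - 1/2: differentiate z^{2l+1}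
times the function of the raising relation at l + 1, and collapse the two resulting orders by
`bes_contiguous`. -/
lemma hasDerivAt_rpow_mul_hker {l : ℝ} (hl : 1 ≤ l) {z : ℝ} (hz : 0 < z) :
    HasDerivAt (fun z => z ^ l * hker (l + 1) z) (z ^ l * hker l z) z := by
  have h1 := ((hasDerivAt_hker_mul_rpow (l := l + 1) (by linarith) hz)).mul
    (Real.hasDerivAt_rpow_const (x := z) (p := 2 * l + 1) (Or.inl hz.ne'))
  have h2 : (fun z => z ^ l * hker (l + 1) z) =ᶠ[𝓝 z]
      fun z => (z ^ (-(l + 1)) * hker (l + 1) z) * z ^ (2 * l + 1) := by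
    filter_upwards [lt_mem_nhds hz] with y hy
    rw [mul_right_comm, ← Real.rpow_add hy]
    ring_nf
  refine (h1.congr_of_eventuallyEq h2).congr_deriv ?_
  have e : ∀ p q : ℝ, z ^ (p + q) = z ^ p * z ^ q := Real.rpow_add hz
  have hc := bes_contiguous (ν := l - 1 / 2) (by linarith) (-(z ^ 2 / 4))
  have hzl : z ^ l ≠ 0 := (Real.rpow_pos_of_pos hz l).ne'
  simp only [hker]
  rw [hc, Real.rpow_neg hz.le, show (1 / 2 - (l + 1) : ℝ) = (1 / 2 - l) - 1 by ring,
    show (1 / 2 - (l + 1 + 1) : ℝ) = (1 / 2 - l) - 1 - 1 by ring,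
    Real.rpow_sub_one (by norm_num : (2:ℝ) ≠ 0), Real.rpow_sub_one (by norm_num : (2:ℝ) ≠ 0),
    show l + 1 - 1 / 2 = l - 1 / 2 + 1 by ring, show l + 1 + 1 - 1 / 2 = l - 1 / 2 + 2 by ring,
    show 2 * l + 1 - 1 = l + l by ring, show 2 * l + 1 = l + l + 1 by ring]
  simp only [e, Real.rpow_one]
  field_simp
  ring

/-! ### Beta integrals and Poisson's representation -/

lemma integral_beta {a b : ℝ} (ha : 0 < a) (hb : 0 < b) :
    ∫ x in Ioo (0 : ℝ) 1, x ^ (a - 1) * (1 - x) ^ (b - 1) =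
      Real.Gamma a * Real.Gamma b / Real.Gamma (a + b) := by
  have h := ProbabilityTheory.beta_eq_betaIntegralReal a b ha hb
  rw [ProbabilityTheory.beta] at h
  rw [h, Complex.betaIntegral, intervalIntegral.integral_of_le (by norm_num),
    ← integral_Ioc_eq_integral_Ioo, ← RCLike.re_to_complex, ← integral_re]
  · refine setIntegral_congr_fun measurableSet_Ioc fun x ⟨hx1, hx2⟩ ↦ ?_
    norm_cast
    rw [← Complex.ofReal_cpow, ← Complex.ofReal_cpow, RCLike.re_to_complex,
      Complex.re_mul_ofReal, Complex.ofReal_re]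
    all_goals linarith
  · convert! Complex.betaIntegral_convergent (u := a) (v := b) (by simpa) (by simpa)
    rw [intervalIntegrable_iff_integrableOn_Ioc_of_le (by simp), IntegrableOn]

lemma integral_one_sub_sq_rpow_mul_pow {l : ℝ} (hl : 1 ≤ l) (k : ℕ) :
    ∫ s in (0 : ℝ)..1, (1 - s ^ 2) ^ (l - 1) * s ^ (2 * k) =
      Real.Gamma (k + 1 / 2) * Real.Gamma l / (2 * Real.Gamma (k + 1 / 2 + l)) := by
  have hk : (0 : ℝ) < k + 1 / 2 := by positivity
  -- The substitution x = s² in the Beta integral. It is available on the half line, hence the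
  -- cut-off by an indicator.
  have h1 := integral_comp_rpow_Ioi_of_pos (p := 2) (by norm_num)
    (g := (Ioo (0 : ℝ) 1).indicator fun x => x ^ ((k : ℝ) + 1 / 2 - 1) * (1 - x) ^ (l - 1))
  rw [setIntegral_indicator measurableSet_Ioo,
    show Ioi (0 : ℝ) ∩ Ioo 0 1 = Ioo 0 1 by ext; simp +contextual,
    integral_beta hk (by linarith)] at h1
  rw [intervalIntegral.integral_of_le (by norm_num), integral_Ioc_eq_integral_Ioo]
  have h2 : ∀ x ∈ Ioi (0 : ℝ), ((2 : ℝ) * x ^ ((2 : ℝ) - 1)) •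
      ((Ioo (0 : ℝ) 1).indicator fun x => x ^ ((k : ℝ) + 1 / 2 - 1) * (1 - x) ^ (l - 1))
        (x ^ (2 : ℝ)) =
      (Ioo (0 : ℝ) 1).indicator (fun s => 2 * ((1 - s ^ 2) ^ (l - 1) * s ^ (2 * k))) x := by
    intro x hx
    have hx : 0 < x := hx
    have e : x ^ (2 : ℝ) = x ^ 2 := by norm_cast
    rw [e]
    by_cases h : x < 1
    · rw [indicator_of_mem, indicator_of_mem (show x ∈ Ioo (0 : ℝ) 1 from ⟨hx, h⟩)]
      · rw [smul_eq_mul, ← Real.rpow_natCast x 2, ← Real.rpow_mul hx.le, ← Real.rpow_natCast x]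
        have : x ^ ((2 : ℝ) - 1) * x ^ (((2 : ℕ) : ℝ) * ((k : ℝ) + 1 / 2 - 1)) =
            x ^ ((2 * k : ℕ) : ℝ) := by
          rw [← Real.rpow_add hx]; push_cast; ring_nf
        rw [← this]
        ring
      · constructor <;> nlinarith
    · rw [indicator_of_notMem, indicator_of_notMem (show x ∉ Ioo (0 : ℝ) 1 from fun h' => h h'.2),
        smul_zero]
      rintro ⟨_, h'⟩
      nlinarith
  rw [setIntegral_congr_fun measurableSet_Ioi h2, setIntegral_indicator measurableSet_Ioo,
    show Ioi (0 : ℝ) ∩ Ioo 0 1 = Ioo 0 1 by ext; simp +contextual, integral_const_mul] at h1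
  have := (Real.Gamma_pos_of_pos (show (0 : ℝ) < k + 1 / 2 + l by linarith)).ne'
  field_simp at h1 ⊢
  linarith

/-- Duplication formula: it trades the (2k)! of the cosine series for the k! Γ(k+1/2) produced by
the Beta integrals. -/
lemma factorial_two_mul_mul_sqrt_pi (k : ℕ) :
    ((2 * k).factorial : ℝ) * Real.sqrt Real.pi = 4 ^ k * k.factorial * Real.Gamma (k + 1 / 2) := by
  induction k with
  | zero => simpa using Real.Gamma_one_half_eq.symm
  | succ k ih =>
    have h : Real.Gamma (((k + 1 : ℕ) : ℝ) + 1 / 2) = (k + 1 / 2) * Real.Gamma (k + 1 / 2) := by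
      rw [← Real.Gamma_add_one (by positivity)]; push_cast; ring_nf
    rw [h, show 2 * (k + 1) = 2 * k + 1 + 1 by ring, Nat.factorial_succ, Nat.factorial_succ,
      Nat.factorial_succ]
    push_cast
    linear_combination (2 * (k : ℝ) + 1 + 1) * (2 * k + 1) * ih

/-- Poisson's integral representation. -/
lemma bes_eq_integral {l : ℝ} (hl : 1 ≤ l) (w : ℝ) {C : ℝ → ℝ}
    (hC : ∀ s, HasSum (fun k : ℕ => (4 * w * s ^ 2) ^ k / ((2 * k).factorial : ℝ)) (C s)) :
    bes (l - 1 / 2) w = 2 / (Real.Gamma l * Real.sqrt Real.pi) *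
      ∫ s in (0 : ℝ)..1, (1 - s ^ 2) ^ (l - 1) * C s := by
  have hcont : Continuous fun s : ℝ => (1 - s ^ 2) ^ (l - 1) :=
    Continuous.rpow_const (by fun_prop) fun x => Or.inr (by linarith)
  have hsum : Summable fun k : ℕ => |4 * w| ^ k / ((2 * k).factorial : ℝ) := by
    refine Summable.of_nonneg_of_le (fun k => by positivity) (fun k => ?_)
      (Real.summable_pow_div_factorial |4 * w|)
    gcongr
    linarith
  -- The series of `C` is integrated term by term, each term being a Beta integral. `C` stays
  -- abstract so that one computation serves cos, cosh and the constant 1, that is w negative,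
  -- positive and zero.
  have h := intervalIntegral.hasSum_integral_of_dominated_convergence (μ := volume)
    (a := 0) (b := 1) (f := fun s => (1 - s ^ 2) ^ (l - 1) * C s)
    (F := fun (k : ℕ) s => (1 - s ^ 2) ^ (l - 1) * ((4 * w * s ^ 2) ^ k / ((2 * k).factorial : ℝ)))
    (fun k _ => |4 * w| ^ k / ((2 * k).factorial : ℝ))
    (fun k => (hcont.mul (by fun_prop)).aestronglyMeasurable) ?_
    (ae_of_all _ fun s _ => hsum) (by simp) (ae_of_all _ fun s _ => (hC s).mul_left _)
  · have h2 := h.mul_left (2 / (Real.Gamma l * Real.sqrt Real.pi))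
    refine HasSum.tsum_eq ?_
    convert! h2 using 2 with k
    have e : ∀ s : ℝ, (1 - s ^ 2) ^ (l - 1) * ((4 * w * s ^ 2) ^ k / ((2 * k).factorial : ℝ)) =
        ((4 * w) ^ k / ((2 * k).factorial : ℝ)) * ((1 - s ^ 2) ^ (l - 1) * s ^ (2 * k)) := by
      intro s; rw [mul_pow _ (s ^ 2), ← pow_mul]; ring
    simp only [e]
    rw [intervalIntegral.integral_const_mul, integral_one_sub_sq_rpow_mul_pow hl]
    have h1 : Real.Gamma l ≠ 0 := (Real.Gamma_pos_of_pos (by linarith)).ne'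
    have h3 : Real.Gamma ((k : ℝ) + 1 / 2 + l) ≠ 0 := (Real.Gamma_pos_of_pos (by positivity)).ne'
    have h4 := factorial_two_mul_mul_sqrt_pi k
    have h5 : Real.sqrt Real.pi ≠ 0 := by positivity
    have h6 : ((2 * k).factorial : ℝ) ≠ 0 := by positivity
    have h7 : (k.factorial : ℝ) ≠ 0 := by positivity
    rw [show (k : ℝ) + (l - 1 / 2) + 1 = k + 1 / 2 + l by ring]
    rw [show 2 / (Real.Gamma l * Real.sqrt Real.pi) * ((4 * w) ^ k / ((2 * k).factorial : ℝ) *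
      (Real.Gamma (k + 1 / 2) * Real.Gamma l / (2 * Real.Gamma (k + 1 / 2 + l)))) =
      (w ^ k * (4 ^ k * Real.Gamma (k + 1 / 2))) /
        (((2 * k).factorial * Real.sqrt Real.pi) * Real.Gamma (k + 1 / 2 + l)) by
      rw [mul_pow]; field_simp, h4]
    have h8 : Real.Gamma ((k : ℝ) + 1 / 2) ≠ 0 := (Real.Gamma_pos_of_pos (by positivity)).ne'
    field_simp
  · intro k
    refine ae_of_all _ fun s hs => ?_
    rw [uIoc_of_le zero_le_one] at hs
    have hs2 : s ^ 2 ≤ 1 := pow_le_one₀ hs.1.le hs.2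
    have a1 : ‖(1 - s ^ 2) ^ (l - 1)‖ ≤ 1 := by
      rw [Real.norm_of_nonneg (Real.rpow_nonneg (by linarith) _)]
      exact Real.rpow_le_one (by linarith) (by nlinarith) (by linarith)
    rw [norm_mul, norm_div, norm_pow, norm_mul, RCLike.norm_natCast, Real.norm_eq_abs (4 * w),
      Real.norm_of_nonneg (sq_nonneg s)]
    calc _ ≤ 1 * ((|4 * w| * 1) ^ k / ((2 * k).factorial : ℝ)) := by gcongr
      _ = _ := by ring

/-- In Poisson's integral |cos| ≤ 1, so the value is at most the one at w = 0, where the same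
integral has integrand weight 1. -/
lemma abs_bes_neg_le {l : ℝ} (hl : 1 ≤ l) (z : ℝ) :
    |bes (l - 1 / 2) (-(z ^ 2 / 4))| ≤ (Real.Gamma (l + 1 / 2))⁻¹ := by
  have hcont : Continuous fun s : ℝ => (1 - s ^ 2) ^ (l - 1) :=
    Continuous.rpow_const (by fun_prop) fun x => Or.inr (by linarith)
  have h0 : bes (l - 1 / 2) 0 = _ := bes_eq_integral hl 0 (C := fun _ => 1) fun s => by
    convert! hasSum_ite_eq 0 (1 : ℝ) using 2 with k
    rcases k with _ | k <;> simp
  rw [bes_zero, show l - 1 / 2 + 1 = l + 1 / 2 by ring] at h0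
  rw [h0, bes_eq_integral hl (-(z ^ 2 / 4)) (C := fun s => Real.cos (z * s)) fun s => by
    convert! Real.hasSum_cos (z * s) using 2 with k
    rw [pow_mul, ← mul_pow]; ring, abs_mul, abs_of_nonneg
      (by have := Real.Gamma_pos_of_pos (show 0 < l by linarith); positivity)]
  have hG := Real.Gamma_pos_of_pos (show 0 < l by linarith)
  gcongr
  refine (intervalIntegral.abs_integral_le_integral_abs zero_le_one).trans ?_
  refine intervalIntegral.integral_mono_on zero_le_one
    (Continuous.intervalIntegrable (by fun_prop) _ _)
    (Continuous.intervalIntegrable (by fun_prop) _ _) fun s hs => ?_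
  have hs2 : s ^ 2 ≤ 1 := pow_le_one₀ hs.1 hs.2
  rw [abs_mul, abs_of_nonneg (Real.rpow_nonneg (by linarith) _)]
  exact mul_le_mul_of_nonneg_left (Real.abs_cos_le_one _) (Real.rpow_nonneg (by linarith) _)

/-- The growth z^l is not sharp at infinity, but it is enough: the kernel is always paired with a
compactly supported or rapidly decreasing function. -/
lemma exists_abs_hker_le {l : ℝ} (hl : 1 ≤ l) : ∃ C > 0, ∀ z, 0 ≤ z → |hker l z| ≤ C * z ^ l := by
  have hG := Real.Gamma_pos_of_pos (show 0 < l + 1 / 2 by linarith)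
  refine ⟨2 ^ (1 / 2 - l) * (Real.Gamma (l + 1 / 2))⁻¹, by positivity, fun z hz => ?_⟩
  have hz' : (0 : ℝ) ≤ z ^ l := Real.rpow_nonneg hz _
  rw [hker, abs_mul, abs_of_nonneg (by positivity : (0 : ℝ) ≤ 2 ^ (1 / 2 - l) * z ^ l)]
  calc _ ≤ 2 ^ (1 / 2 - l) * z ^ l * (Real.Gamma (l + 1 / 2))⁻¹ := by
        gcongr; exact abs_bes_neg_le hl z
    _ = _ := by ring

/-! ### The factor between the Bessel and the Gaussian heat kernels -/

/-- The factor `√(2πz) e⁻ᶻ I_{λ-1/2}(z)` by which the Bessel heat kernel differs from the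
Gaussian. -/
def heatFactor (l z : ℝ) : ℝ :=
  Real.sqrt Real.pi * 2 ^ (1 - l) * z ^ l * Real.exp (-z) * bes (l - 1 / 2) (z ^ 2 / 4)

lemma continuous_heatFactor {l : ℝ} (hl : 1 ≤ l) : Continuous (heatFactor l) := by
  unfold heatFactor
  refine ((continuous_const.mul (continuous_id.rpow_const fun x => Or.inr (by linarith))).mul
    (by fun_prop)).mul ?_
  exact (continuous_bes (by linarith)).comp (by fun_prop)

lemma heatFactor_nonneg {l : ℝ} (hl : 1 ≤ l) {z : ℝ} (hz : 0 ≤ z) : 0 ≤ heatFactor l z := by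
  have := bes_nonneg (ν := l - 1 / 2) (by linarith) (w := z ^ 2 / 4) (by positivity)
  have := Real.rpow_nonneg hz l
  unfold heatFactor
  positivity

/-- The truncated power `(1 - w)₊^(λ-1)`. -/
def truncPow (l w : ℝ) : ℝ := if w < 1 then (1 - w) ^ (l - 1) else 0

lemma truncPow_le_one {l : ℝ} (hl : 1 ≤ l) {w : ℝ} (hw : 0 ≤ w) : truncPow l w ≤ 1 := by
  unfold truncPow
  split_ifs with h
  · exact Real.rpow_le_one (by linarith) (by linarith) (by linarith)
  · norm_num

/-- Bernoulli's inequality. The exponent l - 1 may be less than 1, so it is first raised to l, which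
only decreases a power of 1 - w. -/
lemma one_sub_truncPow_le {l : ℝ} (hl : 1 ≤ l) {w : ℝ} (hw : 0 ≤ w) :
    1 - truncPow l w ≤ l * w := by
  unfold truncPow
  split_ifs with h
  · have h1 : (1 - w) ^ l ≤ (1 - w) ^ (l - 1) :=
      Real.rpow_le_rpow_of_exponent_ge (by linarith) (by linarith) (by linarith)
    have h2 := one_add_mul_self_le_rpow_one_add (s := -w) (by linarith) hl
    rw [← sub_eq_add_neg] at h2
    linarith
  · push Not at h
    nlinarith

lemma measurable_truncPow (l : ℝ) : Measurable (truncPow l) := by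
  unfold truncPow
  exact Measurable.ite measurableSet_Iio (by fun_prop) measurable_const

lemma tendsto_one_sub_truncPow_div (l : ℝ) :
    Tendsto (fun w => (1 - truncPow l w) / w) (𝓝[>] 0) (𝓝 (l - 1)) := by
  have h1 : HasDerivAt (fun w : ℝ => 1 - (1 - w) ^ (l - 1)) (l - 1) 0 := by
    have := ((hasDerivAt_id (0 : ℝ)).const_sub 1).rpow_const (p := l - 1) (by simp)
    simpa using this.const_sub 1
  have h2 := (hasDerivWithinAt_iff_tendsto_slope' (by simp)).1 (h1.hasDerivWithinAt (s := Ioi 0))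
  refine h2.congr' ?_
  filter_upwards [Ioo_mem_nhdsGT (show (0 : ℝ) < 1 by norm_num)] with w hw
  rw [truncPow, if_pos hw.2, slope_def_field]
  simp

/-- The basis of all estimates of the factor: up to normalization it is the mean of `truncPow l (v /
(2z))` when v has the Gamma density e^{-v} v^{l-1}/Γ(l). It comes from Poisson's integral with cosh,
made an exponential integral on [-1, 1]. -/
lemma heatFactor_eq_integral {l : ℝ} (hl : 1 ≤ l) {z : ℝ} (hz : 0 < z) :
    heatFactor l z = (Real.Gamma l)⁻¹ *
      ∫ v in Ioi (0 : ℝ), Real.exp (-v) * v ^ (l - 1) * truncPow l (v / (2 * z)) := by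
  have hcont : Continuous fun s : ℝ => (1 - s ^ 2) ^ (l - 1) :=
    Continuous.rpow_const (by fun_prop) fun x => Or.inr (by linarith)
  have hG := Real.Gamma_pos_of_pos (show 0 < l by linarith)
  have h1 : bes (l - 1 / 2) (z ^ 2 / 4) = _ :=
    bes_eq_integral hl (z ^ 2 / 4) (C := fun s => Real.cosh (z * s)) fun s => by
      convert! Real.hasSum_cosh (z * s) using 2 with k
      rw [pow_mul]; ring_nf
  -- The weight is even, so cosh on [0, 1] may be replaced by half of exp on [-1, 1].
  have h2 : ∫ s in (0 : ℝ)..1, (1 - s ^ 2) ^ (l - 1) * Real.cosh (z * s) =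
      (1 / 2) * ∫ s in (-1 : ℝ)..1, (1 - s ^ 2) ^ (l - 1) * Real.exp (z * s) := by
    have ii : ∀ a b : ℝ, IntervalIntegrable
        (fun s : ℝ => (1 - s ^ 2) ^ (l - 1) * Real.exp (z * s)) volume a b :=
      fun a b => Continuous.intervalIntegrable (by fun_prop) _ _
    have ii' : ∀ a b : ℝ, IntervalIntegrable
        (fun s : ℝ => (1 - s ^ 2) ^ (l - 1) * Real.exp (-(z * s))) volume a b :=
      fun a b => Continuous.intervalIntegrable (by fun_prop) _ _
    rw [← intervalIntegral.integral_add_adjacent_intervals (ii (-1) 0) (ii 0 1)]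
    have := intervalIntegral.integral_comp_neg (a := 0) (b := 1)
      (fun s : ℝ => (1 - s ^ 2) ^ (l - 1) * Real.exp (z * s))
    simp only [neg_zero, neg_sq, mul_neg] at this
    rw [← this, ← intervalIntegral.integral_add (ii' 0 1) (ii 0 1),
      ← intervalIntegral.integral_const_mul]
    refine intervalIntegral.integral_congr fun s _ => ?_
    simp only [Real.cosh_eq]
    ring
  -- The substitution s = 1 - v/z, under which 1 - s² = (2v/z)(1 - v/(2z)) and e^{zs} = e^z e^{-v}.
  have h3 := intervalIntegral.integral_comp_sub_div (a := 0) (b := 2 * z)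
    (fun s : ℝ => (1 - s ^ 2) ^ (l - 1) * Real.exp (z * s)) hz.ne' 1
  rw [show (1 : ℝ) - 2 * z / z = -1 by field_simp; norm_num, zero_div, sub_zero, smul_eq_mul] at h3
  have h4 : ∫ v in Ioi (0 : ℝ), Real.exp (-v) * v ^ (l - 1) * truncPow l (v / (2 * z)) =
      ∫ v in (0 : ℝ)..(2 * z), Real.exp (-v) * v ^ (l - 1) * (1 - v / (2 * z)) ^ (l - 1) := by
    rw [intervalIntegral.integral_of_le (by linarith), integral_Ioc_eq_integral_Ioo,
      ← integral_indicator measurableSet_Ioi, ← integral_indicator measurableSet_Ioo]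
    congr 1
    ext v
    by_cases hv : 0 < v
    · rw [indicator_of_mem (mem_Ioi.2 hv)]
      by_cases hv2 : v < 2 * z
      · rw [indicator_of_mem (show v ∈ Ioo 0 (2 * z) from ⟨hv, hv2⟩), truncPow, if_pos]
        rwa [div_lt_one (by linarith)]
      · rw [indicator_of_notMem (show v ∉ Ioo 0 (2 * z) from fun h => hv2 h.2), truncPow, if_neg, mul_zero]
        rwa [div_lt_one (by linarith)]
    · rw [indicator_of_notMem (show v ∉ Ioi 0 from hv),
        indicator_of_notMem (show v ∉ Ioo 0 (2 * z) from fun h => hv h.1)]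
  have h5 : ∫ v in (0 : ℝ)..(2 * z), (1 - (1 - v / z) ^ 2) ^ (l - 1) * Real.exp (z * (1 - v / z)) =
      (2 ^ (l - 1) * Real.exp z / z ^ (l - 1)) *
      ∫ v in (0 : ℝ)..(2 * z), Real.exp (-v) * v ^ (l - 1) * (1 - v / (2 * z)) ^ (l - 1) := by
    rw [← intervalIntegral.integral_const_mul]
    refine intervalIntegral.integral_congr fun v hv => ?_
    rw [uIcc_of_le (by linarith)] at hv
    have hw : 0 ≤ 1 - v / (2 * z) := by
      rw [sub_nonneg, div_le_one (by linarith)]; exact hv.2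
    rw [show 1 - (1 - v / z) ^ 2 = (2 * v / z) * (1 - v / (2 * z)) by field_simp; ring,
      Real.mul_rpow (div_nonneg (by linarith [hv.1]) hz.le) hw,
      Real.div_rpow (by linarith [hv.1]) hz.le, Real.mul_rpow (by norm_num) hv.1,
      show z * (1 - v / z) = z + -v by field_simp; ring, Real.exp_add]
    ring
  rw [h4, heatFactor, h1, h2]
  rw [h5] at h3
  have e1 : (2 : ℝ) ^ (l - 1) * 2 ^ (1 - l) = 1 := by
    rw [← Real.rpow_add (by norm_num)]; simp
  have e2 : z ^ l = z * z ^ (l - 1) := by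
    rw [← Real.rpow_one_add' hz.le (by linarith)]; ring_nf
  have e3 : Real.exp (-z) * Real.exp z = 1 := by rw [← Real.exp_add]; simp
  have hz1 : z ^ (l - 1) ≠ 0 := (Real.rpow_pos_of_pos hz _).ne'
  have hpi : Real.sqrt Real.pi ≠ 0 := by positivity
  set I := ∫ s in (-1 : ℝ)..1, (1 - s ^ 2) ^ (l - 1) * Real.exp (z * s)
  set J := ∫ v in (0 : ℝ)..(2 * z), Real.exp (-v) * v ^ (l - 1) * (1 - v / (2 * z)) ^ (l - 1)
  have h6 : z * z ^ (l - 1) * I = 2 ^ (l - 1) * Real.exp z * J := by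
    rw [mul_right_comm, ← h3]; field_simp
  have hGl := hG.ne'
  calc _ = (Real.Gamma l)⁻¹ * 2 ^ (1 - l) * Real.exp (-z) * (z * z ^ (l - 1) * I) := by
        rw [e2]; field_simp
    _ = (Real.Gamma l)⁻¹ * (2 ^ (l - 1) * 2 ^ (1 - l)) * (Real.exp (-z) * Real.exp z) * J := by
        rw [h6]; ring
    _ = _ := by rw [e1, e3]; ring

lemma integrableOn_truncPow {l : ℝ} (hl : 1 ≤ l) {z : ℝ} (hz : 0 < z) :
    IntegrableOn (fun v => Real.exp (-v) * v ^ (l - 1) * truncPow l (v / (2 * z))) (Ioi 0) := by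
  refine Integrable.mono' (Real.GammaIntegral_convergent (show 0 < l by linarith)) ?_ ?_
  · exact (Measurable.mul (by fun_prop)
      ((measurable_truncPow l).comp (by fun_prop))).aestronglyMeasurable
  · filter_upwards [ae_restrict_mem measurableSet_Ioi] with v hv
    have hv : 0 < v := hv
    have h0 : 0 ≤ truncPow l (v / (2 * z)) := by
      unfold truncPow
      split_ifs with h
      · exact Real.rpow_nonneg (by linarith) _
      · exact le_rfl
    have h1 := truncPow_le_one hl (w := v / (2 * z)) (by positivity)
    have h2 : 0 ≤ Real.exp (-v) * v ^ (l - 1) := by positivity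
    rw [Real.norm_of_nonneg (mul_nonneg h2 h0)]
    exact mul_le_of_le_one_right h2 h1

/-- The Gamma density has mass 1, so the deficit is the mean of 1 - `truncPow`. -/
lemma one_sub_heatFactor_eq {l : ℝ} (hl : 1 ≤ l) {z : ℝ} (hz : 0 < z) :
    1 - heatFactor l z = (Real.Gamma l)⁻¹ *
      ∫ v in Ioi (0 : ℝ), Real.exp (-v) * v ^ (l - 1) * (1 - truncPow l (v / (2 * z))) := by
  have hG := Real.Gamma_pos_of_pos (show 0 < l by linarith)
  simp only [mul_sub, mul_one]
  rw [integral_sub (Real.GammaIntegral_convergent (show 0 < l by linarith))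
    (integrableOn_truncPow hl hz), ← Real.Gamma_eq_integral (by linarith), mul_sub,
    inv_mul_cancel₀ hG.ne', heatFactor_eq_integral hl hz]

lemma integrableOn_Gamma_moment {l : ℝ} (hl : 1 ≤ l) :
    IntegrableOn (fun v => Real.exp (-v) * v ^ l) (Ioi 0) := by
  simpa using Real.GammaIntegral_convergent (show 0 < l + 1 by linarith)

lemma integral_Gamma_moment {l : ℝ} (hl : 1 ≤ l) :
    ∫ v in Ioi (0 : ℝ), Real.exp (-v) * v ^ l = l * Real.Gamma l := by
  rw [← Real.Gamma_add_one (by linarith), Real.Gamma_eq_integral (by linarith)]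
  simp

lemma heatFactor_le_one {l : ℝ} (hl : 1 ≤ l) {z : ℝ} (hz : 0 < z) : heatFactor l z ≤ 1 := by
  rw [← sub_nonneg, one_sub_heatFactor_eq hl hz]
  refine mul_nonneg (inv_nonneg.2 (Real.Gamma_pos_of_pos (by linarith)).le) ?_
  refine setIntegral_nonneg measurableSet_Ioi fun v hv => ?_
  have hv : 0 < v := hv
  have h1 := truncPow_le_one hl (w := v / (2 * z)) (by positivity)
  exact mul_nonneg (by positivity) (by linarith)

lemma exp_mul_one_sub_truncPow_le {l : ℝ} (hl : 1 ≤ l) {z v : ℝ} (hz : 0 < z) (hv : 0 < v) :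
    ‖Real.exp (-v) * v ^ (l - 1) * (1 - truncPow l (v / (2 * z)))‖ ≤
      l / (2 * z) * (Real.exp (-v) * v ^ l) := by
  have h1 := truncPow_le_one hl (w := v / (2 * z)) (by positivity)
  have h2 := one_sub_truncPow_le hl (w := v / (2 * z)) (by positivity)
  rw [Real.norm_of_nonneg (mul_nonneg (by positivity) (by linarith))]
  calc _ ≤ Real.exp (-v) * v ^ (l - 1) * (l * (v / (2 * z))) := by gcongr
    _ = l / (2 * z) * (Real.exp (-v) * (v ^ (l - 1) * v)) := by field_simp
    _ = _ := by rw [← Real.rpow_add_one hv.ne']; ring_nf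

/-- One factor l comes from `one_sub_truncPow_le`, the other is the mean Γ(l+1)/Γ(l) of the Gamma
density. -/
lemma one_sub_heatFactor_le {l : ℝ} (hl : 1 ≤ l) {z : ℝ} (hz : 0 < z) :
    1 - heatFactor l z ≤ l ^ 2 / (2 * z) := by
  have hG := Real.Gamma_pos_of_pos (show 0 < l by linarith)
  rw [one_sub_heatFactor_eq hl hz]
  have h := norm_integral_le_of_norm_le ((integrableOn_Gamma_moment hl).const_mul (l / (2 * z)))
    (f := fun v => Real.exp (-v) * v ^ (l - 1) * (1 - truncPow l (v / (2 * z))))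
    ((ae_restrict_mem measurableSet_Ioi).mono fun v hv => exp_mul_one_sub_truncPow_le hl hz hv)
  rw [integral_const_mul, integral_Gamma_moment hl] at h
  calc _ ≤ (Real.Gamma l)⁻¹ * (l / (2 * z) * (l * Real.Gamma l)) := by
        gcongr; exact (le_abs_self _).trans h
    _ = _ := by field_simp

/-- z (1 - `truncPow l (v / (2z))`) → (l-1)v/2, and v has mean l. This limit is the origin of the
potential in the generator of the heat semigroup. -/
lemma tendsto_mul_one_sub_heatFactor {l : ℝ} (hl : 1 ≤ l) :
    Tendsto (fun z => z * (1 - heatFactor l z)) atTop (𝓝 (l * (l - 1) / 2)) := by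
  have hG := Real.Gamma_pos_of_pos (show 0 < l by linarith)
  have h : Tendsto (fun z => ∫ v in Ioi (0 : ℝ),
      z * (Real.exp (-v) * v ^ (l - 1) * (1 - truncPow l (v / (2 * z))))) atTop
      (𝓝 (∫ v in Ioi (0 : ℝ), (l - 1) / 2 * (Real.exp (-v) * v ^ l))) := by
    refine tendsto_integral_filter_of_dominated_convergence
      (fun v => l / 2 * (Real.exp (-v) * v ^ l)) ?_ ?_
      ((integrableOn_Gamma_moment hl).const_mul (l / 2)) ?_
    · refine Eventually.of_forall fun z => Measurable.aestronglyMeasurable ?_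
      exact Measurable.const_mul (Measurable.mul (by fun_prop) (measurable_const.sub
        ((measurable_truncPow l).comp (by fun_prop)))) _
    · filter_upwards [eventually_gt_atTop 0] with z hz
      filter_upwards [ae_restrict_mem measurableSet_Ioi] with v hv
      rw [norm_mul, Real.norm_of_nonneg hz.le]
      calc _ ≤ z * (l / (2 * z) * (Real.exp (-v) * v ^ l)) := by
            gcongr; exact exp_mul_one_sub_truncPow_le hl hz hv
        _ = _ := by field_simp
    · filter_upwards [ae_restrict_mem measurableSet_Ioi] with v hv
      have hv : 0 < v := hv
      have h1 : Tendsto (fun z : ℝ => v / (2 * z)) atTop (𝓝[>] 0) := by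
        rw [tendsto_nhdsWithin_iff]
        refine ⟨tendsto_const_nhds.div_atTop (tendsto_id.const_mul_atTop two_pos), ?_⟩
        filter_upwards [eventually_gt_atTop 0] with z hz
        exact div_pos hv (by linarith)
      have h2 := ((tendsto_one_sub_truncPow_div l).comp h1).const_mul
        (Real.exp (-v) * v ^ l / 2)
      refine (h2.congr' ?_).trans (by rw [show Real.exp (-v) * v ^ l / 2 * (l - 1) =
        (l - 1) / 2 * (Real.exp (-v) * v ^ l) by ring])
      filter_upwards [eventually_gt_atTop 0] with z hz
      have : v ^ l = v ^ (l - 1) * v := by rw [← Real.rpow_add_one hv.ne']; ring_nf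
      simp only [Function.comp, this]
      field_simp
  have h2 := h.const_mul (Real.Gamma l)⁻¹
  rw [integral_const_mul, integral_Gamma_moment hl] at h2
  refine (h2.congr' ?_).trans (by
    rw [show (Real.Gamma l)⁻¹ * ((l - 1) / 2 * (l * Real.Gamma l)) = l * (l - 1) / 2 by
      field_simp])
  filter_upwards [eventually_gt_atTop 0] with z hz
  rw [integral_const_mul, one_sub_heatFactor_eq hl hz]
  ring

/-! ### Weber's integral and the heat kernel -/

/-- A form of the Chu–Vandermonde identity. -/
lemma sum_choose_mul_descFactorial_div_Gamma (k : ℕ) : ∀ {β : ℝ}, 0 < β → ∀ m : ℕ,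
    ∑ c ∈ Finset.range (k + 1), (k.choose c : ℝ) * ((m.descFactorial c : ℝ) / Real.Gamma (c + β)) =
      Real.Gamma (k + m + β) / (Real.Gamma (k + β) * Real.Gamma (m + β)) := by
  induction k with
  | zero =>
    intro β hβ m
    have := (Real.Gamma_pos_of_pos (show 0 < (m : ℝ) + β by positivity)).ne'
    have := (Real.Gamma_pos_of_pos hβ).ne'
    simp
    field_simp
  | succ k ih =>
    intro β hβ m
    have h := Finset.sum_choose_succ_mul (R := ℝ)
      (fun c _ => (m.descFactorial c : ℝ) / Real.Gamma (c + β)) k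
    rw [h, ih hβ m]
    have hk : (0 : ℝ) < k + β := by positivity
    have g1 := (Real.Gamma_pos_of_pos hk).ne'
    have e1 : Real.Gamma (((k + 1 : ℕ) : ℝ) + β) = (k + β) * Real.Gamma (k + β) := by
      rw [← Real.Gamma_add_one hk.ne']; push_cast; ring_nf
    rcases m with _ | m
    · simp only [Nat.cast_zero, add_zero, zero_add, Nat.zero_descFactorial_succ, zero_div, mul_zero,
        Finset.sum_const_zero]
      have := (Real.Gamma_pos_of_pos hβ).ne'
      rw [e1]
      field_simp
    · have hm : (0 : ℝ) < m + 1 + β := by positivity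
      have hkm : (0 : ℝ) < k + (m + 1) + β := by positivity
      have g2 := (Real.Gamma_pos_of_pos hm).ne'
      have e2 : Real.Gamma (((k + 1 : ℕ) : ℝ) + ((m + 1 : ℕ) : ℝ) + β) =
          (k + (m + 1) + β) * Real.Gamma (k + (m + 1) + β) := by
        rw [← Real.Gamma_add_one hkm.ne']; push_cast; ring_nf
      -- The second sum left by Pascal's rule has the same shape with m lowered and β raised by one;
      -- hence the induction lets β and m vary.
      have h2 : ∑ c ∈ Finset.range (k + 1), (k.choose c : ℝ) *
          (((m + 1).descFactorial (c + 1) : ℝ) / Real.Gamma (((c + 1 : ℕ) : ℝ) + β)) =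
          (m + 1) * ∑ c ∈ Finset.range (k + 1), (k.choose c : ℝ) *
            ((m.descFactorial c : ℝ) / Real.Gamma (c + (β + 1))) := by
        rw [Finset.mul_sum]
        refine Finset.sum_congr rfl fun c _ => ?_
        rw [Nat.succ_descFactorial_succ, show ((c + 1 : ℕ) : ℝ) + β = c + (β + 1) by
          push_cast; ring]
        push_cast
        ring
      have e3 : Real.Gamma ((k : ℝ) + (β + 1)) = (k + β) * Real.Gamma (k + β) := by
        rw [← Real.Gamma_add_one hk.ne']; ring_nf
      rw [h2, ih (by linarith) m, e1, e2, e3, show (m : ℝ) + (β + 1) = m + 1 + β by ring,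
        show (k : ℝ) + m + (β + 1) = k + (m + 1) + β by ring]
      push_cast
      field_simp
      ring

lemma hasSum_pow_div_factorial (X : ℝ) :
    HasSum (fun a : ℕ => X ^ a / (a.factorial : ℝ)) (Real.exp X) := by
  rw [Real.exp_eq_exp_ℝ]; exact NormedSpace.expSeries_div_hasSum_exp X

lemma hasSum_mul_real {ι κ : Type*} {f : ι → ℝ} {g : κ → ℝ} {a b : ℝ} (hf : HasSum f a)
    (hg : HasSum g b) : HasSum (fun q : ι × κ => f q.1 * g q.2) (a * b) :=
  hf.mul hg (summable_mul_of_summable_norm hf.summable.norm hg.summable.norm)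

lemma hasSum_exp_mul_exp_mul_bes {ν : ℝ} (hν : 0 ≤ ν) (X Y : ℝ) :
    HasSum (fun q : (ℕ × ℕ) × ℕ => X ^ q.1.1 / (q.1.1.factorial : ℝ) *
      (Y ^ q.1.2 / (q.1.2.factorial : ℝ)) *
        ((X * Y) ^ q.2 / ((q.2.factorial : ℝ) * Real.Gamma (q.2 + ν + 1))))
      (Real.exp X * Real.exp Y * bes ν (X * Y)) :=
  hasSum_mul_real (hasSum_mul_real (hasSum_pow_div_factorial X) (hasSum_pow_div_factorial Y))
    (summable_bes hν (X * Y)).hasSum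

/-- The double series that Weber's integral produces. Multiply out the three series on the right
with indices a, b, c and collect by k = a + c, m = b + c; the inner sum over c is
`sum_choose_mul_descFactorial_div_Gamma`. -/
lemma hasSum_bes_mul_exp {ν : ℝ} (hν : 0 ≤ ν) (X Y : ℝ) :
    HasSum (fun p : ℕ × ℕ => X ^ p.1 / ((p.1.factorial : ℝ) * Real.Gamma (p.1 + ν + 1)) *
      (Y ^ p.2 / ((p.2.factorial : ℝ) * Real.Gamma (p.2 + ν + 1))) *
        Real.Gamma (p.1 + p.2 + ν + 1)) (Real.exp X * Real.exp Y * bes ν (X * Y)) := by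
  let i : (ℕ × ℕ) × ℕ → (ℕ × ℕ) × ℕ := fun q => ((q.1.1 + q.2, q.1.2 + q.2), q.2)
  have hi : Function.Injective i := by
    rintro ⟨⟨a, b⟩, c⟩ ⟨⟨a', b'⟩, c'⟩ h
    simp only [i, Prod.mk.injEq] at h ⊢
    omega
  -- The binomial coefficient vanishes for c > k and the descending factorial for c > m, so `f`
  -- extends the reindexed series by zero off the range of `i`.
  let f : (ℕ × ℕ) × ℕ → ℝ := fun q => X ^ q.1.1 / (q.1.1.factorial : ℝ) *
    (Y ^ q.1.2 / (q.1.2.factorial : ℝ)) * ((q.1.1.choose q.2 : ℝ) *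
      ((q.1.2.descFactorial q.2 : ℝ) / Real.Gamma (q.2 + (ν + 1))))
  have hf : HasSum f (Real.exp X * Real.exp Y * bes ν (X * Y)) := by
    rw [← hi.hasSum_iff]
    · have e : f ∘ i = fun q : (ℕ × ℕ) × ℕ => X ^ q.1.1 / (q.1.1.factorial : ℝ) *
          (Y ^ q.1.2 / (q.1.2.factorial : ℝ)) *
            ((X * Y) ^ q.2 / ((q.2.factorial : ℝ) * Real.Gamma (q.2 + ν + 1))) := by
        funext ⟨⟨a, b⟩, c⟩
        simp only [f, i, Function.comp]
        have h1 : (((a + c).choose c : ℕ) : ℝ) * (a.factorial : ℝ) * (c.factorial : ℝ) =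
            ((a + c).factorial : ℝ) := by
          have := Nat.add_choose_mul_factorial_mul_factorial a c
          rw [← this]; push_cast; ring
        have h2 : (b.factorial : ℝ) * (((b + c).descFactorial c : ℕ) : ℝ) =
            ((b + c).factorial : ℝ) := by
          have := Nat.factorial_mul_descFactorial (n := b + c) (k := c) (by omega)
          rw [Nat.add_sub_cancel] at this
          exact_mod_cast this
        have h3 : (((a + c).choose c : ℕ) : ℝ) ≠ 0 := by
          exact_mod_cast (Nat.choose_pos (by omega)).ne'
        have h4 : (((b + c).descFactorial c : ℕ) : ℝ) ≠ 0 := by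
          exact_mod_cast (Nat.descFactorial_pos.2 (by omega)).ne'
        have h5 : (a.factorial : ℝ) ≠ 0 := by positivity
        have h6 : (b.factorial : ℝ) ≠ 0 := by positivity
        have h7 : (c.factorial : ℝ) ≠ 0 := by positivity
        have h8 : Real.Gamma ((c : ℝ) + (ν + 1)) ≠ 0 :=
          (Real.Gamma_pos_of_pos (by positivity)).ne'
        rw [← h1, ← h2, add_assoc (c : ℝ) ν 1, pow_add, pow_add, mul_pow]
        field_simp
      rw [e]
      exact hasSum_exp_mul_exp_mul_bes hν X Y
    · rintro ⟨⟨k, m⟩, c⟩ hq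
      have : k < c ∨ m < c := by
        by_contra! h
        exact hq ⟨((k - c, m - c), c), by
          simp only [i, Nat.sub_add_cancel h.1, Nat.sub_add_cancel h.2]⟩
      rcases this with h | h
      · simp [f, Nat.choose_eq_zero_of_lt h]
      · simp [f, Nat.descFactorial_eq_zero_iff_lt.2 h]
  refine hf.prod_fiberwise fun ⟨k, m⟩ => ?_
  have h := hasSum_sum_of_ne_finset_zero (L := SummationFilter.unconditional ℕ) (f := fun c => f ((k, m), c)) (s := Finset.range (k + 1))
    fun c hc => by
      have : k < c := by simpa using hc
      simp [f, Nat.choose_eq_zero_of_lt this]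
  convert! h using 1
  simp only [f]
  rw [← Finset.mul_sum, sum_choose_mul_descFactorial_div_Gamma k (by linarith) m]
  simp only [← add_assoc]
  ring

/-- The heat kernel of the Bessel operator. -/
def heatKernel (l t x y : ℝ) : ℝ :=
  (Real.sqrt (4 * Real.pi * t))⁻¹ * Real.exp (-(x - y) ^ 2 / (4 * t)) *
    heatFactor l (x * y / (2 * t))

lemma integral_rpow_mul_exp_neg_mul_sq {t : ℝ} (ht : 0 < t) {q : ℝ} (hq : -1 < q) :
    ∫ z in Ioi (0 : ℝ), z ^ q * Real.exp (-t * z ^ 2) =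
      t ^ (-(q + 1) / 2) * (1 / 2) * Real.Gamma ((q + 1) / 2) := by
  rw [← integral_rpow_mul_exp_neg_mul_rpow two_pos hq ht]
  simp only [Real.rpow_two]

/-- Weber's second exponential integral. -/
lemma integral_hker_mul_hker_mul_exp {l : ℝ} (hl : 1 ≤ l) {t x y : ℝ} (ht : 0 < t) (hx : 0 < x)
    (hy : 0 < y) :
    ∫ z in Ioi (0 : ℝ), hker l (x * z) * hker l (y * z) * Real.exp (-t * z ^ 2) =
      heatKernel l t x y := by
  have hν : 0 ≤ l - 1 / 2 := by linarith
  let A : ℝ := 2 ^ (1 / 2 - l) * 2 ^ (1 / 2 - l) * (x ^ l * y ^ l)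
  have hA : 0 ≤ A := by positivity
  let co : ℝ → ℕ → ℝ := fun w k => w ^ k / ((k.factorial : ℝ) * Real.Gamma (k + (l - 1 / 2) + 1))
  have hco : ∀ w, Summable (co w) := fun w => summable_bes hν w
  have hconorm : ∀ w k, ‖co w k‖ = co |w| k := fun w k => by
    have : 0 < Real.Gamma (k + (l - 1 / 2) + 1) := Real.Gamma_pos_of_pos (by positivity)
    simp only [co]
    rw [norm_div, norm_pow, Real.norm_eq_abs, Real.norm_of_nonneg (by positivity)]
  -- The general term of the product of the two kernel series; against the Gaussian it integrates to
  -- a value of Γ.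
  let F : ℕ × ℕ → ℝ → ℝ := fun p z => A * (co (-(x ^ 2 / 4)) p.1 * co (-(y ^ 2 / 4)) p.2) *
    (z ^ (2 * l + 2 * p.1 + 2 * p.2) * Real.exp (-t * z ^ 2))
  have hexp : ∀ p : ℕ × ℕ, -1 < 2 * l + 2 * (p.1 : ℝ) + 2 * p.2 := fun p => by
    have : (0 : ℝ) ≤ p.1 := p.1.cast_nonneg
    have : (0 : ℝ) ≤ p.2 := p.2.cast_nonneg
    linarith
  have hFint : ∀ p, Integrable (F p) (volume.restrict (Ioi 0)) := fun p =>
    (integrableOn_rpow_mul_exp_neg_mul_sq ht (hexp p)).const_mul _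
  have hval : ∀ (p : ℕ × ℕ) (a b : ℝ), A * (co a p.1 * co b p.2) *
      ∫ z in Ioi (0 : ℝ), z ^ (2 * l + 2 * (p.1 : ℝ) + 2 * p.2) * Real.exp (-t * z ^ 2) =
      A * t ^ (-(l + 1 / 2)) * (1 / 2) * (co (a / t) p.1 * co (b / t) p.2 *
        Real.Gamma (p.1 + p.2 + (l - 1 / 2) + 1)) := fun p a b => by
    rw [integral_rpow_mul_exp_neg_mul_sq ht (hexp p),
      show (2 * l + 2 * (p.1 : ℝ) + 2 * p.2 + 1) / 2 = p.1 + p.2 + (l - 1 / 2) + 1 by ring,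
      show -(2 * l + 2 * (p.1 : ℝ) + 2 * p.2 + 1) / 2 = -(l + 1 / 2) - p.1 - p.2 by ring,
      Real.rpow_sub ht, Real.rpow_sub ht, Real.rpow_natCast, Real.rpow_natCast]
    simp only [co, div_pow]
    ring
  have hFnorm : ∀ p z, 0 < z → ‖F p z‖ = A * (co (x ^ 2 / 4) p.1 * co (y ^ 2 / 4) p.2) *
      (z ^ (2 * l + 2 * (p.1 : ℝ) + 2 * p.2) * Real.exp (-t * z ^ 2)) := fun p z hz => by
    simp only [F]
    rw [norm_mul, norm_mul A, norm_mul (co _ _), hconorm, hconorm, abs_neg, abs_neg, Real.norm_of_nonneg hA,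
      abs_of_nonneg (by positivity), abs_of_nonneg (by positivity),
      Real.norm_of_nonneg (by positivity)]
  -- Norms only flip the signs of the arguments, so absolute summability is again
  -- `hasSum_bes_mul_exp`, at positive arguments.
  have hsum : Summable fun p => ∫ z in Ioi (0 : ℝ), ‖F p z‖ := by
    have : (fun p => ∫ z in Ioi (0 : ℝ), ‖F p z‖) = fun p : ℕ × ℕ =>
        A * t ^ (-(l + 1 / 2)) * (1 / 2) * (co (x ^ 2 / 4 / t) p.1 * co (y ^ 2 / 4 / t) p.2 *
        Real.Gamma (p.1 + p.2 + (l - 1 / 2) + 1)) := by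
      funext p
      rw [← hval, ← integral_const_mul]
      exact setIntegral_congr_fun measurableSet_Ioi fun z hz => hFnorm p z hz
    rw [this]
    exact ((hasSum_bes_mul_exp hν _ _).summable).mul_left _
  have h1 := hasSum_integral_of_summable_integral_norm hFint hsum
  have h2 : ∀ z ∈ Ioi (0 : ℝ), ∑' p, F p z =
      hker l (x * z) * hker l (y * z) * Real.exp (-t * z ^ 2) := by
    intro z hz
    have hz : 0 < z := hz
    have hX : HasSum (co (-((x * z) ^ 2 / 4))) (bes (l - 1 / 2) (-((x * z) ^ 2 / 4))) :=
      (hco _).hasSum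
    have hY : HasSum (co (-((y * z) ^ 2 / 4))) (bes (l - 1 / 2) (-((y * z) ^ 2 / 4))) :=
      (hco _).hasSum
    have h3 := ((hasSum_mul_real hX hY).mul_left
      (A * (z ^ l * z ^ l) * Real.exp (-t * z ^ 2))).tsum_eq
    rw [hker, hker, Real.mul_rpow hx.le hz.le, Real.mul_rpow hy.le hz.le]
    refine (Eq.trans (tsum_congr fun p => ?_) h3).trans ?_
    · simp only [F, co]
      rw [Real.rpow_add hz, Real.rpow_add hz, two_mul l, Real.rpow_add hz,
        show (2 : ℝ) * (p.1 : ℝ) = ((2 * p.1 : ℕ) : ℝ) by push_cast; ring,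
        show (2 : ℝ) * (p.2 : ℝ) = ((2 * p.2 : ℕ) : ℝ) by push_cast; ring,
        Real.rpow_natCast, Real.rpow_natCast, pow_mul, pow_mul,
        show -((x * z) ^ 2 / 4) = -(x ^ 2 / 4) * z ^ 2 by ring,
        show -((y * z) ^ 2 / 4) = -(y ^ 2 / 4) * z ^ 2 by ring, mul_pow _ (z ^ 2),
        mul_pow _ (z ^ 2)]
      ring
    · simp only [A]
      ring
  rw [setIntegral_congr_fun measurableSet_Ioi h2] at h1
  -- At the arguments -x²/(4t) and -y²/(4t) the exponentials decay, while the product of the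
  -- arguments is positive: J has become I.
  have h4 : HasSum (fun p => ∫ z in Ioi (0 : ℝ), F p z)
      (A * t ^ (-(l + 1 / 2)) * (1 / 2) * (Real.exp (-(x ^ 2 / 4) / t) *
        Real.exp (-(y ^ 2 / 4) / t) *
          bes (l - 1 / 2) ((-(x ^ 2 / 4) / t) * (-(y ^ 2 / 4) / t)))) := by
    have : (fun p => ∫ z in Ioi (0 : ℝ), F p z) = fun p : ℕ × ℕ =>
        A * t ^ (-(l + 1 / 2)) * (1 / 2) * (co (-(x ^ 2 / 4) / t) p.1 *
          co (-(y ^ 2 / 4) / t) p.2 * Real.Gamma (p.1 + p.2 + (l - 1 / 2) + 1)) := by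
      funext p
      rw [← hval, ← integral_const_mul]
    rw [this]
    exact (hasSum_bes_mul_exp hν _ _).mul_left _
  rw [h1.unique h4, heatKernel, heatFactor]
  have e1 : (-(x ^ 2 / 4) / t) * (-(y ^ 2 / 4) / t) = (x * y / (2 * t)) ^ 2 / 4 := by
    field_simp; norm_num
  have e2 : Real.exp (-(x - y) ^ 2 / (4 * t)) * Real.exp (-(x * y / (2 * t))) =
      Real.exp (-(x ^ 2 / 4) / t) * Real.exp (-(y ^ 2 / 4) / t) := by
    rw [← Real.exp_add, ← Real.exp_add]
    congr 1
    field_simp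
    ring
  have e3 : A * t ^ (-(l + 1 / 2)) * (1 / 2) = (Real.sqrt (4 * Real.pi * t))⁻¹ *
      (Real.sqrt Real.pi * 2 ^ (1 - l) * (x * y / (2 * t)) ^ l) := by
    simp only [A]
    rw [Real.div_rpow (by positivity) (by positivity), Real.mul_rpow hx.le hy.le,
      Real.mul_rpow two_pos.le ht.le, Real.rpow_neg ht.le, Real.rpow_add ht, ← Real.sqrt_eq_rpow,
      Real.sqrt_mul (by positivity), Real.sqrt_mul (by norm_num),
      show Real.sqrt 4 = 2 by rw [show (4 : ℝ) = 2 ^ 2 by norm_num]; simp,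
      ← Real.rpow_add two_pos, show (1 / 2 - l + (1 / 2 - l) : ℝ) = (1 - l) - l by ring,
      Real.rpow_sub two_pos (1 - l) l]
    field_simp
  rw [e1, e3, ← e2]
  ring

/-! ### Test functions and their Hankel transforms -/

lemma IsTest.eq_zero {φ : ℝ → ℝ} (hφ : IsTest φ) {x : ℝ} (hx : x ≤ 0) : φ x = 0 :=
  image_eq_zero_of_notMem_tsupport fun h => (hφ.support h : 0 < x).not_ge hx

lemma IsTest.mul_left {φ g : ℝ → ℝ} (hφ : IsTest φ) (hg : ContDiffOn ℝ ∞ g (Ioi 0)) :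
    IsTest fun x => g x * φ x := by
  refine ⟨contDiff_iff_contDiffAt.2 fun x => ?_, hφ.compact.mul_left,
    (tsupport_mul_subset_right).trans hφ.support⟩
  by_cases hx : x ∈ tsupport φ
  · exact (hg.contDiffAt (isOpen_Ioi.mem_nhds (hφ.support hx))).mul hφ.smooth.contDiffAt
  · refine contDiffAt_const (c := (0 : ℝ)) |>.congr_of_eventuallyEq ?_
    filter_upwards [(isClosed_tsupport φ).isOpen_compl.mem_nhds hx] with y hy
    rw [image_eq_zero_of_notMem_tsupport hy, mul_zero]

lemma IsTest.add {φ ψ : ℝ → ℝ} (hφ : IsTest φ) (hψ : IsTest ψ) : IsTest fun x => φ x + ψ x :=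
  ⟨hφ.smooth.add hψ.smooth, hφ.compact.add hψ.compact,
    (tsupport_add φ ψ).trans (union_subset hφ.support hψ.support)⟩

lemma IsTest.deriv {φ : ℝ → ℝ} (hφ : IsTest φ) : IsTest (deriv φ) :=
  ⟨(contDiff_infty_iff_deriv.1 hφ.smooth).2, hφ.compact.deriv,
    tsupport_deriv_subset.trans hφ.support⟩

lemma IsTest.bessel {φ : ℝ → ℝ} (hφ : IsTest φ) (l : ℝ) : IsTest (bessel l φ) := by
  have h1 := hφ.deriv.deriv.mul_left (g := fun _ => -1) contDiffOn_const
  have h2 := hφ.mul_left (g := fun x => l * (l - 1) / x ^ 2)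
    (contDiffOn_const.div (contDiffOn_id.pow 2) fun x hx => by
      have : 0 < x := hx
      exact pow_ne_zero 2 this.ne')
  convert! h1.add h2 using 2 with x
  simp only [FracBessel.bessel]
  ring

lemma IsTest.continuous_mul {φ g : ℝ → ℝ} (hφ : IsTest φ) (hg : ContinuousOn g (Ioi 0)) :
    Continuous fun x => g x * φ x := by
  rw [continuous_iff_continuousAt]
  intro x
  by_cases hx : x ∈ tsupport φ
  · exact (hg.continuousAt (isOpen_Ioi.mem_nhds (hφ.support hx))).mul
      hφ.smooth.continuous.continuousAt
  · refine continuousAt_const (y := (0 : ℝ)) |>.congr ?_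
    filter_upwards [(isClosed_tsupport φ).isOpen_compl.mem_nhds hx] with y hy
    rw [image_eq_zero_of_notMem_tsupport hy, mul_zero]

lemma IsTest.integrable_mul {φ g : ℝ → ℝ} (hφ : IsTest φ) (hg : ContinuousOn g (Ioi 0)) :
    Integrable fun x => g x * φ x :=
  (hφ.continuous_mul hg).integrable_of_hasCompactSupport hφ.compact.mul_left

lemma IsTest.setIntegral_eq {φ : ℝ → ℝ} (hφ : IsTest φ) (g : ℝ → ℝ) :
    ∫ x in Ioi (0 : ℝ), g x * φ x = ∫ x, g x * φ x :=
  setIntegral_eq_integral_of_forall_compl_eq_zero fun x hx => by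
    rw [hφ.eq_zero (not_lt.1 hx), mul_zero]

lemma hasDerivAt_hker {l : ℝ} (hl : 1 ≤ l) {z : ℝ} (hz : 0 < z) :
    HasDerivAt (hker l) (l / z * hker l z - hker (l + 1) z) z := by
  have h := (hasDerivAt_hker_mul_rpow hl hz).mul
    (Real.hasDerivAt_rpow_const (x := z) (p := l) (Or.inl hz.ne'))
  have e : hker l =ᶠ[𝓝 z] fun z => z ^ (-l) * hker l z * z ^ l := by
    filter_upwards [lt_mem_nhds hz] with y hy
    have : y ^ l ≠ 0 := (Real.rpow_pos_of_pos hy l).ne'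
    rw [Real.rpow_neg hy.le]; field_simp
  refine (h.congr_of_eventuallyEq e).congr_deriv ?_
  have : z ^ l ≠ 0 := (Real.rpow_pos_of_pos hz l).ne'
  rw [Real.rpow_neg hz.le, Real.rpow_sub_one hz.ne']
  field_simp
  ring

lemma hasDerivAt_hker_succ {l : ℝ} (hl : 1 ≤ l) {z : ℝ} (hz : 0 < z) :
    HasDerivAt (hker (l + 1)) (hker l z - l / z * hker (l + 1) z) z := by
  have h := (hasDerivAt_rpow_mul_hker hl hz).mul
    (Real.hasDerivAt_rpow_const (x := z) (p := -l) (Or.inl hz.ne'))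
  have e : hker (l + 1) =ᶠ[𝓝 z] fun z => z ^ l * hker (l + 1) z * z ^ (-l) := by
    filter_upwards [lt_mem_nhds hz] with y hy
    have : y ^ l ≠ 0 := (Real.rpow_pos_of_pos hy l).ne'
    rw [Real.rpow_neg hy.le]; field_simp
  refine (h.congr_of_eventuallyEq e).congr_deriv ?_
  have : z ^ l ≠ 0 := (Real.rpow_pos_of_pos hz l).ne'
  rw [Real.rpow_sub_one hz.ne', Real.rpow_neg hz.le]
  field_simp
  ring

/-- The derivative of `hker l`. -/
def hkerDeriv (l z : ℝ) : ℝ := l / z * hker l z - hker (l + 1) z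

/-- Bessel's equation. -/
lemma hasDerivAt_hkerDeriv {l : ℝ} (hl : 1 ≤ l) {z : ℝ} (hz : 0 < z) :
    HasDerivAt (hkerDeriv l) ((l * (l - 1) / z ^ 2 - 1) * hker l z) z := by
  have h := (((hasDerivAt_const z l).div (hasDerivAt_id z) hz.ne').mul (hasDerivAt_hker hl hz)).sub
    (hasDerivAt_hker_succ hl hz)
  refine h.congr_deriv ?_
  simp only [id, Pi.div_apply]
  field_simp
  ring

/-- Two integrations by parts at once: by Bessel's equation the difference of the integrands is the
derivative of the Wronskian of φ and y ↦ `hker l (x * y)`, which has compact support in (0, ∞). -/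
lemma hankel_bessel {l : ℝ} (hl : 1 ≤ l) {φ : ℝ → ℝ} (hφ : IsTest φ) {x : ℝ} (hx : 0 < x) :
    hankel l (bessel l φ) x = x ^ 2 * hankel l φ x := by
  have hd : ∀ y, 0 < y → HasDerivAt (fun y => hker l (x * y)) (x * hkerDeriv l (x * y)) y :=
    fun y hy => by
      have := (hasDerivAt_hker hl (mul_pos hx hy)).comp y ((hasDerivAt_id y).const_mul x)
      refine this.congr_deriv ?_
      simp only [hkerDeriv]; ring
  have hd2 : ∀ y, 0 < y → HasDerivAt (fun y => x * hkerDeriv l (x * y))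
      ((l * (l - 1) / y ^ 2 - x ^ 2) * hker l (x * y)) y := fun y hy => by
      have := ((hasDerivAt_hkerDeriv hl (mul_pos hx hy)).comp y
        ((hasDerivAt_id y).const_mul x)).const_mul x
      refine this.congr_deriv ?_
      field_simp
  have hc : ContinuousOn (fun y => hker l (x * y)) (Ioi 0) := fun y hy =>
    (hd y hy).continuousAt.continuousWithinAt
  have hc2 : ContinuousOn (fun y => x * hkerDeriv l (x * y)) (Ioi 0) := fun y hy =>
    (hd2 y hy).continuousAt.continuousWithinAt
  have hφ1 : ∀ y, HasDerivAt φ (deriv φ y) y := fun y =>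
    (hφ.smooth.differentiable (by simp)).differentiableAt.hasDerivAt
  have hφ2 : ∀ y, HasDerivAt (deriv φ) (deriv (deriv φ) y) y := fun y =>
    (hφ.deriv.smooth.differentiable (by simp)).differentiableAt.hasDerivAt
  have i1 := (hφ.bessel l).integrable_mul hc
  have i2 := (hφ.integrable_mul hc).const_mul (x ^ 2)
  have key := integral_eq_zero_of_hasDerivAt_of_integrable
    (f := fun y => x * hkerDeriv l (x * y) * φ y - hker l (x * y) * deriv φ y)
    (f' := fun y => hker l (x * y) * bessel l φ y - x ^ 2 * (hker l (x * y) * φ y)) ?_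
    (i1.sub i2) ((hφ.integrable_mul hc2).sub (hφ.deriv.integrable_mul hc))
  · rw [integral_sub i1 i2, integral_const_mul, sub_eq_zero] at key
    rw [hankel_eq l _ hx, hankel_eq l _ hx, hφ.setIntegral_eq, (hφ.bessel l).setIntegral_eq, key]
  · intro y
    by_cases hy : y ∈ tsupport φ
    · have hy : 0 < y := hφ.support hy
      have := ((hd2 y hy).mul (hφ1 y)).sub ((hd y hy).mul (hφ2 y))
      refine this.congr_deriv ?_
      simp only [bessel]
      ring
    -- Off the support the Wronskian vanishes near y, so no regularity of the kernel at y ≤ 0 is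
    -- needed.
    · have h0 : ∀ᶠ z in 𝓝 y, φ z = 0 := by
        filter_upwards [(isClosed_tsupport φ).isOpen_compl.mem_nhds hy] with z hz
        exact image_eq_zero_of_notMem_tsupport hz
      have h1 : ∀ᶠ z in 𝓝 y, deriv φ z = 0 := by
        filter_upwards [(isClosed_tsupport φ).isOpen_compl.mem_nhds hy] with z hz
        exact image_eq_zero_of_notMem_tsupport fun h => hz (tsupport_deriv_subset h)
      have h2 : deriv (deriv φ) y = 0 :=
        image_eq_zero_of_notMem_tsupport fun h =>
          hy (tsupport_deriv_subset (tsupport_deriv_subset h))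
      rw [bessel, h2, h0.self_of_nhds]
      simp only [neg_zero, mul_zero, add_zero, sub_zero]
      refine (hasDerivAt_const y (0 : ℝ)).congr_of_eventuallyEq ?_
      filter_upwards [h0, h1] with z hz hz1
      simp [hz, hz1]

lemma exists_abs_hankel_le {l : ℝ} (hl : 1 ≤ l) {φ : ℝ → ℝ} (hφ : IsTest φ) :
    ∃ C, 0 ≤ C ∧ ∀ x, 0 < x → |hankel l φ x| ≤ C * x ^ l := by
  obtain ⟨C, hC, h⟩ := exists_abs_hker_le hl
  have hi : Integrable fun y => y ^ l * φ y := hφ.integrable_mul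
    ((continuous_id.rpow_const fun x => Or.inr (by linarith)).continuousOn)
  refine ⟨C * ∫ y in Ioi (0 : ℝ), ‖y ^ l * φ y‖, by positivity, fun x hx => ?_⟩
  rw [hankel_eq l _ hx, ← Real.norm_eq_abs]
  refine (norm_integral_le_of_norm_le (hi.norm.integrableOn.const_mul (C * x ^ l)) ?_).trans ?_
  · filter_upwards [ae_restrict_mem measurableSet_Ioi] with y hy
    have hy : 0 < y := hy
    rw [norm_mul, norm_mul, Real.norm_of_nonneg (Real.rpow_nonneg hy.le l)]
    calc _ ≤ C * (x * y) ^ l * ‖φ y‖ := by gcongr; exact h _ (by positivity)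
      _ = _ := by rw [Real.mul_rpow hx.le hy.le]; ring
  · rw [integral_const_mul]
    apply le_of_eq; ring

/-- Rapid decay of the Hankel transform of a test function. -/
lemma exists_pow_mul_abs_hankel_le {l : ℝ} (hl : 1 ≤ l) (N : ℕ) : ∀ {φ : ℝ → ℝ}, IsTest φ →
    ∃ C, 0 ≤ C ∧ ∀ x, 0 < x → (x ^ 2) ^ N * |hankel l φ x| ≤ C * x ^ l := by
  induction N with
  | zero => intro φ hφ; simpa using exists_abs_hankel_le hl hφ
  | succ N ih =>
    intro φ hφ
    obtain ⟨C, hC, h⟩ := ih (hφ.bessel l)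
    refine ⟨C, hC, fun x hx => ?_⟩
    have := h x hx
    rwa [hankel_bessel hl hφ hx, abs_mul, abs_of_nonneg (sq_nonneg x), ← mul_assoc,
      ← pow_succ] at this

lemma aestronglyMeasurable_hankel {l : ℝ} (hl : 1 ≤ l) {φ : ℝ → ℝ} (hφ : IsTest φ) :
    AEStronglyMeasurable (hankel l φ) (volume.restrict (Ioi 0)) := by
  have h : StronglyMeasurable fun x => ∫ y in Ioi (0 : ℝ), hker l (x * y) * φ y := by
    have : Continuous fun p : ℝ × ℝ => hker l (p.1 * p.2) * φ p.2 :=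
      ((continuous_hker hl).comp (by fun_prop)).mul (hφ.smooth.continuous.comp continuous_snd)
    exact this.stronglyMeasurable.integral_prod_right
  refine h.aestronglyMeasurable.congr ?_
  filter_upwards [ae_restrict_mem measurableSet_Ioi] with x hx
  rw [hankel_eq l _ hx]

lemma integrableOn_rpow_mul_hankel {l : ℝ} (hl : 1 ≤ l) {φ : ℝ → ℝ} (hφ : IsTest φ) {q : ℝ}
    (hq : 0 ≤ q) : IntegrableOn (fun z => z ^ q * hankel l φ z) (Ioi 0) := by
  have hm : AEStronglyMeasurable (fun z => z ^ q * hankel l φ z) (volume.restrict (Ioi 0)) :=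
    (Measurable.aestronglyMeasurable (by fun_prop)).mul (aestronglyMeasurable_hankel hl hφ)
  rw [← Ioc_union_Ioi_eq_Ioi zero_le_one]
  refine IntegrableOn.union ?_ ?_
  · obtain ⟨C, hC, h⟩ := exists_abs_hankel_le hl hφ
    refine Integrable.mono' (integrable_const C) (hm.mono_set Ioc_subset_Ioi_self) ?_
    filter_upwards [ae_restrict_mem measurableSet_Ioc] with x hx
    rw [norm_mul, Real.norm_of_nonneg (Real.rpow_nonneg hx.1.le q)]
    calc _ ≤ 1 * (C * 1) := by
          gcongr
          · exact Real.rpow_le_one hx.1.le hx.2 hq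
          · refine (h x hx.1).trans ?_
            gcongr
            exact Real.rpow_le_one hx.1.le hx.2 (by linarith)
      _ = C := by ring
  -- This makes the exponent q + l - 2N smaller than -1.
  · obtain ⟨N, hN⟩ := exists_nat_gt (q + l + 1)
    obtain ⟨C, hC, h⟩ := exists_pow_mul_abs_hankel_le hl N hφ
    have hi := (integrableOn_Ioi_rpow_of_lt (a := q + l - 2 * N) (by
      have : (0 : ℝ) ≤ N := N.cast_nonneg
      linarith) one_pos).const_mul C
    refine Integrable.mono' hi (hm.mono_set (Ioi_subset_Ioi zero_le_one)) ?_
    filter_upwards [ae_restrict_mem measurableSet_Ioi] with x hx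
    have hx : 0 < x := zero_lt_one.trans hx
    have hx2 : x ^ (2 * (N : ℝ)) = (x ^ 2) ^ N := by
      rw [← pow_mul, ← Real.rpow_natCast]; push_cast; rfl
    rw [norm_mul, Real.norm_of_nonneg (Real.rpow_nonneg hx.le q), Real.rpow_sub hx,
      Real.rpow_add hx, hx2, Real.norm_eq_abs, ← mul_div_assoc, le_div_iff₀ (by positivity)]
    calc _ = x ^ q * ((x ^ 2) ^ N * |hankel l φ x|) := by ring
      _ ≤ x ^ q * (C * x ^ l) := mul_le_mul_of_nonneg_left (h x hx) (by positivity)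
      _ = _ := by ring

lemma integrableOn_hker_mul_rpow_mul_hankel {l : ℝ} (hl : 1 ≤ l) {φ : ℝ → ℝ} (hφ : IsTest φ)
    {q x : ℝ} (hq : 0 ≤ q) (hx : 0 < x) :
    IntegrableOn (fun z => hker l (x * z) * (z ^ q * hankel l φ z)) (Ioi 0) := by
  obtain ⟨C, hC, h⟩ := exists_abs_hker_le hl
  refine Integrable.mono' ((integrableOn_rpow_mul_hankel hl hφ (q := l + q)
    (by linarith)).norm.const_mul (C * x ^ l)) ?_ ?_
  · exact (((continuous_hker hl).comp (by fun_prop)).aestronglyMeasurable).mul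
      ((Measurable.aestronglyMeasurable (by fun_prop)).mul (aestronglyMeasurable_hankel hl hφ))
  · filter_upwards [ae_restrict_mem measurableSet_Ioi] with z hz
    have hz : 0 < z := hz
    rw [norm_mul, norm_mul, norm_mul, Real.rpow_add hz, norm_mul,
      Real.norm_of_nonneg (Real.rpow_nonneg hz.le l)]
    calc _ ≤ C * (x * z) ^ l * (‖z ^ q‖ * ‖hankel l φ z‖) := by
          gcongr; exact h _ (by positivity)
      _ = _ := by rw [Real.mul_rpow hx.le hz.le]; ring

/-! ### Gaussian bounds for the heat semigroup -/

/-- The heat semigroup of the Bessel operator. -/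
def heat (l t : ℝ) (f : ℝ → ℝ) (x : ℝ) : ℝ := ∫ y in Ioi (0 : ℝ), heatKernel l t x y * f y

/-- The Gauss kernel `(4πt)^{-1/2} e^{-r²/4t}`. -/
def gauss (t r : ℝ) : ℝ := (Real.sqrt (4 * Real.pi * t))⁻¹ * Real.exp (-r ^ 2 / (4 * t))

lemma gauss_nonneg (t r : ℝ) : 0 ≤ gauss t r := by unfold gauss; positivity

lemma gauss_eq (t r : ℝ) :
    gauss t r = (Real.sqrt (4 * Real.pi * t))⁻¹ * Real.exp (-(1 / (4 * t)) * r ^ 2) := by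
  unfold gauss; congr 2; ring

lemma continuous_gauss (t : ℝ) : Continuous (gauss t) := by unfold gauss; fun_prop

lemma integrable_gauss {t : ℝ} (ht : 0 < t) : Integrable (gauss t) := by
  simp only [funext (gauss_eq t)]
  exact (integrable_exp_neg_mul_sq (by positivity)).const_mul _

lemma integral_gauss {t : ℝ} (ht : 0 < t) : ∫ r, gauss t r = 1 := by
  simp only [gauss_eq]
  rw [integral_const_mul, integral_gaussian, show Real.pi / (1 / (4 * t)) = 4 * Real.pi * t by
    field_simp]
  exact inv_mul_cancel₀ (by positivity)

lemma integrable_mul_gauss {t : ℝ} (ht : 0 < t) : Integrable fun r => gauss t r * r := by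
  simp only [gauss_eq]
  have := (integrable_mul_exp_neg_mul_sq (b := 1 / (4 * t)) (by positivity)).const_mul
    (Real.sqrt (4 * Real.pi * t))⁻¹
  refine this.congr (ae_of_all _ fun r => ?_)
  simp only; ring

lemma integral_mul_gauss (t : ℝ) : ∫ r, gauss t r * r = 0 := by
  have h := integral_neg_eq_self (fun r => gauss t r * r) volume
  have e : ∀ r, gauss t (-r) * (-r) = -(gauss t r * r) := fun r => by
    simp [gauss]
  simp only [e, integral_neg] at h
  linarith

lemma integrable_sq_mul_gauss {t : ℝ} (ht : 0 < t) : Integrable fun r => gauss t r * r ^ 2 := by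
  simp only [gauss_eq]
  have := (integrable_rpow_mul_exp_neg_mul_sq (b := 1 / (4 * t)) (by positivity)
    (show (-1 : ℝ) < 2 by norm_num)).const_mul (Real.sqrt (4 * Real.pi * t))⁻¹
  refine this.congr (ae_of_all _ fun r => ?_)
  simp only [Real.rpow_two]; ring

lemma integral_sq_mul_gauss_one : ∫ r, gauss 1 r * r ^ 2 = 2 := by
  have h := integral_comp_abs (f := fun r => gauss 1 r * r ^ 2)
  have e : ∀ r, gauss 1 |r| * |r| ^ 2 = gauss 1 r * r ^ 2 := fun r => by
    simp [gauss]
  simp only [e] at h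
  rw [h]
  have h2 : ∫ r in Ioi (0 : ℝ), gauss 1 r * r ^ 2 = (Real.sqrt (4 * Real.pi))⁻¹ *
      ∫ r in Ioi (0 : ℝ), r ^ (2 : ℝ) * Real.exp (-(1 / 4) * r ^ 2) := by
    rw [← integral_const_mul]
    refine integral_congr_ae (ae_of_all _ fun r => ?_)
    simp only [Real.rpow_two, gauss_eq, mul_one]
    ring
  rw [h2, integral_rpow_mul_exp_neg_mul_sq (by norm_num) (by norm_num),
    show ((2 : ℝ) + 1) / 2 = 1 / 2 + 1 by norm_num, Real.Gamma_add_one (by norm_num),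
    Real.Gamma_one_half_eq, show -((2 : ℝ) + 1) / 2 = -(1 / 2) - 1 by norm_num,
    Real.rpow_sub_one (by norm_num), Real.rpow_neg (by norm_num), ← Real.sqrt_eq_rpow,
    Real.sqrt_mul (by norm_num), show Real.sqrt 4 = 2 by rw [show (4 : ℝ) = 2 ^ 2 by norm_num]; simp,
    show Real.sqrt (1 / 4) = 1 / 2 by
      rw [show (1 / 4 : ℝ) = (1 / 2) ^ 2 by norm_num]; exact Real.sqrt_sq (by norm_num)]
  have : Real.sqrt Real.pi ≠ 0 := by positivity
  field_simp
  norm_num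

lemma heatKernel_symm (l t x y : ℝ) : heatKernel l t x y = heatKernel l t y x := by
  unfold heatKernel
  rw [mul_comm x y, show -(x - y) ^ 2 = -(y - x) ^ 2 by ring]

lemma measurable_heatKernel {l : ℝ} (hl : 1 ≤ l) :
    Measurable fun p : ℝ × ℝ × ℝ => heatKernel l p.1 p.2.1 p.2.2 := by
  unfold heatKernel
  exact Measurable.mul (by fun_prop) ((continuous_heatFactor hl).measurable.comp (by fun_prop))

lemma heatKernel_nonneg {l t x y : ℝ} (hl : 1 ≤ l) (ht : 0 < t) (hx : 0 < x) (hy : 0 < y) :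
    0 ≤ heatKernel l t x y :=
  mul_nonneg (gauss_nonneg _ _) (heatFactor_nonneg hl (by positivity))

lemma heatKernel_le {l t x y : ℝ} (hl : 1 ≤ l) (ht : 0 < t) (hx : 0 < x) (hy : 0 < y) :
    heatKernel l t x y ≤ gauss t (x - y) :=
  mul_le_of_le_one_right (gauss_nonneg _ _) (heatFactor_le_one hl (by positivity))

lemma norm_heatKernel_le {l t x y : ℝ} (hl : 1 ≤ l) (ht : 0 < t) (hx : 0 < x) (hy : 0 < y) :
    ‖heatKernel l t x y‖ ≤ gauss t (x - y) := by
  rw [Real.norm_of_nonneg (heatKernel_nonneg hl ht hx hy)]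
  exact heatKernel_le hl ht hx hy

lemma measurable_heatKernel_right {l : ℝ} (hl : 1 ≤ l) (t x : ℝ) :
    Measurable (heatKernel l t x) :=
  (measurable_heatKernel hl).comp (by fun_prop : Measurable fun y : ℝ => (t, x, y))

lemma integrableOn_heatKernel {l t x : ℝ} (hl : 1 ≤ l) (ht : 0 < t) (hx : 0 < x) :
    IntegrableOn (heatKernel l t x) (Ioi 0) := by
  refine Integrable.mono' ((integrable_gauss ht).comp_sub_left x).integrableOn
    (measurable_heatKernel_right hl t x).aestronglyMeasurable ?_
  filter_upwards [ae_restrict_mem measurableSet_Ioi] with y hy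
  exact norm_heatKernel_le hl ht hx hy

/-- The semigroup is sub-Markovian, by comparison with the Gauss kernel. With the symmetry of the
kernel this gives contractivity in both L^∞ and L¹. -/
lemma integral_heatKernel_le_one {l t x : ℝ} (hl : 1 ≤ l) (ht : 0 < t) (hx : 0 < x) :
    ∫ y in Ioi (0 : ℝ), heatKernel l t x y ≤ 1 := by
  have hi := (integrable_gauss ht).comp_sub_left x
  calc _ ≤ ∫ y in Ioi (0 : ℝ), gauss t (x - y) :=
        setIntegral_mono_on (integrableOn_heatKernel hl ht hx) hi.integrableOn measurableSet_Ioi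
          fun y hy => heatKernel_le hl ht hx hy
    _ ≤ ∫ y, gauss t (x - y) :=
        setIntegral_le_integral hi (ae_of_all _ fun y => gauss_nonneg _ _)
    _ = 1 := by rw [integral_sub_left_eq_self (gauss t) volume x, integral_gauss ht]

lemma abs_heat_le {l t x M : ℝ} (hl : 1 ≤ l) (ht : 0 < t) (hx : 0 < x) {u : ℝ → ℝ}
    (hM : ∀ x, |u x| ≤ M) : |heat l t u x| ≤ M := by
  have hM0 : 0 ≤ M := (abs_nonneg _).trans (hM 0)
  rw [heat, ← Real.norm_eq_abs]
  refine (norm_integral_le_of_norm_le ((integrableOn_heatKernel hl ht hx).mul_const M) ?_).trans ?_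
  · filter_upwards [ae_restrict_mem measurableSet_Ioi] with y hy
    rw [norm_mul, Real.norm_of_nonneg (heatKernel_nonneg hl ht hx hy)]
    exact mul_le_mul_of_nonneg_left (hM y) (heatKernel_nonneg hl ht hx hy)
  · rw [integral_mul_const]
    exact mul_le_of_le_one_left hM0 (integral_heatKernel_le_one hl ht hx)

lemma measurable_heat {l : ℝ} (hl : 1 ≤ l) {u : ℝ → ℝ} (hu : Measurable u) :
    Measurable fun p : ℝ × ℝ => heat l p.1 u p.2 := by
  have : Measurable fun q : (ℝ × ℝ) × ℝ => heatKernel l q.1.1 q.1.2 q.2 * u q.2 :=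
    ((measurable_heatKernel hl).comp
      (by fun_prop : Measurable fun q : (ℝ × ℝ) × ℝ => (q.1.1, q.1.2, q.2))).mul
      (hu.comp measurable_snd)
  have h2 : StronglyMeasurable fun p : ℝ × ℝ =>
      ∫ y in Ioi (0 : ℝ), heatKernel l p.1 p.2 y * u y :=
    this.stronglyMeasurable.integral_prod_right' (ν := volume.restrict (Ioi 0))
  exact h2.measurable

lemma continuousOn_heat {l t M : ℝ} (hl : 1 ≤ l) (ht : 0 < t) {u : ℝ → ℝ} (hu : Measurable u)
    (hM : ∀ x, |u x| ≤ M) : ContinuousOn (heat l t u) (Ioi 0) := by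
  intro x hx
  refine ContinuousAt.continuousWithinAt ?_
  have hx : 0 < x := hx
  have hM0 : 0 ≤ M := (abs_nonneg _).trans (hM 0)
  -- For |z - x| ≤ 1 one has (x-y)² ≤ 2(z-y)² + 2, so the Gaussians centred at z lie below a wider
  -- one centred at x.
  refine continuousAt_of_dominated (bound := fun y => (Real.sqrt (4 * Real.pi * t))⁻¹ *
    (Real.exp (1 / (4 * t)) * Real.exp (-(1 / (8 * t)) * (x - y) ^ 2)) * M) ?_ ?_ ?_ ?_
  · exact Eventually.of_forall fun z =>
      ((measurable_heatKernel_right hl t z).mul hu).aestronglyMeasurable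
  · filter_upwards [lt_mem_nhds hx, Metric.ball_mem_nhds x one_pos] with z hz hzx
    filter_upwards [ae_restrict_mem measurableSet_Ioi] with y hy
    rw [norm_mul]
    refine mul_le_mul ((norm_heatKernel_le hl ht hz hy).trans ?_) (hM y) (norm_nonneg _)
      (by positivity)
    unfold gauss
    rw [← Real.exp_add]
    gcongr
    rw [Metric.mem_ball, Real.dist_eq] at hzx
    have h1 : (z - x) ^ 2 ≤ 1 := by rw [← sq_abs]; nlinarith [abs_nonneg (z - x)]
    rw [show (1 : ℝ) / (4 * t) + -(1 / (8 * t)) * (x - y) ^ 2 = (1 - (x - y) ^ 2 / 2) / (4 * t) by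
      field_simp; ring]
    gcongr
    nlinarith [sq_nonneg (z - y + (z - x))]
  · refine Integrable.integrableOn ?_
    exact ((((integrable_exp_neg_mul_sq (b := 1 / (8 * t)) (by positivity)).comp_sub_left
      x).const_mul _).const_mul _).mul_const M
  · refine ae_of_all _ fun y => ContinuousAt.mul ?_ continuousAt_const
    unfold heatKernel
    exact (ContinuousAt.mul (by fun_prop)
      ((continuous_heatFactor hl).continuousAt.comp (by fun_prop)))

/-! ### Short-time behaviour of the heat semigroup -/

/-- The integrand of the heat semigroup in the parabolic variable `s = (y - x) / √t`. -/
def heatProfile (l t : ℝ) (u : ℝ → ℝ) (x s : ℝ) : ℝ :=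
  if 0 < x + Real.sqrt t * s then
    heatFactor l (x * (x + Real.sqrt t * s) / (2 * t)) * u (x + Real.sqrt t * s) else 0

/-- With y = x + √t s the Gaussian no longer depends on t, which prepares for dominated convergence
as t → 0. -/
lemma heat_eq_integral_gauss {l t : ℝ} (ht : 0 < t) (u : ℝ → ℝ) (x : ℝ) :
    heat l t u x = ∫ s, gauss 1 s * heatProfile l t u x s := by
  let f : ℝ → ℝ := (Ioi (0 : ℝ)).indicator fun y => heatKernel l t x y * u y
  have hs : 0 < Real.sqrt t := Real.sqrt_pos.2 ht
  have h1 : heat l t u x = ∫ y, f y := (integral_indicator measurableSet_Ioi).symm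
  rw [h1, ← integral_add_left_eq_self f x]
  have h2 := Measure.integral_comp_mul_left (fun y => f (x + y)) (Real.sqrt t)
  rw [smul_eq_mul, abs_of_pos (inv_pos.2 hs)] at h2
  have h3 : ∫ y, f (x + y) = Real.sqrt t * ∫ s, f (x + Real.sqrt t * s) := by
    rw [h2]; field_simp
  rw [h3, ← integral_const_mul]
  refine integral_congr_ae (ae_of_all _ fun s => ?_)
  simp only [f, heatProfile, indicator_apply, mem_Ioi]
  split_ifs with h
  · have e : (x - (x + Real.sqrt t * s)) ^ 2 = t * s ^ 2 := by
      rw [show (x - (x + Real.sqrt t * s)) ^ 2 = Real.sqrt t ^ 2 * s ^ 2 by ring,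
        Real.sq_sqrt ht.le]
    rw [heatKernel, gauss, e, Real.sqrt_mul (by positivity), mul_one,
      show -(t * s ^ 2) / (4 * t) = -s ^ 2 / (4 * 1) by field_simp]
    field_simp
  · simp

lemma measurable_heatProfile {l : ℝ} (hl : 1 ≤ l) (t : ℝ) {u : ℝ → ℝ} (hu : Measurable u) (x : ℝ) :
    Measurable (heatProfile l t u x) := by
  unfold heatProfile
  refine Measurable.ite (measurableSet_lt measurable_const (by fun_prop)) ?_ measurable_const
  exact ((continuous_heatFactor hl).measurable.comp (by fun_prop)).mul (hu.comp (by fun_prop))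

lemma abs_heatProfile_le {l t x M : ℝ} (hl : 1 ≤ l) (ht : 0 < t) (hx : 0 < x) {u : ℝ → ℝ}
    (hM : ∀ x, |u x| ≤ M) (s : ℝ) : |heatProfile l t u x s| ≤ M := by
  have hM0 : 0 ≤ M := (abs_nonneg _).trans (hM 0)
  unfold heatProfile
  split_ifs with h
  · rw [abs_mul, abs_of_nonneg (heatFactor_nonneg hl (by positivity))]
    calc _ ≤ 1 * M := by
          gcongr
          · exact heatFactor_le_one hl (by positivity)
          · exact hM _
      _ = M := one_mul M
  · simpa

lemma integrable_gauss_mul_heatProfile {l t x M : ℝ} (hl : 1 ≤ l) (ht : 0 < t) (hx : 0 < x)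
    {u : ℝ → ℝ} (hu : Measurable u) (hM : ∀ x, |u x| ≤ M) :
    Integrable fun s => gauss 1 s * heatProfile l t u x s := by
  refine Integrable.mono' ((integrable_gauss one_pos).mul_const M)
    ((continuous_gauss 1).measurable.mul (measurable_heatProfile hl t hu x)).aestronglyMeasurable
    (ae_of_all _ fun s => ?_)
  rw [norm_mul, Real.norm_of_nonneg (gauss_nonneg _ _)]
  exact mul_le_mul_of_nonneg_left (abs_heatProfile_le hl ht hx hM s) (gauss_nonneg _ _)

/-- A linear term c s is free because the Gaussian has mean zero; it will cancel the first-order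
Taylor term of u. -/
lemma sub_heat_eq {l t x M : ℝ} (hl : 1 ≤ l) (ht : 0 < t) (hx : 0 < x) {u : ℝ → ℝ}
    (hu : Measurable u) (hM : ∀ x, |u x| ≤ M) (c : ℝ) :
    u x - heat l t u x = ∫ s, gauss 1 s * (u x + c * s - heatProfile l t u x s) := by
  have i1 := (integrable_gauss one_pos).mul_const (u x)
  have i2 := (integrable_mul_gauss one_pos).const_mul c
  have i3 := integrable_gauss_mul_heatProfile hl ht hx hu hM
  have e : ∀ s, gauss 1 s * (u x + c * s - heatProfile l t u x s) =
      (gauss 1 s * u x + c * (gauss 1 s * s)) - gauss 1 s * heatProfile l t u x s := fun s => by ring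
  simp only [e]
  rw [integral_sub (by exact i1.add i2) i3, integral_add i1 i2, integral_mul_const, integral_const_mul,
    integral_gauss one_pos, integral_mul_gauss, heat_eq_integral_gauss ht]
  ring

lemma abs_sub_heat_le {l t x M K : ℝ} (hl : 1 ≤ l) (ht : 0 < t) (hx : 0 < x) {u : ℝ → ℝ}
    (hu : Measurable u) (hM : ∀ x, |u x| ≤ M) {c : ℝ}
    (h : ∀ s, |u x + c * s - heatProfile l t u x s| ≤ K * (1 + s ^ 2)) :
    |u x - heat l t u x| ≤ 3 * K := by
  rw [sub_heat_eq hl ht hx hu hM c, ← Real.norm_eq_abs]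
  have i1 := (integrable_gauss one_pos).const_mul K
  have i2 := (integrable_sq_mul_gauss one_pos).const_mul K
  refine (norm_integral_le_of_norm_le (i1.add i2) (ae_of_all _ fun s => ?_)).trans ?_
  · rw [norm_mul, Real.norm_of_nonneg (gauss_nonneg _ _)]
    calc _ ≤ gauss 1 s * (K * (1 + s ^ 2)) :=
          mul_le_mul_of_nonneg_left (h s) (gauss_nonneg _ _)
      _ = _ := by simp only [Pi.add_apply]; ring
  · simp only [Pi.add_apply]
    -- The constant 3 is the mass 1 plus the second moment 2 of `gauss 1`.
    rw [integral_add i1 i2, integral_const_mul, integral_const_mul, integral_gauss one_pos,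
      integral_sq_mul_gauss_one]
    linarith

/-- For displacements up to a/2 the argument of the factor is at least a²/(4t), so
`one_sub_heatFactor_le` bounds the deficit by 2l²t/a². -/
lemma abs_heatProfile_sub_le {l t x M a : ℝ} (hl : 1 ≤ l) (ht : 0 < t) (ha : 0 < a) (hx : a ≤ x)
    {u : ℝ → ℝ} (hM : ∀ x, |u x| ≤ M) {s : ℝ} (hs : |Real.sqrt t * s| ≤ a / 2) :
    |u (x + Real.sqrt t * s) - heatProfile l t u x s| ≤ 2 * l ^ 2 * M / a ^ 2 * t := by
  have hM0 : 0 ≤ M := (abs_nonneg _).trans (hM 0)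
  have hx0 : 0 < x := ha.trans_le hx
  have hy : a / 2 ≤ x + Real.sqrt t * s := by have := (abs_le.1 hs).1; linarith
  have hy0 : 0 < x + Real.sqrt t * s := by linarith
  rw [heatProfile, if_pos hy0]
  set y := x + Real.sqrt t * s
  have hz : 0 < x * y / (2 * t) := by positivity
  have h1 := one_sub_heatFactor_le hl hz
  have h2 := heatFactor_le_one hl hz
  rw [show u y - heatFactor l (x * y / (2 * t)) * u y =
    (1 - heatFactor l (x * y / (2 * t))) * u y by ring, abs_mul, abs_of_nonneg (by linarith)]
  have h3 : l ^ 2 / (2 * (x * y / (2 * t))) ≤ 2 * l ^ 2 / a ^ 2 * t := by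
    rw [show l ^ 2 / (2 * (x * y / (2 * t))) = l ^ 2 * t / (x * y) by field_simp,
      show 2 * l ^ 2 / a ^ 2 * t = l ^ 2 * t / (a * (a / 2)) by field_simp]
    gcongr
  calc _ ≤ (2 * l ^ 2 / a ^ 2 * t) * M := mul_le_mul (h1.trans h3) (hM y) (abs_nonneg _)
        (by positivity)
    _ = _ := by ring

lemma hasDerivAt_of_contDiffOn_two {u : ℝ → ℝ} (hu : ContDiffOn ℝ 2 u (Ioi 0)) {x : ℝ}
    (hx : 0 < x) : HasDerivAt u (deriv u x) x :=
  ((hu.contDiffAt (isOpen_Ioi.mem_nhds hx)).differentiableAt (by norm_num)).hasDerivAt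

lemma contDiffOn_deriv {u : ℝ → ℝ} (hu : ContDiffOn ℝ 2 u (Ioi 0)) :
    ContDiffOn ℝ 1 (deriv u) (Ioi 0) :=
  hu.deriv_of_isOpen isOpen_Ioi (by norm_num)

lemma hasDerivAt_deriv_of_contDiffOn_two {u : ℝ → ℝ} (hu : ContDiffOn ℝ 2 u (Ioi 0)) {x : ℝ}
    (hx : 0 < x) : HasDerivAt (deriv u) (deriv (deriv u) x) x :=
  (((contDiffOn_deriv hu).contDiffAt (isOpen_Ioi.mem_nhds hx)).differentiableAt
    (by norm_num)).hasDerivAt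

lemma continuousOn_deriv_deriv {u : ℝ → ℝ} (hu : ContDiffOn ℝ 2 u (Ioi 0)) :
    ContinuousOn (deriv (deriv u)) (Ioi 0) :=
  ((contDiffOn_deriv hu).deriv_of_isOpen (m := 0) isOpen_Ioi (by norm_num)).continuousOn

/-- The mean value inequality used twice, for u' and then for y ↦ u(y) - u'(x) y, on the slightly
larger compact interval [a/2, b + a/2] ⊆ (0, ∞). -/
lemma exists_taylor_bound {u : ℝ → ℝ} (hu : ContDiffOn ℝ 2 u (Ioi 0)) {a b : ℝ} (ha : 0 < a) :
    ∃ B L : ℝ, 0 ≤ B ∧ 0 ≤ L ∧ ∀ x ∈ Icc a b, |deriv u x| ≤ L ∧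
      ∀ h, |h| ≤ a / 2 → |u (x + h) - u x - deriv u x * h| ≤ B * h ^ 2 := by
  have hsub : Icc (a / 2) (b + a / 2) ⊆ Ioi (0 : ℝ) := fun y hy => by
    have := hy.1; simp only [mem_Ioi]; linarith
  obtain ⟨B, hB⟩ := (isCompact_Icc (a := a / 2) (b := b + a / 2)).exists_bound_of_continuousOn
    ((continuousOn_deriv_deriv hu).mono hsub)
  obtain ⟨L, hL⟩ := (isCompact_Icc (a := a / 2) (b := b + a / 2)).exists_bound_of_continuousOn
    ((contDiffOn_deriv hu).continuousOn.mono hsub)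
  refine ⟨max B 0, max L 0, le_max_right _ _, le_max_right _ _, fun x hx => ⟨?_, fun h hh => ?_⟩⟩
  · exact (hL x ⟨by linarith [hx.1], by linarith [hx.2]⟩).trans (le_max_left _ _)
  · have hh' := abs_le.1 hh
    have hmem : ∀ y ∈ uIcc x (x + h), y ∈ Icc (a / 2) (b + a / 2) ∧ |y - x| ≤ |h| := by
      intro y hy
      have h2 : |y - x| ≤ |h| := by simpa using abs_sub_left_of_mem_uIcc hy
      have := abs_le.1 (h2.trans hh)
      exact ⟨⟨by linarith [hx.1], by linarith [hx.2]⟩, h2⟩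
    have hd : ∀ y ∈ uIcc x (x + h), |deriv u y - deriv u x| ≤ max B 0 * |h| := by
      intro y hy
      have hsub2 : uIcc x y ⊆ uIcc x (x + h) := uIcc_subset_uIcc left_mem_uIcc hy
      have := (convex_uIcc x y).norm_image_sub_le_of_norm_hasDerivWithin_le
        (f := deriv u) (f' := deriv (deriv u)) (C := max B 0)
        (fun z hz => (hasDerivAt_deriv_of_contDiffOn_two hu
          (hsub (hmem z (hsub2 hz)).1)).hasDerivWithinAt)
        (fun z hz => (hB z (hmem z (hsub2 hz)).1).trans (le_max_left _ _))
        left_mem_uIcc right_mem_uIcc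
      exact this.trans (mul_le_mul_of_nonneg_left (hmem y hy).2 (le_max_right _ _))
    have := (convex_uIcc x (x + h)).norm_image_sub_le_of_norm_hasDerivWithin_le
      (f := fun y => u y - deriv u x * y) (f' := fun y => deriv u y - deriv u x)
      (C := max B 0 * |h|)
      (fun z hz => ((hasDerivAt_of_contDiffOn_two hu (hsub (hmem z hz).1)).sub
        (by simpa using (hasDerivAt_id z).const_mul (deriv u x))).hasDerivWithinAt)
      hd left_mem_uIcc right_mem_uIcc
    rw [Real.norm_eq_abs, Real.norm_eq_abs, add_sub_cancel_left, mul_assoc, abs_mul_abs_self,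
      ← sq] at this
    convert! this using 2
    ring

lemma exists_abs_profile_le_of_contDiffOn {l M : ℝ} (hl : 1 ≤ l) {u : ℝ → ℝ}
    (hM : ∀ x, |u x| ≤ M) (h2 : ContDiffOn ℝ 2 u (Ioi 0)) {a b : ℝ} (ha : 0 < a) :
    ∃ K, 0 ≤ K ∧ ∀ x ∈ Icc a b, ∀ t, 0 < t → ∀ s,
      |u x + deriv u x * Real.sqrt t * s - heatProfile l t u x s| ≤ K * t * (1 + s ^ 2) := by
  have hM0 : 0 ≤ M := (abs_nonneg _).trans (hM 0)
  obtain ⟨B, L, hB, hL, h⟩ := exists_taylor_bound h2 ha (b := b)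
  refine ⟨B + 2 * l ^ 2 * M / a ^ 2 + 8 * M / a ^ 2 + 2 * L / a, by positivity, ?_⟩
  intro x hx t ht s
  obtain ⟨hxL, hT⟩ := h x hx
  set r := Real.sqrt t * s with hr
  have hr2 : r ^ 2 = t * s ^ 2 := by rw [hr, mul_pow, Real.sq_sqrt ht.le]
  rw [mul_assoc, ← hr]
  by_cases hs : |r| ≤ a / 2
  · have e1 := hT r hs
    have e2 := abs_heatProfile_sub_le hl ht ha hx.1 hM hs
    calc |u x + deriv u x * r - heatProfile l t u x s|
        = |-(u (x + r) - u x - deriv u x * r) + (u (x + r) - heatProfile l t u x s)| := by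
          congr 1; ring
      _ ≤ B * r ^ 2 + 2 * l ^ 2 * M / a ^ 2 * t := by
          refine (abs_add_le _ _).trans ?_
          rw [abs_neg]
          exact add_le_add e1 e2
      _ ≤ B * t * (1 + s ^ 2) + 2 * l ^ 2 * M / a ^ 2 * t * (1 + s ^ 2) := by
          rw [hr2]
          have q1 : 0 ≤ B * t := by positivity
          have q2 : 0 ≤ 2 * l ^ 2 * M / a ^ 2 * t * s ^ 2 := by positivity
          linarith
      _ ≤ _ := by
          have q1 : 0 ≤ (8 * M / a ^ 2 + 2 * L / a) * t * (1 + s ^ 2) := by positivity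
          linarith
  · push Not at hs
    -- For large displacements trivial bounds suffice: constants are absorbed by powers of 2|r|/a ≥
    -- 1, and r² = t s² restores the factor t.
    have hra : 1 ≤ 2 * |r| / a := by rw [le_div_iff₀ ha]; linarith
    have e1 : |deriv u x * r| ≤ 2 * L / a * (t * s ^ 2) := by
      rw [abs_mul, ← hr2, ← sq_abs r]
      calc _ ≤ L * (|r| * (2 * |r| / a)) := by
            gcongr; exact le_mul_of_one_le_right (abs_nonneg _) hra
        _ = _ := by ring
    have e2 : 2 * M ≤ 8 * M / a ^ 2 * (t * s ^ 2) := by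
      rw [← hr2, ← sq_abs r]
      calc 2 * M = 2 * M * 1 ^ 2 := by ring
        _ ≤ 2 * M * (2 * |r| / a) ^ 2 := by gcongr
        _ = _ := by ring
    have e3 := abs_heatProfile_le hl ht (ha.trans_le hx.1) hM s
    calc |u x + deriv u x * r - heatProfile l t u x s|
        ≤ |u x| + |deriv u x * r| + |heatProfile l t u x s| :=
          (abs_sub _ _).trans (add_le_add_left (abs_add_le _ _) _)
      _ ≤ 8 * M / a ^ 2 * (t * s ^ 2) + 2 * L / a * (t * s ^ 2) := by linarith [hM x]
      _ ≤ _ := by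
          have q1 : 0 ≤ (8 * M / a ^ 2 + 2 * L / a) * t := by positivity
          have q2 : 0 ≤ (B + 2 * l ^ 2 * M / a ^ 2) * t * (1 + s ^ 2) := by positivity
          linarith

lemma exists_abs_sub_heat_le_of_contDiffOn {l M : ℝ} (hl : 1 ≤ l) {u : ℝ → ℝ} (hu : Measurable u)
    (hM : ∀ x, |u x| ≤ M) (h2 : ContDiffOn ℝ 2 u (Ioi 0)) {a b : ℝ} (ha : 0 < a) :
    ∃ C, 0 ≤ C ∧ ∀ x ∈ Icc a b, ∀ t, 0 < t → |u x - heat l t u x| ≤ C * t := by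
  obtain ⟨K, hK, h⟩ := exists_abs_profile_le_of_contDiffOn hl hM h2 ha (b := b)
  refine ⟨3 * K, by positivity, fun x hx t ht => ?_⟩
  rw [mul_assoc]
  exact abs_sub_heat_le hl ht (ha.trans_le hx.1) hu hM (h x hx t ht)

lemma tendsto_taylor_two {u : ℝ → ℝ} (h2 : ContDiffOn ℝ 2 u (Ioi 0)) {x : ℝ} (hx : 0 < x) :
    Tendsto (fun h => (u (x + h) - u x - deriv u x * h) / h ^ 2) (𝓝[≠] 0)
      (𝓝 (deriv (deriv u) x / 2)) := by
  have h := Real.taylor_tendsto (convex_Ioi 0) (mem_Ioi.2 hx) (n := 2) (by exact_mod_cast h2)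
  rw [isOpen_Ioi.nhdsWithin_eq (mem_Ioi.2 hx)] at h
  have e1 : iteratedDerivWithin 1 u (Ioi 0) x = deriv u x := by
    rw [iteratedDerivWithin_one, derivWithin_of_isOpen isOpen_Ioi (mem_Ioi.2 hx)]
  have e2 : iteratedDerivWithin 2 u (Ioi 0) x = deriv (deriv u) x := by
    rw [iteratedDerivWithin_of_isOpen isOpen_Ioi (mem_Ioi.2 hx), iteratedDeriv_succ,
      iteratedDeriv_one]
  have hmap : Tendsto (fun h : ℝ => x + h) (𝓝[≠] 0) (𝓝 x) := by
    have : Tendsto (fun h : ℝ => x + h) (𝓝 0) (𝓝 (x + 0)) := Continuous.tendsto (by fun_prop) 0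
    rw [add_zero] at this
    exact this.mono_left nhdsWithin_le_nhds
  have h3 := ((h.comp hmap).add_const (deriv (deriv u) x / 2))
  rw [zero_add] at h3
  refine h3.congr' ?_
  filter_upwards [self_mem_nhdsWithin] with r hr
  have hr : r ≠ 0 := hr
  simp only [Function.comp, taylorWithinEval_succ, taylor_within_zero_eval, zero_add, e1, e2,
    one_add_one_eq_two, add_sub_cancel_left, Nat.factorial, smul_eq_mul]
  push_cast
  field_simp
  ring

/-- The generator is Δ_λ: the deficit of the factor contributes the potential, and the Taylor term
u''(x) s²/2, with Gaussian second moment 2, contributes -u''(x). The previous O(t) bound on the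
profile supplies the majorant. -/
lemma tendsto_sub_heat_div {l M : ℝ} (hl : 1 ≤ l) {u : ℝ → ℝ} (hu : Measurable u)
    (hM : ∀ x, |u x| ≤ M) (h2 : ContDiffOn ℝ 2 u (Ioi 0)) {x : ℝ} (hx : 0 < x) :
    Tendsto (fun t => (u x - heat l t u x) / t) (𝓝[>] 0) (𝓝 (bessel l u x)) := by
  obtain ⟨K, hK, h⟩ := exists_abs_profile_le_of_contDiffOn hl hM h2 hx (b := x)
  have i1 := integrable_gauss one_pos
  have i2 := integrable_sq_mul_gauss one_pos
  have hlim : Tendsto (fun t => ∫ s, gauss 1 s *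
      ((u x + deriv u x * Real.sqrt t * s - heatProfile l t u x s) / t)) (𝓝[>] 0)
      (𝓝 (∫ s, gauss 1 s * (l * (l - 1) / x ^ 2 * u x - deriv (deriv u) x / 2 * s ^ 2))) := by
    refine tendsto_integral_filter_of_dominated_convergence
      (fun s => K * gauss 1 s + K * (gauss 1 s * s ^ 2)) ?_ ?_
      ((i1.const_mul K).add (i2.const_mul K)) (ae_of_all _ fun s => ?_)
    · exact Eventually.of_forall fun t => Measurable.aestronglyMeasurable
        ((continuous_gauss 1).measurable.mul
        (Measurable.div_const (Measurable.sub (by fun_prop) (measurable_heatProfile hl t hu x)) _))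
    · filter_upwards [self_mem_nhdsWithin] with t ht
      have ht : 0 < t := ht
      refine ae_of_all _ fun s => ?_
      rw [norm_mul, Real.norm_of_nonneg (gauss_nonneg _ _), norm_div, Real.norm_of_nonneg ht.le]
      calc _ ≤ gauss 1 s * (K * t * (1 + s ^ 2) / t) := by
            gcongr
            · exact gauss_nonneg _ _
            · exact h x ⟨le_rfl, le_rfl⟩ t ht s
        _ = _ := by field_simp
    · refine Tendsto.const_mul _ ?_
      have hsqrt : Tendsto (fun t : ℝ => Real.sqrt t * s) (𝓝[>] 0) (𝓝 0) := by
        have : Tendsto (fun t : ℝ => Real.sqrt t * s) (𝓝 0) (𝓝 (Real.sqrt 0 * s)) :=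
          Continuous.tendsto (by fun_prop) 0
        rw [Real.sqrt_zero, zero_mul] at this
        exact this.mono_left nhdsWithin_le_nhds
      have hy : Tendsto (fun t : ℝ => x + Real.sqrt t * s) (𝓝[>] 0) (𝓝 x) := by
        simpa using hsqrt.const_add x
      have hT : Tendsto (fun t : ℝ => (u (x + Real.sqrt t * s) - u x -
          deriv u x * (Real.sqrt t * s)) / t) (𝓝[>] 0) (𝓝 (deriv (deriv u) x / 2 * s ^ 2)) := by
        -- The Taylor limit lives on a punctured neighbourhood, which the displacement √t s never
        -- enters when s = 0.
        by_cases hs : s = 0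
        · simp [hs]
        · have hne : Tendsto (fun t : ℝ => Real.sqrt t * s) (𝓝[>] 0) (𝓝[≠] 0) := by
            refine tendsto_nhdsWithin_iff.2 ⟨hsqrt, ?_⟩
            filter_upwards [self_mem_nhdsWithin] with t ht
            exact mul_ne_zero (Real.sqrt_pos.2 ht).ne' hs
          refine (((tendsto_taylor_two h2 hx).comp hne).mul_const (s ^ 2)).congr' ?_
          filter_upwards [self_mem_nhdsWithin] with t ht
          have ht : 0 < t := ht
          simp only [Function.comp]
          rw [mul_pow, Real.sq_sqrt ht.le]
          field_simp
      -- With z = xy/(2t) and y = x + √t s, the quotient (1 - factor)/t is 2/(xy) times z (1 -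
      -- factor).
      have hF : Tendsto (fun t : ℝ => 2 / (x * (x + Real.sqrt t * s)) *
          ((x * (x + Real.sqrt t * s) / (2 * t)) *
            (1 - heatFactor l (x * (x + Real.sqrt t * s) / (2 * t)))) *
              u (x + Real.sqrt t * s)) (𝓝[>] 0)
          (𝓝 (2 / (x * x) * (l * (l - 1) / 2) * u x)) := by
        refine Tendsto.mul (Tendsto.mul ?_ ?_) ?_
        · exact tendsto_const_nhds.div (hy.const_mul x) (by positivity)
        · refine (tendsto_mul_one_sub_heatFactor hl).comp ?_
          have h1 : Tendsto (fun t : ℝ => x * (x + Real.sqrt t * s) * (2⁻¹ * t⁻¹)) (𝓝[>] 0)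
              atTop := Tendsto.pos_mul_atTop (mul_pos hx hx) (hy.const_mul x)
                (tendsto_inv_nhdsGT_zero.const_mul_atTop (by norm_num))
          refine h1.congr fun t => ?_
          rw [div_eq_mul_inv, mul_inv]
        · exact (hasDerivAt_of_contDiffOn_two h2 hx).continuousAt.tendsto.comp hy
      have h3 := hF.sub hT
      rw [show 2 / (x * x) * (l * (l - 1) / 2) * u x = l * (l - 1) / x ^ 2 * u x by
        field_simp] at h3
      refine h3.congr' ?_
      filter_upwards [self_mem_nhdsWithin, hy.eventually (lt_mem_nhds hx)] with t ht hyt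
      have ht : 0 < t := ht
      rw [heatProfile, if_pos hyt]
      field_simp
      ring
  have e : ∫ s, gauss 1 s * (l * (l - 1) / x ^ 2 * u x - deriv (deriv u) x / 2 * s ^ 2) =
      bessel l u x := by
    have e1 : ∀ s, gauss 1 s * (l * (l - 1) / x ^ 2 * u x - deriv (deriv u) x / 2 * s ^ 2) =
      gauss 1 s * (l * (l - 1) / x ^ 2 * u x) - deriv (deriv u) x / 2 * (gauss 1 s * s ^ 2) :=
      fun s => by ring
    simp only [e1]
    rw [integral_sub (i1.mul_const _) (i2.const_mul _), integral_mul_const, integral_const_mul,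
      integral_gauss one_pos, integral_sq_mul_gauss_one, bessel]
    ring
  rw [e] at hlim
  refine hlim.congr' ?_
  filter_upwards [self_mem_nhdsWithin] with t ht
  have ht : 0 < t := ht
  rw [sub_heat_eq hl ht hx hu hM (deriv u x * Real.sqrt t), ← integral_div]
  simp only [mul_div_assoc]

/-- A displacement √t s costs t^{α/2}|s|^α by Hölder continuity. The O(t) error from the factor is
smaller for t ≤ 1, and displacements beyond a/2 are absorbed by (2|r|/a)^α ≥ 1. -/
lemma exists_abs_sub_heat_le_of_holder {l M C α : ℝ} (hl : 1 ≤ l) {u : ℝ → ℝ} (hu : Measurable u)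
    (hM : ∀ x, |u x| ≤ M) (hα : 0 < α) (hα1 : α < 1) (hC : 0 ≤ C)
    (h : ∀ x > 0, ∀ y > 0, |u x - u y| ≤ C * |x - y| ^ α) {a b : ℝ} (ha : 0 < a) :
    ∃ K, 0 ≤ K ∧ ∀ x ∈ Icc a b, ∀ t, 0 < t → t ≤ 1 →
      |u x - heat l t u x| ≤ K * t ^ (α / 2) := by
  have hM0 : 0 ≤ M := (abs_nonneg _).trans (hM 0)
  have hl0 : 0 ≤ 2 * l ^ 2 * M / a ^ 2 := by positivity
  set D := C + 2 * l ^ 2 * M / a ^ 2 + 2 * M * (2 / a) ^ α with hD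
  refine ⟨3 * D, by positivity, fun x hx t ht ht1 => ?_⟩
  have hx0 : 0 < x := ha.trans_le hx.1
  rw [mul_assoc]
  refine abs_sub_heat_le hl ht hx0 hu hM (c := 0) fun s => ?_
  rw [zero_mul, add_zero]
  set r := Real.sqrt t * s with hr
  have hsα : |s| ^ α ≤ 1 + s ^ 2 := by
    rcases le_total |s| 1 with h1 | h1
    · have := Real.rpow_le_one (abs_nonneg s) h1 hα.le
      nlinarith [sq_nonneg s]
    · have : |s| ^ α ≤ |s| ^ (2 : ℝ) := Real.rpow_le_rpow_of_exponent_le h1 (by linarith)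
      rw [Real.rpow_two, sq_abs] at this
      linarith
  have hrα : |r| ^ α = t ^ (α / 2) * |s| ^ α := by
    rw [hr, abs_mul, abs_of_nonneg (Real.sqrt_nonneg t), Real.mul_rpow (Real.sqrt_nonneg t)
      (abs_nonneg s), Real.sqrt_eq_rpow, ← Real.rpow_mul ht.le]
    ring_nf
  have htα : t ≤ t ^ (α / 2) := by
    simpa using Real.rpow_le_rpow_of_exponent_ge ht ht1 (show α / 2 ≤ 1 by linarith)
  have htp : 0 < t ^ (α / 2) := Real.rpow_pos_of_pos ht _
  by_cases hs : |r| ≤ a / 2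
  · have e2 := abs_heatProfile_sub_le hl ht ha hx.1 hM hs
    have hy : 0 < x + r := by have := (abs_le.1 hs).1; linarith [hx.1]
    have e1 := h x hx0 (x + r) hy
    rw [show x - (x + r) = -r by ring, abs_neg, hrα] at e1
    calc |u x - heatProfile l t u x s|
        = |(u x - u (x + r)) + (u (x + r) - heatProfile l t u x s)| := by congr 1; ring
      _ ≤ C * (t ^ (α / 2) * |s| ^ α) + 2 * l ^ 2 * M / a ^ 2 * t :=
          (abs_add_le _ _).trans (add_le_add e1 e2)
      _ ≤ C * (t ^ (α / 2) * (1 + s ^ 2)) + 2 * l ^ 2 * M / a ^ 2 * (t ^ (α / 2) * (1 + s ^ 2)) := by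
          gcongr
          nlinarith [mul_nonneg htp.le (sq_nonneg s)]
      _ ≤ _ := by
          have : 0 ≤ 2 * M * (2 / a) ^ α * (t ^ (α / 2) * (1 + s ^ 2)) := by positivity
          rw [hD]; linarith
  · push Not at hs
    have e3 := abs_heatProfile_le hl ht hx0 hM s
    have hra : 1 ≤ (2 / a) ^ α * |r| ^ α := by
      rw [← Real.mul_rpow (by positivity) (abs_nonneg r)]
      refine Real.one_le_rpow ?_ hα.le
      rw [div_mul_eq_mul_div, le_div_iff₀ ha]; linarith
    rw [hrα] at hra
    calc |u x - heatProfile l t u x s| ≤ 2 * M * 1 :=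
          (abs_sub _ _).trans (by linarith [hM x])
      _ ≤ 2 * M * ((2 / a) ^ α * (t ^ (α / 2) * |s| ^ α)) := by gcongr
      _ ≤ 2 * M * ((2 / a) ^ α * (t ^ (α / 2) * (1 + s ^ 2))) := by gcongr
      _ ≤ _ := by
          have : 0 ≤ (C + 2 * l ^ 2 * M / a ^ 2) * (t ^ (α / 2) * (1 + s ^ 2)) := by positivity
          rw [hD]; linarith

/-! ### Long-time behaviour of the heat semigroup -/

/-- The kernel is at most t^{-1/2}, hence tends to 0 pointwise; for t ≥ 1 its product with 1 + y
stays below x + 2, so the integrability that defines L_0 provides the majorant. -/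
lemma tendsto_heat_atTop {l : ℝ} (hl : 1 ≤ l) {u : ℝ → ℝ} (hu : Measurable u)
    (hi : IntegrableOn (fun y => u y / (1 + y)) (Ioi 0)) {x : ℝ} (hx : 0 < x) :
    Tendsto (fun t => heat l t u x) atTop (𝓝 0) := by
  have hg : ∀ t ≥ (1 : ℝ), ∀ y > 0, gauss t (x - y) ≤ (Real.sqrt t)⁻¹ ∧
      gauss t (x - y) * (1 + y) ≤ x + 2 := by
    intro t ht y hy
    have ht0 : 0 < t := by linarith
    have hst : 1 ≤ Real.sqrt t := by simpa using ht
    have h4 : Real.sqrt t ≤ Real.sqrt (4 * Real.pi * t) := Real.sqrt_le_sqrt (by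
      nlinarith [Real.pi_gt_three])
    have hexp : Real.exp (-(x - y) ^ 2 / (4 * t)) ≤ 1 := by
      rw [Real.exp_le_one_iff, neg_div]
      have : 0 ≤ (x - y) ^ 2 / (4 * t) := by positivity
      linarith
    have h1 : gauss t (x - y) ≤ (Real.sqrt t)⁻¹ * Real.exp (-(x - y) ^ 2 / (4 * t)) := by
      unfold gauss; gcongr
    refine ⟨h1.trans (mul_le_of_le_one_right (by positivity) hexp), ?_⟩
    set q := |x - y| / Real.sqrt t with hq
    have hq0 : 0 ≤ q := by positivity
    have e : -(x - y) ^ 2 / (4 * t) = -(q ^ 2 / 4) := by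
      rw [hq, div_pow, sq_abs, Real.sq_sqrt ht0.le]; field_simp
    -- From q ≤ 1 + q²/4 ≤ e^{q²/4}, the first inequality being (q - 2)² ≥ 0.
    have h5 : q * Real.exp (-(q ^ 2 / 4)) ≤ 1 := by
      rw [Real.exp_neg, ← div_eq_mul_inv, div_le_one (Real.exp_pos _)]
      nlinarith [Real.add_one_le_exp (q ^ 2 / 4), sq_nonneg (q - 2)]
    have hy2 : 1 + y ≤ (1 + x) + q * Real.sqrt t := by
      rw [hq, div_mul_cancel₀ _ (by positivity)]
      linarith [neg_abs_le (x - y)]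
    calc gauss t (x - y) * (1 + y)
        ≤ ((Real.sqrt t)⁻¹ * Real.exp (-(q ^ 2 / 4))) * ((1 + x) + q * Real.sqrt t) := by
          rw [← e]; gcongr
      _ = (1 + x) * (Real.sqrt t)⁻¹ * Real.exp (-(q ^ 2 / 4)) + q * Real.exp (-(q ^ 2 / 4)) := by
          field_simp
      _ ≤ (1 + x) * 1 * 1 + 1 := by
          gcongr
          · exact inv_le_one_of_one_le₀ hst
          · rw [← e]; exact hexp
      _ = x + 2 := by ring
  have h0 : (0 : ℝ) = ∫ _ in Ioi (0 : ℝ), (0 : ℝ) := by simp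
  rw [h0]
  refine tendsto_integral_filter_of_dominated_convergence
    (fun y => (x + 2) * ‖u y / (1 + y)‖) ?_ ?_ (hi.norm.const_mul _) ?_
  · exact Eventually.of_forall fun t =>
      ((measurable_heatKernel_right hl t x).mul hu).aestronglyMeasurable
  · filter_upwards [eventually_ge_atTop 1] with t ht
    filter_upwards [ae_restrict_mem measurableSet_Ioi] with y hy
    have hy : 0 < y := hy
    have hK := norm_heatKernel_le hl (zero_lt_one.trans_le ht) hx hy
    rw [norm_mul, norm_div, Real.norm_of_nonneg (show 0 ≤ 1 + y by linarith)]
    calc _ ≤ gauss t (x - y) * ‖u y‖ := by gcongr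
      _ = gauss t (x - y) * (1 + y) * (‖u y‖ / (1 + y)) := by field_simp
      _ ≤ _ := mul_le_mul_of_nonneg_right (hg t ht y hy).2 (by positivity)
  · filter_upwards [ae_restrict_mem measurableSet_Ioi] with y hy
    have hy : 0 < y := hy
    have hs : Tendsto (fun t : ℝ => (Real.sqrt t)⁻¹) atTop (𝓝 0) :=
      tendsto_inv_atTop_zero.comp Real.tendsto_sqrt_atTop
    have : Tendsto (fun t => heatKernel l t x y) atTop (𝓝 0) := by
      refine squeeze_zero_norm' ?_ hs
      filter_upwards [eventually_ge_atTop 1] with t ht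
      exact (norm_heatKernel_le hl (zero_lt_one.trans_le ht) hx hy).trans (hg t ht y hy).1
    simpa using this.mul_const (u y)

/-! ### Subordination: fractional powers of test functions through the semigroup -/

lemma integrableOn_mul_rpow_neg {k : ℝ → ℝ} {A M β σ : ℝ}
    (hk : AEStronglyMeasurable k (volume.restrict (Ioi 0)))
    (h1 : ∀ t, 0 < t → t ≤ 1 → |k t| ≤ A * t ^ β) (h2 : ∀ t, 1 < t → |k t| ≤ M) (hσ : 0 < σ)
    (hβ : σ < β) : IntegrableOn (fun t => k t * t ^ (-1 - σ)) (Ioi 0) := by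
  have hm : AEStronglyMeasurable (fun t => k t * t ^ (-1 - σ)) (volume.restrict (Ioi 0)) :=
    hk.mul (Measurable.aestronglyMeasurable (by fun_prop))
  rw [← Ioc_union_Ioi_eq_Ioi zero_le_one]
  refine IntegrableOn.union ?_ ?_
  · have hi : IntegrableOn (fun t : ℝ => t ^ (β - 1 - σ)) (Ioc 0 1) := by
      rw [← intervalIntegrable_iff_integrableOn_Ioc_of_le zero_le_one]
      exact intervalIntegral.intervalIntegrable_rpow' (by linarith)
    refine Integrable.mono' (hi.const_mul A) (hm.mono_set Ioc_subset_Ioi_self) ?_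
    filter_upwards [ae_restrict_mem measurableSet_Ioc] with t ht
    rw [norm_mul, Real.norm_of_nonneg (Real.rpow_nonneg ht.1.le _),
      show β - 1 - σ = β + (-1 - σ) by ring, Real.rpow_add ht.1, ← mul_assoc]
    exact mul_le_mul_of_nonneg_right (h1 t ht.1 ht.2) (Real.rpow_nonneg ht.1.le _)
  · have hi := integrableOn_Ioi_rpow_of_lt (a := -1 - σ) (by linarith) one_pos
    refine Integrable.mono' (hi.const_mul M) (hm.mono_set (Ioi_subset_Ioi zero_le_one)) ?_
    filter_upwards [ae_restrict_mem measurableSet_Ioi] with t ht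
    have h0 : 0 < t := zero_lt_one.trans ht
    rw [norm_mul, Real.norm_of_nonneg (Real.rpow_nonneg h0.le _)]
    exact mul_le_mul_of_nonneg_right (h2 t ht) (Real.rpow_nonneg h0.le _)

lemma one_sub_exp_neg_nonneg {t : ℝ} (ht : 0 ≤ t) : 0 ≤ 1 - Real.exp (-t) := by
  have : Real.exp (-t) ≤ 1 := Real.exp_le_one_iff.2 (by linarith)
  linarith

lemma one_sub_exp_neg_le_one (t : ℝ) : 1 - Real.exp (-t) ≤ 1 := by
  linarith [Real.exp_pos (-t)]

lemma one_sub_exp_neg_le (t : ℝ) : 1 - Real.exp (-t) ≤ t := by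
  linarith [Real.add_one_le_exp (-t)]

/-- The normalizing constant `∫₀^∞ (1 - e⁻ᵗ) t^{-1-σ} dt` of the semigroup formula. -/
def subordConst (σ : ℝ) : ℝ := ∫ t in Ioi (0 : ℝ), (1 - Real.exp (-t)) * t ^ (-1 - σ)

lemma integrableOn_subordConst {σ : ℝ} (h0 : 0 < σ) (h1 : σ < 1) :
    IntegrableOn (fun t => (1 - Real.exp (-t)) * t ^ (-1 - σ)) (Ioi 0) := by
  refine integrableOn_mul_rpow_neg (A := 1) (M := 1) (β := 1)
    (Continuous.aestronglyMeasurable (by fun_prop)) ?_ ?_ h0 h1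
  · intro t ht _
    rw [abs_of_nonneg (one_sub_exp_neg_nonneg ht.le), Real.rpow_one, one_mul]
    exact one_sub_exp_neg_le t
  · intro t ht
    rw [abs_of_nonneg (one_sub_exp_neg_nonneg (zero_le_one.trans ht.le))]
    exact one_sub_exp_neg_le_one t

lemma subordConst_pos {σ : ℝ} (h0 : 0 < σ) (h1 : σ < 1) : 0 < subordConst σ := by
  have hpos : ∀ t ∈ Ioi (0 : ℝ), 0 < (1 - Real.exp (-t)) * t ^ (-1 - σ) := fun t ht => by
    have ht : 0 < t := ht
    have : Real.exp (-t) < 1 := Real.exp_lt_one_iff.2 (by linarith)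
    exact mul_pos (by linarith) (Real.rpow_pos_of_pos ht _)
  rw [subordConst, setIntegral_pos_iff_support_of_nonneg_ae
    ((ae_restrict_mem measurableSet_Ioi).mono fun t ht => (hpos t ht).le)
    (integrableOn_subordConst h0 h1)]
  have hsub : Ioi (0 : ℝ) ⊆ Function.support fun t => (1 - Real.exp (-t)) * t ^ (-1 - σ) :=
    fun t ht => (hpos t ht).ne'
  rw [inter_eq_self_of_subset_right hsub]
  simp

lemma integrableOn_subord {σ z : ℝ} (h0 : 0 < σ) (h1 : σ < 1) (hz : 0 < z) :
    IntegrableOn (fun t => (1 - Real.exp (-t * z ^ 2)) * t ^ (-1 - σ)) (Ioi 0) := by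
  refine integrableOn_mul_rpow_neg (A := z ^ 2) (M := 1) (β := 1)
    (Continuous.aestronglyMeasurable (by fun_prop)) ?_ ?_ h0 h1
  · intro t ht _
    rw [neg_mul, abs_of_nonneg (one_sub_exp_neg_nonneg (by positivity)), Real.rpow_one]
    linarith [one_sub_exp_neg_le (t * z ^ 2)]
  · intro t ht
    have : 0 < t := zero_lt_one.trans ht
    rw [neg_mul, abs_of_nonneg (one_sub_exp_neg_nonneg (by positivity))]
    exact one_sub_exp_neg_le_one _

/-- Homogeneity: the substitution v = z² t scales out the power z^{2σ}. -/
lemma integral_subord {σ z : ℝ} (hz : 0 < z) :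
    ∫ t in Ioi (0 : ℝ), (1 - Real.exp (-t * z ^ 2)) * t ^ (-1 - σ) =
      subordConst σ * z ^ (2 * σ) := by
  have hz2 : 0 < z ^ 2 := by positivity
  have h := integral_comp_mul_left_Ioi (fun v : ℝ => (1 - Real.exp (-v)) * v ^ (-1 - σ)) 0 hz2
  rw [mul_zero, smul_eq_mul, ← subordConst] at h
  have e : z ^ 2 * (z ^ 2) ^ (-1 - σ) * z ^ (2 * σ) = 1 := by
    rw [← Real.rpow_natCast, ← Real.rpow_mul hz.le, ← Real.rpow_add hz, ← Real.rpow_add hz]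
    push_cast
    ring_nf
    simp
  have h2 : ∫ t in Ioi (0 : ℝ), (1 - Real.exp (-(z ^ 2 * t))) * (z ^ 2 * t) ^ (-1 - σ) =
      (z ^ 2) ^ (-1 - σ) * ∫ t in Ioi (0 : ℝ), (1 - Real.exp (-t * z ^ 2)) * t ^ (-1 - σ) := by
    rw [← integral_const_mul]
    refine setIntegral_congr_fun measurableSet_Ioi fun t ht => ?_
    rw [Real.mul_rpow hz2.le (le_of_lt ht), show -(z ^ 2 * t) = -t * z ^ 2 by ring]
    ring
  rw [h2] at h
  set I := ∫ t in Ioi (0 : ℝ), (1 - Real.exp (-t * z ^ 2)) * t ^ (-1 - σ)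
  calc I = (z ^ 2 * (z ^ 2) ^ (-1 - σ) * z ^ (2 * σ)) * I := by rw [e, one_mul]
    _ = z ^ 2 * z ^ (2 * σ) * ((z ^ 2) ^ (-1 - σ) * I) := by ring
    _ = _ := by rw [h]; field_simp

lemma IsTest.integrable {φ : ℝ → ℝ} (hφ : IsTest φ) : Integrable φ :=
  hφ.smooth.continuous.integrable_of_hasCompactSupport hφ.compact

lemma IsTest.exists_bound {φ : ℝ → ℝ} (hφ : IsTest φ) : ∃ M, ∀ x, |φ x| ≤ M :=
  hφ.compact.exists_bound_of_continuous hφ.smooth.continuous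

lemma IsTest.exists_abs_sub_heat_le {l : ℝ} (hl : 1 ≤ l) {φ : ℝ → ℝ} (hφ : IsTest φ) {x : ℝ}
    (hx : 0 < x) : ∃ C, 0 ≤ C ∧ ∀ t, 0 < t → |φ x - heat l t φ x| ≤ C * t := by
  obtain ⟨M, hM⟩ := hφ.exists_bound
  obtain ⟨C, hC, h⟩ := exists_abs_sub_heat_le_of_contDiffOn hl hφ.smooth.continuous.measurable hM
    ((contDiff_infty.1 hφ.smooth 2).contDiffOn) hx (b := x)
  exact ⟨C, hC, h x ⟨le_rfl, le_rfl⟩⟩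

/-- The heat semigroup on test functions is diagonalized by the Hankel transform. -/
lemma heat_eq_integral_hankel {l t x : ℝ} (hl : 1 ≤ l) (ht : 0 < t) (hx : 0 < x) {φ : ℝ → ℝ}
    (hφ : IsTest φ) :
    heat l t φ x =
      ∫ z in Ioi (0 : ℝ), hker l (x * z) * (Real.exp (-t * z ^ 2) * hankel l φ z) := by
  obtain ⟨C, hC, h⟩ := exists_abs_hker_le hl
  have hc := continuous_hker hl
  have i1 : Integrable fun y => y ^ l * φ y := hφ.integrable_mul
    ((continuous_id.rpow_const fun x => Or.inr (by linarith)).continuousOn)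
  have i2 := integrableOn_rpow_mul_exp_neg_mul_sq ht (show -1 < l + l by linarith)
  -- Fubini before Weber's integral: the bound z^l on each kernel leaves y^l |φ(y)| times z^{2l}
  -- e^{-tz²}.
  have hint : Integrable (Function.uncurry fun y z =>
      hker l (x * z) * hker l (y * z) * Real.exp (-t * z ^ 2) * φ y)
      ((volume.restrict (Ioi 0)).prod (volume.restrict (Ioi 0))) := by
    have hb : Integrable (fun p : ℝ × ℝ => (p.1 ^ l * φ p.1) * (p.2 ^ (l + l) *
        Real.exp (-t * p.2 ^ 2))) ((volume.restrict (Ioi 0)).prod (volume.restrict (Ioi 0))) :=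
      Integrable.mul_prod (f := fun y => y ^ l * φ y) i1.integrableOn i2
    refine Integrable.mono' (hb.norm.const_mul (C * C * x ^ l)) ?_ ?_
    · refine Continuous.aestronglyMeasurable ?_
      refine (((hc.comp (by fun_prop)).mul (hc.comp (by fun_prop))).mul (by fun_prop)).mul
        (hφ.smooth.continuous.comp continuous_fst)
    · rw [Measure.prod_restrict]
      filter_upwards [ae_restrict_mem (measurableSet_Ioi.prod measurableSet_Ioi)] with p hp
      have hy : 0 < p.1 := hp.1
      have hz : 0 < p.2 := hp.2
      simp only [Function.uncurry]
      rw [norm_mul, norm_mul, norm_mul, norm_mul, norm_mul, norm_mul, Real.rpow_add hz, norm_mul,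
        Real.norm_of_nonneg (Real.rpow_nonneg hz.le l),
        Real.norm_of_nonneg (Real.rpow_nonneg hy.le l)]
      calc _ ≤ C * (x * p.2) ^ l * (C * (p.1 * p.2) ^ l) * ‖Real.exp (-t * p.2 ^ 2)‖ * ‖φ p.1‖ := by
            gcongr
            · exact h _ (by positivity)
            · exact h _ (by positivity)
        _ = _ := by rw [Real.mul_rpow hx.le hz.le, Real.mul_rpow hy.le hz.le]; ring
  have hswap := integral_integral_swap hint
  have hL : heat l t φ x = ∫ y in Ioi (0 : ℝ), ∫ z in Ioi (0 : ℝ),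
      hker l (x * z) * hker l (y * z) * Real.exp (-t * z ^ 2) * φ y := by
    refine setIntegral_congr_fun measurableSet_Ioi fun y hy => ?_
    rw [integral_mul_const, integral_hker_mul_hker_mul_exp hl ht hx hy]
  rw [hL, hswap]
  refine setIntegral_congr_fun measurableSet_Ioi fun z hz => ?_
  rw [hankel_eq l φ hz, ← integral_const_mul, ← integral_const_mul]
  refine integral_congr_ae (ae_of_all _ fun y => ?_)
  simp only [mul_comm y z]
  ring

lemma integrableOn_hker_mul_hankel {l : ℝ} (hl : 1 ≤ l) {φ : ℝ → ℝ} (hφ : IsTest φ) {x : ℝ}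
    (hx : 0 < x) : IntegrableOn (fun z => hker l (x * z) * hankel l φ z) (Ioi 0) := by
  simpa using integrableOn_hker_mul_rpow_mul_hankel hl hφ le_rfl hx

lemma integrableOn_hker_mul_exp_mul_hankel {l : ℝ} (hl : 1 ≤ l) {φ : ℝ → ℝ} (hφ : IsTest φ) {t x : ℝ}
    (ht : 0 ≤ t) (hx : 0 < x) :
    IntegrableOn (fun z => hker l (x * z) * (Real.exp (-t * z ^ 2) * hankel l φ z)) (Ioi 0) := by
  have h := integrableOn_hker_mul_hankel hl hφ hx
  refine Integrable.mono' h.norm ?_ ?_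
  · have := h.aestronglyMeasurable.mul (Continuous.aestronglyMeasurable
      (show Continuous fun z : ℝ => Real.exp (-t * z ^ 2) by fun_prop))
    refine this.congr (ae_of_all _ fun z => ?_)
    simp only [Pi.mul_apply]
    ring
  · refine ae_of_all _ fun z => ?_
    have : Real.exp (-t * z ^ 2) ≤ 1 := Real.exp_le_one_iff.2 (by
      have : 0 ≤ t * z ^ 2 := by positivity
      linarith)
    rw [norm_mul, norm_mul, norm_mul, Real.norm_of_nonneg (Real.exp_pos _).le]
    gcongr
    exact mul_le_of_le_one_left (norm_nonneg _) this

/-- Inversion of the Hankel transform on test functions. -/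
lemma integral_hker_mul_hankel {l : ℝ} (hl : 1 ≤ l) {φ : ℝ → ℝ} (hφ : IsTest φ) {x : ℝ}
    (hx : 0 < x) : ∫ z in Ioi (0 : ℝ), hker l (x * z) * hankel l φ z = φ x := by
  have hi := integrableOn_hker_mul_hankel hl hφ hx
  -- Abel regularization: with the factor e^{-tz²} the inversion integral is `heat l t φ x`, which
  -- tends to φ(x); the factor is then removed by dominated convergence.
  have h1 : Tendsto (fun t : ℝ => ∫ z in Ioi (0 : ℝ),
      hker l (x * z) * (Real.exp (-t * z ^ 2) * hankel l φ z)) (𝓝[>] 0)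
      (𝓝 (∫ z in Ioi (0 : ℝ), hker l (x * z) * hankel l φ z)) := by
    refine tendsto_integral_filter_of_dominated_convergence _ ?_ ?_ hi.norm ?_
    · filter_upwards [self_mem_nhdsWithin] with t ht
      exact (integrableOn_hker_mul_exp_mul_hankel hl hφ (le_of_lt ht) hx).aestronglyMeasurable
    · filter_upwards [self_mem_nhdsWithin] with t ht
      refine ae_of_all _ fun z => ?_
      have ht : 0 < t := ht
      have : Real.exp (-t * z ^ 2) ≤ 1 := Real.exp_le_one_iff.2 (by
        have : 0 ≤ t * z ^ 2 := by positivity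
        linarith)
      rw [norm_mul, norm_mul, norm_mul, Real.norm_of_nonneg (Real.exp_pos _).le]
      gcongr
      exact mul_le_of_le_one_left (norm_nonneg _) this
    · refine ae_of_all _ fun z => ?_
      have : Tendsto (fun t : ℝ => hker l (x * z) * (Real.exp (-t * z ^ 2) * hankel l φ z)) (𝓝 0)
          (𝓝 (hker l (x * z) * (Real.exp (-0 * z ^ 2) * hankel l φ z))) :=
        Continuous.tendsto (by fun_prop) 0
      simp only [neg_zero, zero_mul, Real.exp_zero, one_mul] at this
      exact this.mono_left nhdsWithin_le_nhds
  obtain ⟨C, hC, h⟩ := hφ.exists_abs_sub_heat_le hl hx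
  have h2 : Tendsto (fun t => heat l t φ x) (𝓝[>] 0) (𝓝 (φ x)) := by
    have h3 : Tendsto (fun t => φ x - heat l t φ x) (𝓝[>] 0) (𝓝 0) := by
      refine squeeze_zero_norm' (a := fun t => C * t) ?_ ?_
      · filter_upwards [self_mem_nhdsWithin] with t ht using h t ht
      · have : Tendsto (fun t : ℝ => C * t) (𝓝 0) (𝓝 (C * 0)) :=
          Continuous.tendsto (by fun_prop) 0
        rw [mul_zero] at this
        exact this.mono_left nhdsWithin_le_nhds
    simpa using h3.const_sub (φ x)
  refine tendsto_nhds_unique h1 (h2.congr' ?_)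
  filter_upwards [self_mem_nhdsWithin] with t ht
  exact heat_eq_integral_hankel hl ht hx hφ

lemma sub_heat_eq_integral_hankel {l t x : ℝ} (hl : 1 ≤ l) (ht : 0 < t) (hx : 0 < x) {φ : ℝ → ℝ}
    (hφ : IsTest φ) : φ x - heat l t φ x =
      ∫ z in Ioi (0 : ℝ), hker l (x * z) * hankel l φ z * (1 - Real.exp (-t * z ^ 2)) := by
  rw [heat_eq_integral_hankel hl ht hx hφ, ← integral_hker_mul_hankel hl hφ hx,
    ← integral_sub (integrableOn_hker_mul_hankel hl hφ hx)
      (integrableOn_hker_mul_exp_mul_hankel hl hφ ht.le hx)]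
  refine integral_congr_ae (ae_of_all _ fun z => ?_)
  simp only
  ring

/-- The semigroup formula for the fractional powers on test functions. -/
lemma subordConst_mul_fracTest {l σ x : ℝ} (hl : 1 ≤ l) (h0 : 0 < σ) (h1 : σ < 1) (hx : 0 < x)
    {φ : ℝ → ℝ} (hφ : IsTest φ) : subordConst σ * fracTest l σ φ x =
      ∫ t in Ioi (0 : ℝ), (φ x - heat l t φ x) * t ^ (-1 - σ) := by
  have hi := integrableOn_hker_mul_hankel hl hφ hx
  have hi2 := integrableOn_hker_mul_rpow_mul_hankel hl hφ (q := 2 * σ) (by linarith) hx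
  -- Integrating the norm in t first gives z^{2σ}, which the rapid decay of the Hankel transform
  -- absorbs.
  have hint : Integrable (Function.uncurry fun z t => hker l (x * z) * hankel l φ z *
      ((1 - Real.exp (-t * z ^ 2)) * t ^ (-1 - σ)))
      ((volume.restrict (Ioi 0)).prod (volume.restrict (Ioi 0))) := by
    rw [integrable_prod_iff]
    · refine ⟨?_, ?_⟩
      · filter_upwards [ae_restrict_mem measurableSet_Ioi] with z hz
        exact (integrableOn_subord h0 h1 hz).const_mul (hker l (x * z) * hankel l φ z)
      · refine (hi2.norm.const_mul (subordConst σ)).congr ?_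
        filter_upwards [ae_restrict_mem measurableSet_Ioi] with z hz
        have hz : 0 < z := hz
        simp only [Function.uncurry, norm_mul (hker l (x * z) * hankel l φ z)]
        rw [integral_const_mul]
        have : ∫ t in Ioi (0 : ℝ), ‖(1 - Real.exp (-t * z ^ 2)) * t ^ (-1 - σ)‖ =
            subordConst σ * z ^ (2 * σ) := by
          rw [← integral_subord hz]
          refine setIntegral_congr_fun measurableSet_Ioi fun t ht => ?_
          have ht : 0 < t := ht
          refine Real.norm_of_nonneg (mul_nonneg ?_ (Real.rpow_nonneg ht.le _))
          rw [neg_mul]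
          exact one_sub_exp_neg_nonneg (by positivity)
        rw [this, norm_mul, norm_mul, norm_mul, Real.norm_of_nonneg (Real.rpow_nonneg hz.le _)]
        ring
    · exact (AEStronglyMeasurable.comp_fst hi.aestronglyMeasurable).mul
        (Measurable.aestronglyMeasurable (by fun_prop))
  have hswap := integral_integral_swap hint
  have hL : subordConst σ * fracTest l σ φ x = ∫ z in Ioi (0 : ℝ), ∫ t in Ioi (0 : ℝ),
      hker l (x * z) * hankel l φ z * ((1 - Real.exp (-t * z ^ 2)) * t ^ (-1 - σ)) := by
    rw [fracTest, hankel_eq l _ hx, ← integral_const_mul]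
    refine setIntegral_congr_fun measurableSet_Ioi fun z hz => ?_
    rw [integral_const_mul, integral_subord hz]
    ring
  rw [hL, hswap]
  refine setIntegral_congr_fun measurableSet_Ioi fun t ht => ?_
  rw [sub_heat_eq_integral_hankel hl ht hx hφ, ← integral_mul_const]
  refine integral_congr_ae (ae_of_all _ fun z => ?_)
  simp only
  ring

/-- Duhamel's formula for the heat semigroup on test functions. -/
lemma sub_heat_eq_integral_heat {l t x : ℝ} (hl : 1 ≤ l) (ht : 0 < t) (hx : 0 < x) {φ : ℝ → ℝ}
    (hφ : IsTest φ) : φ x - heat l t φ x = ∫ s in Ioc 0 t, heat l s (bessel l φ) x := by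
  have hi := integrableOn_hker_mul_hankel hl (hφ.bessel l) hx
  have hint : Integrable (Function.uncurry fun z s => hker l (x * z) *
      (Real.exp (-s * z ^ 2) * hankel l (bessel l φ) z))
      ((volume.restrict (Ioi 0)).prod (volume.restrict (Ioc 0 t))) := by
    have hb : Integrable (fun p : ℝ × ℝ => (hker l (x * p.1) * hankel l (bessel l φ) p.1) * 1)
        ((volume.restrict (Ioi 0)).prod (volume.restrict (Ioc 0 t))) :=
      Integrable.mul_prod (f := fun z => hker l (x * z) * hankel l (bessel l φ) z)
        (g := fun _ => (1 : ℝ)) hi (integrable_const _)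
    refine Integrable.mono' hb.norm ?_ ?_
    · have := (AEStronglyMeasurable.comp_fst (ν := volume.restrict (Ioc 0 t))
        hi.aestronglyMeasurable).mul (Continuous.aestronglyMeasurable
        (show Continuous fun p : ℝ × ℝ => Real.exp (-p.2 * p.1 ^ 2) by fun_prop))
      refine this.congr (ae_of_all _ fun z => ?_)
      simp only [Pi.mul_apply, Function.uncurry]
      ring
    · rw [Measure.prod_restrict]
      filter_upwards [ae_restrict_mem (measurableSet_Ioi.prod measurableSet_Ioc)] with p hp
      have hs : 0 < p.2 := hp.2.1
      have : Real.exp (-p.2 * p.1 ^ 2) ≤ 1 := Real.exp_le_one_iff.2 (by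
        have : 0 ≤ p.2 * p.1 ^ 2 := by positivity
        linarith)
      simp only [Function.uncurry, mul_one]
      rw [norm_mul, norm_mul, norm_mul, Real.norm_of_nonneg (Real.exp_pos _).le]
      gcongr
      exact mul_le_of_le_one_left (norm_nonneg _) this
  have hswap := integral_integral_swap hint
  have hR : ∫ s in Ioc 0 t, heat l s (bessel l φ) x = ∫ s in Ioc 0 t, ∫ z in Ioi (0 : ℝ),
      hker l (x * z) * (Real.exp (-s * z ^ 2) * hankel l (bessel l φ) z) :=
    setIntegral_congr_fun measurableSet_Ioc fun s hs =>
      heat_eq_integral_hankel hl hs.1 hx (hφ.bessel l)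
  rw [hR, ← hswap, sub_heat_eq_integral_hankel hl ht hx hφ]
  refine setIntegral_congr_fun measurableSet_Ioi fun z hz => ?_
  have hz : 0 < z := hz
  have hexp : ∫ s in Ioc 0 t, Real.exp (-s * z ^ 2) = (1 - Real.exp (-t * z ^ 2)) / z ^ 2 := by
    rw [← intervalIntegral.integral_of_le ht.le,
      intervalIntegral.integral_eq_sub_of_hasDerivAt (f := fun s => -Real.exp (-s * z ^ 2) / z ^ 2)]
    · simp only [neg_zero, zero_mul, Real.exp_zero]; ring
    · intro s _
      have h1 : HasDerivAt (fun s : ℝ => -s * z ^ 2) (-1 * z ^ 2) s :=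
        ((hasDerivAt_id s).neg).mul_const _
      refine (h1.exp.neg.div_const (z ^ 2)).congr_deriv ?_
      field_simp
    · exact Continuous.intervalIntegrable (by fun_prop) _ _
  rw [integral_const_mul, integral_mul_const, hexp, hankel_bessel hl hφ hz]
  field_simp

/-! ### The heat semigroup on L¹ and its symmetry -/

lemma integrable_heatKernel_mul {l t : ℝ} (hl : 1 ≤ l) (ht : 0 < t) {f : ℝ → ℝ}
    (hf : IntegrableOn f (Ioi 0)) :
    Integrable (Function.uncurry fun y x => heatKernel l t x y * f y)
      ((volume.restrict (Ioi 0)).prod (volume.restrict (Ioi 0))) := by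
  have hm : AEStronglyMeasurable (Function.uncurry fun y x => heatKernel l t x y * f y)
      ((volume.restrict (Ioi 0)).prod (volume.restrict (Ioi 0))) :=
    (((measurable_heatKernel hl).comp
      (by fun_prop : Measurable fun p : ℝ × ℝ => (t, p.2, p.1))).aestronglyMeasurable).mul
      (AEStronglyMeasurable.comp_fst hf.aestronglyMeasurable)
  rw [integrable_prod_iff hm]
  refine ⟨?_, ?_⟩
  · filter_upwards [ae_restrict_mem measurableSet_Ioi] with y hy
    have := (integrableOn_heatKernel hl ht hy).mul_const (f y)
    refine this.congr (ae_of_all _ fun x => ?_)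
    simp only [Function.uncurry, heatKernel_symm l t y x]
  · refine Integrable.mono' hf.norm hm.norm.integral_prod_right' ?_
    filter_upwards [ae_restrict_mem measurableSet_Ioi] with y hy
    have e : ∫ x in Ioi (0 : ℝ), ‖Function.uncurry (fun y x => heatKernel l t x y * f y) (y, x)‖ =
        (∫ x in Ioi (0 : ℝ), heatKernel l t y x) * ‖f y‖ := by
      rw [← integral_mul_const]
      refine setIntegral_congr_fun measurableSet_Ioi fun x hx => ?_
      simp only [Function.uncurry]
      rw [norm_mul, heatKernel_symm, Real.norm_of_nonneg (heatKernel_nonneg hl ht hy hx)]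
    rw [e, norm_mul, norm_norm, Real.norm_of_nonneg
      (setIntegral_nonneg measurableSet_Ioi fun x hx => heatKernel_nonneg hl ht hy hx)]
    exact mul_le_of_le_one_left (norm_nonneg _) (integral_heatKernel_le_one hl ht hy)

lemma integrableOn_heat {l t : ℝ} (hl : 1 ≤ l) (ht : 0 < t) {f : ℝ → ℝ}
    (hf : IntegrableOn f (Ioi 0)) : IntegrableOn (heat l t f) (Ioi 0) :=
  (integrable_heatKernel_mul hl ht hf).integral_prod_right

/-- The heat semigroup is a contraction of `L¹`. -/
lemma integral_norm_heat_le {l t : ℝ} (hl : 1 ≤ l) (ht : 0 < t) {f : ℝ → ℝ}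
    (hf : IntegrableOn f (Ioi 0)) :
    ∫ x in Ioi (0 : ℝ), ‖heat l t f x‖ ≤ ∫ y in Ioi (0 : ℝ), ‖f y‖ := by
  have hi := (integrable_heatKernel_mul hl ht hf).norm
  calc _ ≤ ∫ x in Ioi (0 : ℝ), ∫ y in Ioi (0 : ℝ), ‖heatKernel l t x y * f y‖ :=
        integral_mono (integrableOn_heat hl ht hf).norm hi.integral_prod_right
          fun x => norm_integral_le_integral_norm _
    _ = ∫ y in Ioi (0 : ℝ), ∫ x in Ioi (0 : ℝ), ‖heatKernel l t x y * f y‖ :=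
        (integral_integral_swap (f := fun y x => ‖heatKernel l t x y * f y‖) hi).symm
    _ ≤ _ := by
        refine setIntegral_mono_on hi.integral_prod_left hf.norm measurableSet_Ioi fun y hy => ?_
        have e : ∫ x in Ioi (0 : ℝ), ‖heatKernel l t x y * f y‖ =
            (∫ x in Ioi (0 : ℝ), heatKernel l t y x) * ‖f y‖ := by
          rw [← integral_mul_const]
          refine setIntegral_congr_fun measurableSet_Ioi fun x hx => ?_
          rw [norm_mul, heatKernel_symm, Real.norm_of_nonneg (heatKernel_nonneg hl ht hy hx)]
        rw [e]
        exact mul_le_of_le_one_left (norm_nonneg _) (integral_heatKernel_le_one hl ht hy)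

/-- The heat semigroup is symmetric. -/
lemma integral_mul_heat {l t M : ℝ} (hl : 1 ≤ l) (ht : 0 < t) {u f : ℝ → ℝ} (hu : Measurable u)
    (hM : ∀ x, |u x| ≤ M) (hf : IntegrableOn f (Ioi 0)) :
    ∫ x in Ioi (0 : ℝ), u x * heat l t f x = ∫ y in Ioi (0 : ℝ), heat l t u y * f y := by
  have hi : Integrable (Function.uncurry fun y x => u x * (heatKernel l t x y * f y))
      ((volume.restrict (Ioi 0)).prod (volume.restrict (Ioi 0))) := by
    refine Integrable.mono' ((integrable_heatKernel_mul hl ht hf).norm.const_mul M)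
      ((hu.comp measurable_snd).aestronglyMeasurable.mul
        (integrable_heatKernel_mul hl ht hf).aestronglyMeasurable) (ae_of_all _ fun p => ?_)
    simp only [Function.uncurry]
    rw [norm_mul]
    exact mul_le_mul_of_nonneg_right (hM _) (norm_nonneg _)
  have h := integral_integral_swap hi
  have e1 : ∫ x in Ioi (0 : ℝ), u x * heat l t f x =
      ∫ x in Ioi (0 : ℝ), ∫ y in Ioi (0 : ℝ), u x * (heatKernel l t x y * f y) := by
    refine integral_congr_ae (ae_of_all _ fun x => ?_)
    simp only [heat]
    rw [integral_const_mul]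
  rw [e1, ← h]
  refine integral_congr_ae (ae_of_all _ fun y => ?_)
  simp only [heat]
  rw [← integral_mul_const]
  refine integral_congr_ae (ae_of_all _ fun x => ?_)
  simp only [heatKernel_symm l t y x]
  ring

lemma integral_norm_sub_heat_le {l t : ℝ} (hl : 1 ≤ l) (ht : 0 < t) {φ : ℝ → ℝ}
    (hφ : IsTest φ) : ∫ x in Ioi (0 : ℝ), ‖φ x - heat l t φ x‖ ≤
      2 * ∫ x in Ioi (0 : ℝ), ‖φ x‖ := by
  have hi := hφ.integrable.integrableOn (s := Ioi 0)
  have hh := integrableOn_heat hl ht hi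
  calc _ ≤ ∫ x in Ioi (0 : ℝ), (‖φ x‖ + ‖heat l t φ x‖) :=
        integral_mono (hi.sub hh).norm (hi.norm.add hh.norm) fun x => norm_sub_le _ _
    _ = (∫ x in Ioi (0 : ℝ), ‖φ x‖) + ∫ x in Ioi (0 : ℝ), ‖heat l t φ x‖ :=
        integral_add hi.norm hh.norm
    _ ≤ _ := by linarith [integral_norm_heat_le hl ht hi]

/-- Duhamel's formula and L¹ contractivity. The pointwise O(t) bounds are only local in x, whereas
the pairing with a merely bounded u needs a rate in L¹ of the whole half line. -/
lemma integral_norm_sub_heat_le_mul {l t : ℝ} (hl : 1 ≤ l) (ht : 0 < t) {φ : ℝ → ℝ}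
    (hφ : IsTest φ) : ∫ x in Ioi (0 : ℝ), ‖φ x - heat l t φ x‖ ≤
      (∫ x in Ioi (0 : ℝ), ‖bessel l φ x‖) * t := by
  have hψ := (hφ.bessel l).integrable.integrableOn (s := Ioi 0)
  have hi := hφ.integrable.integrableOn (s := Ioi 0)
  have hh := integrableOn_heat hl ht hi
  have hm : AEStronglyMeasurable (Function.uncurry fun s x => heat l s (bessel l φ) x)
      ((volume.restrict (Ioc 0 t)).prod (volume.restrict (Ioi 0))) :=
    (measurable_heat hl (hφ.bessel l).smooth.continuous.measurable).aestronglyMeasurable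
  have hint : Integrable (Function.uncurry fun s x => heat l s (bessel l φ) x)
      ((volume.restrict (Ioc 0 t)).prod (volume.restrict (Ioi 0))) := by
    rw [integrable_prod_iff hm]
    refine ⟨?_, ?_⟩
    · filter_upwards [ae_restrict_mem measurableSet_Ioc] with s hs
      exact integrableOn_heat hl hs.1 hψ
    · refine Integrable.mono' (integrable_const (∫ x in Ioi (0 : ℝ), ‖bessel l φ x‖))
        hm.norm.integral_prod_right' ?_
      filter_upwards [ae_restrict_mem measurableSet_Ioc] with s hs
      rw [Real.norm_of_nonneg (by positivity)]
      exact integral_norm_heat_le hl hs.1 hψ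
  calc _ ≤ ∫ x in Ioi (0 : ℝ), ∫ s in Ioc 0 t, ‖heat l s (bessel l φ) x‖ := by
        refine setIntegral_mono_on (hi.sub hh).norm hint.norm.integral_prod_right
          measurableSet_Ioi fun x hx => ?_
        rw [sub_heat_eq_integral_heat hl ht hx hφ]
        exact norm_integral_le_integral_norm _
    _ = ∫ s in Ioc 0 t, ∫ x in Ioi (0 : ℝ), ‖heat l s (bessel l φ) x‖ :=
        (integral_integral_swap (f := fun s x => ‖heat l s (bessel l φ) x‖) hint.norm).symm
    _ ≤ ∫ s in Ioc 0 t, ∫ x in Ioi (0 : ℝ), ‖bessel l φ x‖ :=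
        setIntegral_mono_on hint.norm.integral_prod_left (integrable_const _) measurableSet_Ioc
          fun s hs => integral_norm_heat_le hl hs.1 hψ
    _ = _ := by
        rw [setIntegral_const, Measure.real, Real.volume_Ioc, sub_zero, ENNReal.toReal_ofReal ht.le,
          smul_eq_mul, mul_comm]

/-- Fubini with the semigroup acting on φ: u is bounded, and the L¹ norm of φ - `heat l t φ` is O(t)
near 0 and bounded for large t. This also makes the pairing of u with Δ_λ^σ φ absolutely convergent.
-/
lemma integrable_mul_sub_heat_test {l σ M : ℝ} (hl : 1 ≤ l) (h0 : 0 < σ) (h1 : σ < 1) {u φ : ℝ → ℝ}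
    (hu : Measurable u) (hM : ∀ x, |u x| ≤ M) (hφ : IsTest φ) :
    Integrable (Function.uncurry fun t x => u x * (φ x - heat l t φ x) * t ^ (-1 - σ))
      ((volume.restrict (Ioi 0)).prod (volume.restrict (Ioi 0))) := by
  have hM0 : 0 ≤ M := (abs_nonneg _).trans (hM 0)
  have hi := hφ.integrable.integrableOn (s := Ioi 0)
  have hφm := hφ.smooth.continuous.measurable
  have hm : Measurable (Function.uncurry fun t x => u x * (φ x - heat l t φ x) * t ^ (-1 - σ)) :=
    ((hu.comp measurable_snd).mul ((hφm.comp measurable_snd).sub (measurable_heat hl hφm))).mul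
      (by fun_prop)
  have hd : ∀ t, 0 < t → IntegrableOn (fun x => u x * (φ x - heat l t φ x)) (Ioi 0) :=
    fun t ht => Integrable.mono' ((hi.sub (integrableOn_heat hl ht hi)).norm.const_mul M)
      ((hu.mul (hφm.sub ((measurable_heat hl hφm).comp
        (by fun_prop : Measurable fun x : ℝ => (t, x))))).aestronglyMeasurable)
      (ae_of_all _ fun x => by
        rw [norm_mul]; exact mul_le_mul_of_nonneg_right (hM x) (norm_nonneg _))
  have hd2 : ∀ t, 0 < t → ∫ x in Ioi (0 : ℝ), ‖u x * (φ x - heat l t φ x)‖ ≤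
      M * ∫ x in Ioi (0 : ℝ), ‖φ x - heat l t φ x‖ := fun t ht => by
    rw [← integral_const_mul]
    refine integral_mono (hd t ht).norm
      ((hi.sub (integrableOn_heat hl ht hi)).norm.const_mul M) fun x => ?_
    simp only [norm_mul]
    exact mul_le_mul_of_nonneg_right (hM x) (norm_nonneg _)
  rw [integrable_prod_iff hm.aestronglyMeasurable]
  refine ⟨?_, ?_⟩
  · filter_upwards [ae_restrict_mem measurableSet_Ioi] with t ht
    exact (hd t ht).mul_const (t ^ (-1 - σ))
  · have hk : AEStronglyMeasurable (fun t => ∫ x in Ioi (0 : ℝ), ‖u x * (φ x - heat l t φ x)‖)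
        (volume.restrict (Ioi 0)) := by
      have : Measurable (Function.uncurry fun t x => ‖u x * (φ x - heat l t φ x)‖) :=
        ((hu.comp measurable_snd).mul ((hφm.comp measurable_snd).sub (measurable_heat hl hφm))).norm
      exact (this.aestronglyMeasurable (μ := (volume.restrict (Ioi 0)).prod
        (volume.restrict (Ioi 0)))).integral_prod_right'
    have := integrableOn_mul_rpow_neg (β := 1) (σ := σ)
      (A := M * ∫ x in Ioi (0 : ℝ), ‖bessel l φ x‖) (M := M * (2 * ∫ x in Ioi (0 : ℝ), ‖φ x‖)) hk
      ?_ ?_ h0 h1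
    · refine this.congr ?_
      filter_upwards [ae_restrict_mem measurableSet_Ioi] with t ht
      have ht : 0 < t := ht
      rw [← integral_mul_const]
      refine integral_congr_ae (ae_of_all _ fun x => ?_)
      simp only [Function.uncurry]
      rw [norm_mul _ (t ^ (-1 - σ)), Real.norm_of_nonneg (Real.rpow_nonneg ht.le (-1 - σ))]
    · intro t ht _
      rw [abs_of_nonneg (by positivity), Real.rpow_one, mul_assoc]
      exact (hd2 t ht).trans
        (mul_le_mul_of_nonneg_left (integral_norm_sub_heat_le_mul hl ht hφ) hM0)
    · intro t ht
      have ht : 0 < t := zero_lt_one.trans ht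
      rw [abs_of_nonneg (by positivity)]
      exact (hd2 t ht).trans
        (mul_le_mul_of_nonneg_left (integral_norm_sub_heat_le hl ht hφ) hM0)

/-! ### Transposition: the fractional operator on bounded functions -/

/-- The semigroup formula for the fractional Bessel operator. -/
def fracHeat (l σ : ℝ) (u : ℝ → ℝ) (x : ℝ) : ℝ :=
  (subordConst σ)⁻¹ * ∫ t in Ioi (0 : ℝ), (u x - heat l t u x) * t ^ (-1 - σ)

/-- Local uniform convergence `heat l t u → u` at the rate `t ^ β`. -/
def HasHeatRate (l β : ℝ) (u : ℝ → ℝ) : Prop :=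
  ∀ a b : ℝ, 0 < a → ∃ K, 0 ≤ K ∧ ∀ x ∈ Icc a b, ∀ t, 0 < t → t ≤ 1 →
    |u x - heat l t u x| ≤ K * t ^ β

/-- A common majorant for small and large times. -/
def rateBound (K M β t : ℝ) : ℝ := if t ≤ 1 then K * t ^ β else 2 * M

lemma integrableOn_rateBound {K M β σ : ℝ} (hK : 0 ≤ K) (hM : 0 ≤ M) (h0 : 0 < σ) (hβ : σ < β) :
    IntegrableOn (fun t => rateBound K M β t * t ^ (-1 - σ)) (Ioi 0) := by
  refine integrableOn_mul_rpow_neg (A := K) (M := 2 * M) (β := β) ?_ ?_ ?_ h0 hβ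
  · exact (Measurable.ite measurableSet_Iic (by fun_prop)
      measurable_const).aestronglyMeasurable
  · intro t ht ht1
    rw [rateBound, if_pos ht1, abs_of_nonneg (mul_nonneg hK (Real.rpow_nonneg ht.le _))]
  · intro t ht
    rw [rateBound, if_neg (not_le.2 ht), abs_of_nonneg (by positivity)]

lemma abs_sub_heat_le_rateBound {l K M β a b : ℝ} (hl : 1 ≤ l) (ha : 0 < a) {u : ℝ → ℝ}
    (hM : ∀ x, |u x| ≤ M) (h : ∀ x ∈ Icc a b, ∀ t, 0 < t → t ≤ 1 →
      |u x - heat l t u x| ≤ K * t ^ β) {x t : ℝ} (hx : x ∈ Icc a b) (ht : 0 < t) :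
    |u x - heat l t u x| ≤ rateBound K M β t := by
  unfold rateBound
  split_ifs with h1
  · exact h x hx t ht h1
  · have := abs_heat_le hl ht (ha.trans_le hx.1) hM
    exact (abs_sub _ _).trans (by linarith [hM x])

lemma continuousOn_fracHeat {l σ M β : ℝ} (hl : 1 ≤ l) {u : ℝ → ℝ} (hu : Measurable u)
    (hM : ∀ x, |u x| ≤ M) (hc : ContinuousOn u (Ioi 0)) (h : HasHeatRate l β u) (h0 : 0 < σ)
    (hβ : σ < β) : ContinuousOn (fracHeat l σ u) (Ioi 0) := by
  intro x hx
  have hx : 0 < x := hx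
  have hM0 : 0 ≤ M := (abs_nonneg _).trans (hM 0)
  obtain ⟨K, hK, hr⟩ := h (x / 2) (2 * x) (by positivity)
  refine ContinuousAt.continuousWithinAt (ContinuousAt.mul continuousAt_const ?_)
  refine continuousAt_of_dominated (bound := fun t => rateBound K M β t * t ^ (-1 - σ)) ?_ ?_
    (integrableOn_rateBound hK hM0 h0 hβ) ?_
  · refine Eventually.of_forall fun z => Measurable.aestronglyMeasurable ?_
    exact (measurable_const.sub ((measurable_heat hl hu).comp
      (by fun_prop : Measurable fun t : ℝ => (t, z)))).mul (by fun_prop)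
  · filter_upwards [Icc_mem_nhds (show x / 2 < x by linarith) (show x < 2 * x by linarith)]
      with z hz
    filter_upwards [ae_restrict_mem measurableSet_Ioi] with t ht
    have ht : 0 < t := ht
    rw [norm_mul, Real.norm_of_nonneg (Real.rpow_nonneg ht.le (-1 - σ))]
    exact mul_le_mul_of_nonneg_right
      (abs_sub_heat_le_rateBound hl (by positivity) hM hr hz ht) (Real.rpow_nonneg ht.le _)
  · filter_upwards [ae_restrict_mem measurableSet_Ioi] with t ht
    exact ((hc.continuousAt (isOpen_Ioi.mem_nhds hx)).sub
      ((continuousOn_heat hl ht hu hM).continuousAt (isOpen_Ioi.mem_nhds hx))).mul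
        continuousAt_const

lemma IsTest.exists_support_subset {φ : ℝ → ℝ} (hφ : IsTest φ) :
    ∃ a b : ℝ, 0 < a ∧ ∀ x, x ∉ Icc a b → φ x = 0 := by
  rcases (tsupport φ).eq_empty_or_nonempty with h | h
  · refine ⟨1, 1, one_pos, fun x _ => image_eq_zero_of_notMem_tsupport (by simp [h])⟩
  · obtain ⟨a, ha⟩ := hφ.compact.isCompact.exists_isLeast h
    obtain ⟨b, hb⟩ := hφ.compact.isCompact.exists_isGreatest h
    exact ⟨a, b, hφ.support ha.1, fun x hx =>
      image_eq_zero_of_notMem_tsupport fun hx' => hx ⟨ha.2 hx', hb.2 hx'⟩⟩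

/-- Fubini with the semigroup acting on u: φ confines x to a compact interval, where the local rate
t^β with β > σ suffices. -/
lemma integrable_sub_heat_mul_test {l σ M β : ℝ} (hl : 1 ≤ l) {u φ : ℝ → ℝ} (hu : Measurable u)
    (hM : ∀ x, |u x| ≤ M) (h : HasHeatRate l β u) (h0 : 0 < σ) (hβ : σ < β) (hφ : IsTest φ) :
    Integrable (Function.uncurry fun t x => (u x - heat l t u x) * φ x * t ^ (-1 - σ))
      ((volume.restrict (Ioi 0)).prod (volume.restrict (Ioi 0))) := by
  have hM0 : 0 ≤ M := (abs_nonneg _).trans (hM 0)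
  obtain ⟨a, b, ha, hab⟩ := hφ.exists_support_subset
  obtain ⟨K, hK, hr⟩ := h a b ha
  have hb : Integrable (fun p : ℝ × ℝ => (rateBound K M β p.1 * p.1 ^ (-1 - σ)) * ‖φ p.2‖)
      ((volume.restrict (Ioi 0)).prod (volume.restrict (Ioi 0))) :=
    Integrable.mul_prod (f := fun t => rateBound K M β t * t ^ (-1 - σ)) (g := fun x => ‖φ x‖)
      (integrableOn_rateBound hK hM0 h0 hβ) hφ.integrable.norm.integrableOn
  refine Integrable.mono' hb ?_ ?_
  · refine Measurable.aestronglyMeasurable ?_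
    exact (((hu.comp measurable_snd).sub (measurable_heat hl hu)).mul
      (hφ.smooth.continuous.measurable.comp measurable_snd)).mul (by fun_prop)
  · rw [Measure.prod_restrict]
    filter_upwards [ae_restrict_mem (measurableSet_Ioi.prod measurableSet_Ioi)] with p hp
    have ht : 0 < p.1 := hp.1
    simp only [Function.uncurry]
    by_cases hx : p.2 ∈ Icc a b
    · rw [norm_mul, norm_mul, Real.norm_of_nonneg (Real.rpow_nonneg ht.le (-1 - σ)),
        mul_right_comm]
      gcongr
      exact abs_sub_heat_le_rateBound hl ha hM hr hx ht
    · simp [hab _ hx]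

/-- For fixed t, symmetry gives ∫ u (φ - e^{-tΔ}φ) = ∫ (u - e^{-tΔ}u) φ. Integrating against
t^{-1-σ} dt, with one Fubini theorem on each side, moves the whole semigroup formula from φ to u. -/
theorem isFracBessel_fracHeat {l σ M β : ℝ} (hl : 1 ≤ l) {u : ℝ → ℝ} (hu : Measurable u)
    (hM : ∀ x, |u x| ≤ M) (hc : ContinuousOn u (Ioi 0)) (h : HasHeatRate l β u) (h0 : 0 < σ)
    (h1 : σ < 1) (hβ : σ < β) : IsFracBessel l σ u (fracHeat l σ u) := by
  have hD := subordConst_pos h0 h1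
  have e : ∀ φ, IsTest φ → ∀ x ∈ Ioi (0 : ℝ), u x * fracTest l σ φ x = (subordConst σ)⁻¹ *
      ∫ t in Ioi (0 : ℝ), u x * (φ x - heat l t φ x) * t ^ (-1 - σ) := fun φ hφ x hx => by
    have := subordConst_mul_fracTest hl h0 h1 hx hφ
    simp only [mul_assoc]
    rw [integral_const_mul, ← this]
    field_simp
  refine ⟨continuousOn_fracHeat hl hu hM hc h h0 hβ, fun φ hφ => ?_, fun φ hφ => ?_⟩
  · have hi := ((integrable_mul_sub_heat_test hl h0 h1 hu hM hφ).integral_prod_right).const_mul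
      (subordConst σ)⁻¹
    refine hi.congr ?_
    filter_upwards [ae_restrict_mem measurableSet_Ioi] with x hx
    exact (e φ hφ x hx).symm
  · have hφi := hφ.integrable.integrableOn (s := Ioi 0)
    have hφm := hφ.smooth.continuous.measurable
    rw [setIntegral_congr_fun measurableSet_Ioi (e φ hφ), integral_const_mul,
      ← integral_integral_swap (integrable_mul_sub_heat_test hl h0 h1 hu hM hφ)]
    have e2 : ∫ x in Ioi (0 : ℝ), fracHeat l σ u x * φ x = (subordConst σ)⁻¹ *
        ∫ x in Ioi (0 : ℝ), ∫ t in Ioi (0 : ℝ), (u x - heat l t u x) * φ x * t ^ (-1 - σ) := by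
      rw [← integral_const_mul]
      refine integral_congr_ae (ae_of_all _ fun x => ?_)
      simp only [fracHeat]
      rw [mul_assoc, ← integral_mul_const]
      congr 1
      refine integral_congr_ae (ae_of_all _ fun t => ?_)
      simp only
      ring
    rw [e2, ← integral_integral_swap (integrable_sub_heat_mul_test hl hu hM h h0 hβ hφ)]
    congr 1
    refine setIntegral_congr_fun measurableSet_Ioi fun t ht => ?_
    have ht : 0 < t := ht
    simp only [integral_mul_const]
    congr 1
    have bm : ∀ {f g : ℝ → ℝ}, Measurable f → (∀ x, 0 < x → |f x| ≤ M) →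
        IntegrableOn g (Ioi 0) → IntegrableOn (fun x => f x * g x) (Ioi 0) := fun hf hb hg =>
      Integrable.mono' (hg.norm.const_mul M) (hf.aestronglyMeasurable.mul hg.aestronglyMeasurable)
        ((ae_restrict_mem measurableSet_Ioi).mono fun x hx => by
          rw [norm_mul]; exact mul_le_mul_of_nonneg_right (hb x hx) (norm_nonneg _))
    have i1 := bm hu (fun x _ => hM x) hφi
    have i2 := bm hu (fun x _ => hM x) (integrableOn_heat hl ht hφi)
    have i3 := bm ((measurable_heat hl hu).comp (by fun_prop : Measurable fun x : ℝ => (t, x)))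
      (fun x hx => abs_heat_le hl ht hx hM) hφi
    simp only [mul_sub, sub_mul]
    rw [integral_sub i1 i2, integral_mul_heat hl ht hu hM hφi]
    exact (integral_sub i1 i3).symm

/-! ### Abelian limits as σ → 0 and σ → 1 -/

/-- An Abelian theorem in the variable `r = t ^ δ`. -/
lemma tendsto_integral_comp_rpow {h : ℝ → ℝ} {B β κ : ℝ} (hm : Measurable h) (hβ : 0 < β)
    (h1 : ∀ t, 0 < t → t ≤ 1 → |h t| ≤ B) (h2 : ∀ t, 1 < t → |h t| ≤ B * t ^ (-β))
    (h3 : Tendsto h (𝓝[>] 0) (𝓝 κ)) :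
    Tendsto (fun δ : ℝ => ∫ r in Ioi (0 : ℝ), h (r ^ (1 / δ))) (𝓝[>] 0) (𝓝 κ) := by
  have hB : 0 ≤ B := (abs_nonneg _).trans (h1 1 one_pos le_rfl)
  -- As δ → 0, r^{1/δ} tends to 0 for r < 1 and to ∞ for r > 1, so the integrand tends to κ on (0,
  -- 1) and to 0 beyond; r = 1 is a null set.
  let f : ℝ → ℝ := fun r => if r < 1 then κ else 0
  -- Beyond 1 the decay gives r^{-β/δ}, which is at most r^{-2} once δ < β/2.
  let bd : ℝ → ℝ := fun r => if r ≤ 1 then B else B * r ^ (-2 : ℝ)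
  have hf : ∫ r in Ioi (0 : ℝ), f r = κ := by
    have e : f = (Iio (1 : ℝ)).indicator fun _ => κ := by
      funext r; simp [f, indicator_apply]
    rw [e, setIntegral_indicator measurableSet_Iio, setIntegral_const, Measure.real,
      Ioi_inter_Iio, Real.volume_Ioo]
    simp
  have hbd : IntegrableOn bd (Ioi 0) := by
    rw [← Ioc_union_Ioi_eq_Ioi zero_le_one]
    refine IntegrableOn.union ?_ ?_
    · refine (integrableOn_const (C := B) (by simp)).congr_fun (fun r hr => ?_) measurableSet_Ioc
      simp only [bd, if_pos hr.2]
    · refine IntegrableOn.congr_fun ((integrableOn_Ioi_rpow_of_lt (a := -2) (by norm_num)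
        one_pos).const_mul B) (fun r hr => ?_) measurableSet_Ioi
      simp only [bd, if_neg (not_le.2 (mem_Ioi.1 hr))]
  have hinv : Tendsto (fun δ : ℝ => 1 / δ) (𝓝[>] 0) atTop := by
    simpa only [one_div] using tendsto_inv_nhdsGT_zero (𝕜 := ℝ)
  rw [← hf]
  refine tendsto_integral_filter_of_dominated_convergence bd ?_ ?_ hbd ?_
  · exact Eventually.of_forall fun δ => (hm.comp (by fun_prop)).aestronglyMeasurable
  · filter_upwards [self_mem_nhdsWithin, Ioo_mem_nhdsGT (show (0 : ℝ) < β / 2 by positivity)]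
      with δ hδ hδ2
    have hδ : 0 < δ := hδ
    filter_upwards [ae_restrict_mem measurableSet_Ioi] with r hr
    have hr : 0 < r := hr
    rw [Real.norm_eq_abs]
    simp only [bd]
    split_ifs with hr1
    · exact h1 _ (Real.rpow_pos_of_pos hr _) (Real.rpow_le_one hr.le hr1 (by positivity))
    · push Not at hr1
      refine (h2 _ (Real.one_lt_rpow hr1 (by positivity))).trans ?_
      rw [← Real.rpow_mul hr.le]
      refine mul_le_mul_of_nonneg_left (Real.rpow_le_rpow_of_exponent_le hr1.le ?_) hB
      have : 2 ≤ β / δ := by rw [le_div_iff₀ hδ]; linarith [hδ2.2]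
      rw [one_div, mul_neg, mul_comm, ← div_eq_mul_inv]
      linarith
  · have hne : ∀ᵐ r : ℝ ∂(volume.restrict (Ioi 0)), r ≠ 1 := by
      refine ae_restrict_of_ae ?_
      simp [ae_iff]
    filter_upwards [ae_restrict_mem measurableSet_Ioi, hne] with r hr hr1
    have hr : 0 < r := hr
    rcases lt_or_gt_of_ne hr1 with hlt | hgt
    · simp only [f, if_pos hlt]
      refine h3.comp (tendsto_nhdsWithin_iff.2
        ⟨(tendsto_rpow_atTop_of_base_lt_one r (by linarith) hlt).comp hinv,
          Eventually.of_forall fun δ => Real.rpow_pos_of_pos hr _⟩)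
    · simp only [f, if_neg (not_lt.2 hgt.le)]
      have ht : Tendsto (fun δ : ℝ => r ^ (1 / δ)) (𝓝[>] 0) atTop :=
        (tendsto_rpow_atTop_of_base_gt_one r hgt).comp hinv
      have h4 : Tendsto (fun δ : ℝ => B * (r ^ (1 / δ)) ^ (-β)) (𝓝[>] 0) (𝓝 0) := by
        simpa using ((tendsto_rpow_neg_atTop hβ).comp ht).const_mul B
      refine squeeze_zero_norm' ?_ h4
      filter_upwards [self_mem_nhdsWithin] with δ hδ
      have hδ : 0 < δ := hδ
      exact h2 _ (Real.one_lt_rpow hgt (by positivity))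

/-- The substitution t = r^{-1/σ} turns σ t^{-1-σ} dt into dr and exchanges t = ∞ with r = 0. -/
lemma mul_integral_mul_rpow_eq_integral_comp_inv (k : ℝ → ℝ) {σ : ℝ} (hσ : 0 < σ) :
    σ * ∫ t in Ioi (0 : ℝ), k t * t ^ (-1 - σ) =
      ∫ r in Ioi (0 : ℝ), k ((r ^ (1 / σ))⁻¹) := by
  rw [← integral_comp_rpow_Ioi (fun t => k t * t ^ (-1 - σ)) (p := -(1 / σ)) (by simp [hσ.ne']),
    ← integral_const_mul]
  refine setIntegral_congr_fun measurableSet_Ioi fun r hr => ?_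
  have hr : 0 < r := hr
  have e : r ^ (-(1 / σ) - 1) * (r ^ (-(1 / σ))) ^ (-1 - σ) = 1 := by
    rw [← Real.rpow_mul hr.le, ← Real.rpow_add hr]
    have : -(1 / σ) - 1 + -(1 / σ) * (-1 - σ) = 0 := by field_simp; ring
    rw [this, Real.rpow_zero]
  rw [abs_neg, abs_of_pos (by positivity : 0 < 1 / σ), ← Real.rpow_neg hr.le]
  calc _ = (σ * (1 / σ)) * (r ^ (-(1 / σ) - 1) * (r ^ (-(1 / σ))) ^ (-1 - σ)) *
        k (r ^ (-(1 / σ))) := by simp only [smul_eq_mul]; ring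
    _ = _ := by rw [e, mul_one_div_cancel hσ.ne', one_mul, one_mul]

/-- Here t = r^{1/δ} with δ = 1 - σ: δ t^{δ-1} dt becomes dr, and the remaining t^{-1} makes the
quotient k(t)/t. -/
lemma mul_integral_mul_rpow_eq_integral_div (k : ℝ → ℝ) {δ : ℝ} (hδ : 0 < δ) :
    δ * ∫ t in Ioi (0 : ℝ), k t * t ^ (-1 - (1 - δ)) =
      ∫ r in Ioi (0 : ℝ), k (r ^ (1 / δ)) / r ^ (1 / δ) := by
  rw [← integral_comp_rpow_Ioi (fun t => k t * t ^ (-1 - (1 - δ))) (p := 1 / δ)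
    (by simp [hδ.ne']), ← integral_const_mul]
  refine setIntegral_congr_fun measurableSet_Ioi fun r hr => ?_
  have hr : 0 < r := hr
  have e : r ^ (1 / δ - 1) * (r ^ (1 / δ)) ^ (-1 - (1 - δ)) = (r ^ (1 / δ))⁻¹ := by
    rw [← Real.rpow_mul hr.le, ← Real.rpow_add hr, ← Real.rpow_neg hr.le]
    congr 1
    field_simp
    ring
  rw [abs_of_pos (by positivity : 0 < 1 / δ)]
  calc _ = (δ * (1 / δ)) * (r ^ (1 / δ - 1) * (r ^ (1 / δ)) ^ (-1 - (1 - δ))) *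
        k (r ^ (1 / δ)) := by simp only [smul_eq_mul]; ring
    _ = _ := by rw [e, mul_one_div_cancel hδ.ne', one_mul]; ring

lemma tendsto_mul_integral_zero {k : ℝ → ℝ} {A M β κ : ℝ} (hm : Measurable k) (hβ : 0 < β)
    (h1 : ∀ t, 0 < t → t ≤ 1 → |k t| ≤ A * t ^ β) (h2 : ∀ t, 1 ≤ t → |k t| ≤ M)
    (h3 : Tendsto k atTop (𝓝 κ)) :
    Tendsto (fun σ : ℝ => σ * ∫ t in Ioi (0 : ℝ), k t * t ^ (-1 - σ)) (𝓝[>] 0) (𝓝 κ) := by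
  have := tendsto_integral_comp_rpow (h := fun s => k s⁻¹) (B := max A M) (β := β) (κ := κ)
    (hm.comp measurable_inv) hβ
    (fun t ht ht1 => (h2 _ ((one_le_inv₀ ht).2 ht1)).trans (le_max_right _ _))
    (fun t ht => by
      have h0 : 0 < t := zero_lt_one.trans ht
      refine (h1 _ (inv_pos.2 h0) (inv_le_one_of_one_le₀ ht.le)).trans ?_
      rw [Real.inv_rpow h0.le, ← Real.rpow_neg h0.le]
      exact mul_le_mul_of_nonneg_right (le_max_left _ _) (Real.rpow_nonneg h0.le _))
    (h3.comp tendsto_inv_nhdsGT_zero)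
  refine this.congr' ?_
  filter_upwards [self_mem_nhdsWithin] with σ hσ
  exact (mul_integral_mul_rpow_eq_integral_comp_inv k hσ).symm

lemma tendsto_mul_integral_one {k : ℝ → ℝ} {A M κ : ℝ} (hm : Measurable k)
    (h1 : ∀ t, 0 < t → t ≤ 1 → |k t| ≤ A * t) (h2 : ∀ t, 1 ≤ t → |k t| ≤ M)
    (h3 : Tendsto (fun t => k t / t) (𝓝[>] 0) (𝓝 κ)) :
    Tendsto (fun σ : ℝ => (1 - σ) * ∫ t in Ioi (0 : ℝ), k t * t ^ (-1 - σ)) (𝓝[<] 1) (𝓝 κ) := by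
  have h := tendsto_integral_comp_rpow (h := fun t => k t / t) (B := max A M) (β := 1) (κ := κ)
    (hm.div measurable_id) one_pos
    (fun t ht ht1 => by
      rw [abs_div, abs_of_pos ht, div_le_iff₀ ht]
      exact (h1 t ht ht1).trans (mul_le_mul_of_nonneg_right (le_max_left _ _) ht.le))
    (fun t ht => by
      have h0 : 0 < t := zero_lt_one.trans ht
      rw [abs_div, abs_of_pos h0, Real.rpow_neg_one, div_eq_mul_inv]
      exact mul_le_mul_of_nonneg_right ((h2 t ht.le).trans (le_max_right _ _)) (inv_pos.2 h0).le) h3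
  have hsub : Tendsto (fun σ : ℝ => 1 - σ) (𝓝[<] 1) (𝓝[>] 0) := by
    refine tendsto_nhdsWithin_iff.2 ⟨?_, ?_⟩
    · have : Tendsto (fun σ : ℝ => 1 - σ) (𝓝 1) (𝓝 (1 - 1)) := Continuous.tendsto (by fun_prop) 1
      rw [sub_self] at this
      exact this.mono_left nhdsWithin_le_nhds
    · filter_upwards [self_mem_nhdsWithin] with σ hσ
      exact sub_pos.2 (mem_Iio.1 hσ)
  refine (h.comp hsub).congr' ?_
  filter_upwards [self_mem_nhdsWithin] with σ hσ
  have hσ : σ < 1 := hσ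
  have := mul_integral_mul_rpow_eq_integral_div k (δ := 1 - σ) (by linarith)
  rw [show -1 - (1 - (1 - σ)) = -1 - σ by ring] at this
  exact this.symm

lemma abs_one_sub_exp_neg_le {t : ℝ} (ht : 0 < t) : |1 - Real.exp (-t)| ≤ 1 * t := by
  rw [abs_of_nonneg (one_sub_exp_neg_nonneg ht.le), one_mul]
  exact one_sub_exp_neg_le t

lemma abs_one_sub_exp_neg_le_one {t : ℝ} (ht : 1 ≤ t) : |1 - Real.exp (-t)| ≤ 1 := by
  rw [abs_of_nonneg (one_sub_exp_neg_nonneg (zero_le_one.trans ht))]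
  exact one_sub_exp_neg_le_one t

/-- The constant is itself such an integral, with k(t) = 1 - e^{-t}, k(∞) = 1 and k'(0) = 1; hence
it cancels in both limits. -/
lemma tendsto_mul_subordConst_zero :
    Tendsto (fun σ : ℝ => σ * subordConst σ) (𝓝[>] 0) (𝓝 1) := by
  refine tendsto_mul_integral_zero (A := 1) (M := 1) (β := 1) (by fun_prop) one_pos
    (fun t ht _ => by simpa using abs_one_sub_exp_neg_le ht)
    (fun t ht => abs_one_sub_exp_neg_le_one ht) ?_
  simpa using Real.tendsto_exp_neg_atTop_nhds_zero.const_sub 1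

lemma tendsto_mul_subordConst_one :
    Tendsto (fun σ : ℝ => (1 - σ) * subordConst σ) (𝓝[<] 1) (𝓝 1) := by
  refine tendsto_mul_integral_one (A := 1) (M := 1) (by fun_prop)
    (fun t ht _ => abs_one_sub_exp_neg_le ht) (fun t ht => abs_one_sub_exp_neg_le_one ht) ?_
  have h1 : HasDerivAt (fun t : ℝ => 1 - Real.exp (-t)) 1 0 := by
    have := ((hasDerivAt_id (0 : ℝ)).fun_neg.exp).const_sub 1
    simpa using this
  have h2 := (hasDerivWithinAt_iff_tendsto_slope' (by simp)).1 (h1.hasDerivWithinAt (s := Ioi 0))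
  refine h2.congr fun t => ?_
  simp [slope_def_field]

lemma tendsto_fracHeat_zero {l M β : ℝ} (hl : 1 ≤ l) {u : ℝ → ℝ} (hu : Measurable u)
    (hM : ∀ x, |u x| ≤ M) (hβ : 0 < β) (h : HasHeatRate l β u)
    (hi : IntegrableOn (fun y => u y / (1 + y)) (Ioi 0)) {x : ℝ} (hx : 0 < x) :
    Tendsto (fun σ => fracHeat l σ u x) (𝓝[>] 0) (𝓝 (u x)) := by
  obtain ⟨K, hK, hr⟩ := h x x hx
  have h1 := tendsto_mul_integral_zero (k := fun t => u x - heat l t u x) (A := K) (M := 2 * M)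
    (κ := u x) (measurable_const.sub ((measurable_heat hl hu).comp
      (by fun_prop : Measurable fun t : ℝ => (t, x)))) hβ (fun t ht ht1 => hr x ⟨le_rfl, le_rfl⟩ t ht ht1)
    (fun t ht => (abs_sub _ _).trans (by
      linarith [hM x, abs_heat_le hl (zero_lt_one.trans_le ht) hx hM]))
    (by simpa using (tendsto_heat_atTop hl hu hi hx).const_sub (u x))
  have h2 := (tendsto_mul_subordConst_zero.inv₀ one_ne_zero).mul h1
  rw [inv_one, one_mul] at h2
  refine h2.congr' ?_
  filter_upwards [self_mem_nhdsWithin] with σ hσ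
  have hσ : 0 < σ := hσ
  rw [fracHeat, mul_inv]
  field_simp

lemma tendsto_fracHeat_one {l M : ℝ} (hl : 1 ≤ l) {u : ℝ → ℝ} (hu : Measurable u)
    (hM : ∀ x, |u x| ≤ M) (h : ContDiffOn ℝ 2 u (Ioi 0)) {x : ℝ} (hx : 0 < x) :
    Tendsto (fun σ => fracHeat l σ u x) (𝓝[<] 1) (𝓝 (bessel l u x)) := by
  obtain ⟨K, hK, hr⟩ := exists_abs_sub_heat_le_of_contDiffOn hl hu hM h hx (b := x)
  have h1 := tendsto_mul_integral_one (k := fun t => u x - heat l t u x) (A := K) (M := 2 * M)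
    (measurable_const.sub ((measurable_heat hl hu).comp
      (by fun_prop : Measurable fun t : ℝ => (t, x)))) (fun t ht _ => hr x ⟨le_rfl, le_rfl⟩ t ht)
    (fun t ht => (abs_sub _ _).trans (by
      linarith [hM x, abs_heat_le hl (zero_lt_one.trans_le ht) hx hM]))
    (tendsto_sub_heat_div hl hu hM h hx)
  have h2 := (tendsto_mul_subordConst_one.inv₀ one_ne_zero).mul h1
  rw [inv_one, one_mul] at h2
  refine h2.congr' ?_
  filter_upwards [self_mem_nhdsWithin] with σ hσ
  have hσ : 0 < 1 - σ := sub_pos.2 (mem_Iio.1 hσ)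
  rw [fracHeat, mul_inv]
  field_simp

/-! ### Reduction to bounded measurable functions and conclusion -/

lemma exists_bound_of_memLp_top {u : ℝ → ℝ} (hu : MemLp u ∞ (volume.restrict (Ioi (0 : ℝ))))
    (hc : ContinuousOn u (Ioi 0)) : ∃ M, 0 ≤ M ∧ ∀ x, 0 < x → |u x| ≤ M := by
  obtain ⟨M, hM⟩ : ∃ M : ℝ, ∀ᵐ x ∂(volume.restrict (Ioi (0 : ℝ))), |u x| ≤ M := by
    refine ⟨(eLpNorm u ∞ (volume.restrict (Ioi (0 : ℝ)))).toReal, ?_⟩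
    rw [eLpNorm_exponent_top]
    have hfin := hu.eLpNorm_lt_top
    rw [eLpNorm_exponent_top] at hfin
    filter_upwards [ae_le_eLpNormEssSup (f := u)] with x hx
    rw [← Real.norm_eq_abs, ← toReal_enorm]
    exact ENNReal.toReal_mono hfin.ne hx
  refine ⟨max M 0, le_max_right _ _, fun x hx => ?_⟩
  -- The continuous functions min(|u|, M) and |u| agree almost everywhere, hence everywhere on (0,
  -- ∞).
  have h := Measure.eqOn_open_of_ae_eq (μ := volume) (f := fun x => min |u x| M)
    (g := fun x => |u x|) (hM.mono fun x hx => min_eq_left hx) isOpen_Ioi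
    (hc.abs.inf continuousOn_const) hc.abs hx
  exact (min_eq_left_iff.1 h).trans (le_max_left _ _)

lemma IsFracBessel.congr {l σ : ℝ} {u v g : ℝ → ℝ} (h : IsFracBessel l σ u g)
    (huv : EqOn u v (Ioi 0)) : IsFracBessel l σ v g := by
  have e : ∀ φ, EqOn (fun x => u x * fracTest l σ φ x) (fun x => v x * fracTest l σ φ x) (Ioi 0) :=
    fun φ x hx => by simp only [huv hx]
  refine ⟨h.continuousOn, fun φ hφ => (h.integrable φ hφ).congr_fun (e φ) measurableSet_Ioi,
    fun φ hφ => ?_⟩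
  rw [← h.pairing φ hφ, setIntegral_congr_fun measurableSet_Ioi (e φ)]

lemma IsFracBessel.fracBessel {l σ : ℝ} {u g : ℝ → ℝ} (h : IsFracBessel l σ u g) :
    IsFracBessel l σ u (fracBessel l σ u) := by
  have hex : ∃ g, IsFracBessel l σ u g := ⟨g, h⟩
  rw [FracBessel.fracBessel, dif_pos hex]
  exact hex.choose_spec

lemma bessel_congr {u v : ℝ → ℝ} (l : ℝ) (huv : EqOn u v (Ioi 0)) {x : ℝ} (hx : 0 < x) :
    bessel l u x = bessel l v x := by
  have h : u =ᶠ[𝓝 x] v := huv.eventuallyEq_of_mem (Ioi_mem_nhds hx)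
  rw [bessel, bessel, h.deriv.deriv_eq, h.self_of_nhds]

/-- The values of u off (0, ∞) are arbitrary; extension by zero gives the global measurability and
bound required by the heat estimates without changing the functional. -/
lemma exists_measurable_bounded {u : ℝ → ℝ} (hu : MemLp u ∞ (volume.restrict (Ioi (0 : ℝ))))
    (hc : ContinuousOn u (Ioi 0)) :
    ∃ (v : ℝ → ℝ) (M : ℝ), Measurable v ∧ (∀ x, |v x| ≤ M) ∧ EqOn v u (Ioi 0) := by
  obtain ⟨M, hM0, hM⟩ := exists_bound_of_memLp_top hu hc
  classical
  refine ⟨(Ioi (0 : ℝ)).piecewise u fun _ => 0, M,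
    hc.measurable_piecewise continuousOn_const measurableSet_Ioi, fun x => ?_,
    fun x hx => piecewise_eq_of_mem _ _ _ hx⟩
  by_cases hx : x ∈ Ioi (0 : ℝ)
  · rw [piecewise_eq_of_mem _ _ _ hx]; exact hM x hx
  · rw [piecewise_eq_of_notMem _ _ _ hx]; simpa

end FracBessel

end

theorem corollary2 (u : ℝ → ℝ) (hu : MemLp u ∞ (volume.restrict (Ioi (0 : ℝ)))) :
    (∀ lam α : ℝ, 1 ≤ lam → 0 < α → α < 1 →
      FracBessel.HolderPlus α u → FracBessel.MemLrho 0 u →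
        (∀ σ : ℝ, 0 < σ → 2 * σ < α →
          FracBessel.IsFracBessel lam σ u (FracBessel.fracBessel lam σ u)) ∧
        ∀ x : ℝ, 0 < x →
          Tendsto (fun σ : ℝ => FracBessel.fracBessel lam σ u x) (𝓝[>] 0) (𝓝 (u x))) ∧
    (∀ lam : ℝ, 2 ≤ lam →
      ContDiffOn ℝ 2 u (Ioi 0) → MemLp (deriv u) ∞ (volume.restrict (Ioi (0 : ℝ))) →
        (∀ σ : ℝ, 1 / 2 ≤ σ → σ < 1 →
          FracBessel.IsFracBessel lam σ u (FracBessel.fracBessel lam σ u)) ∧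
        ∀ x : ℝ, 0 < x →
          Tendsto (fun σ : ℝ => FracBessel.fracBessel lam σ u x) (𝓝[<] 1)
            (𝓝 (FracBessel.bessel lam u x))) := by
  refine ⟨fun lam α hl hα hα1 hH hL => ?_, fun lam hl2 hC _ => ?_⟩
  · obtain ⟨v, M, hv, hM, hvu⟩ := FracBessel.exists_measurable_bounded hu hH.continuousOn
    obtain ⟨C, hC⟩ := hH.seminorm
    have hhol : ∀ x > 0, ∀ y > 0, |v x - v y| ≤ max C 0 * |x - y| ^ α := by
      intro x hx y hy
      rw [hvu hx, hvu hy]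
      rcases eq_or_ne x y with rfl | hxy
      · rw [sub_self, abs_zero]; positivity
      · have h := hC x hx y hy hxy
        rw [div_le_iff₀ (Real.rpow_pos_of_pos (abs_pos.2 (sub_ne_zero.2 hxy)) α)] at h
        exact h.trans (mul_le_mul_of_nonneg_right (le_max_left _ _)
          (Real.rpow_nonneg (abs_nonneg _) _))
    -- The rate α/2 is what limits the orders to σ < α/2.
    have hrate : FracBessel.HasHeatRate lam (α / 2) v := fun a b ha =>
      FracBessel.exists_abs_sub_heat_le_of_holder hl hv hM hα hα1 (le_max_right _ _) hhol ha
    have hvc : ContinuousOn v (Ioi 0) := hH.continuousOn.congr hvu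
    have key : ∀ σ, 0 < σ → 2 * σ < α →
        FracBessel.IsFracBessel lam σ u (FracBessel.fracHeat lam σ v) := fun σ h0 h1 =>
      (FracBessel.isFracBessel_fracHeat hl hv hM hvc hrate h0 (by linarith) (by linarith)).congr hvu
    refine ⟨fun σ h0 h1 => (key σ h0 h1).fracBessel, fun x hx => ?_⟩
    have hint : IntegrableOn (fun y => v y / (1 + y)) (Ioi 0) := by
      refine IntegrableOn.congr_fun hL (fun y hy => ?_) measurableSet_Ioi
      simp [hvu hy]
    rw [← hvu hx]
    refine (FracBessel.tendsto_fracHeat_zero hl hv hM (by positivity) hrate hint hx).congr' ?_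
    filter_upwards [Ioo_mem_nhdsGT (show 0 < α / 2 by positivity)] with σ hσ
    have hk := key σ hσ.1 (by linarith [hσ.2])
    -- Uniqueness of the continuous representative identifies the chosen one with the semigroup
    -- formula.
    exact hk.eqOn hk.fracBessel hx
  · have hl : 1 ≤ lam := by linarith
    obtain ⟨v, M, hv, hM, hvu⟩ := FracBessel.exists_measurable_bounded hu hC.continuousOn
    have hvC : ContDiffOn ℝ 2 v (Ioi 0) := hC.congr hvu
    -- Rate 1 admits every σ < 1.
    have hrate : FracBessel.HasHeatRate lam 1 v := fun a b ha => by
      obtain ⟨K, hK, h⟩ := FracBessel.exists_abs_sub_heat_le_of_contDiffOn hl hv hM hvC ha (b := b)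
      exact ⟨K, hK, fun x hx t ht _ => by simpa using h x hx t ht⟩
    have key : ∀ σ, 0 < σ → σ < 1 →
        FracBessel.IsFracBessel lam σ u (FracBessel.fracHeat lam σ v) := fun σ h0 h1 =>
      (FracBessel.isFracBessel_fracHeat hl hv hM hvC.continuousOn hrate h0 h1 h1).congr hvu
    refine ⟨fun σ h0 h1 => (key σ (by linarith) h1).fracBessel, fun x hx => ?_⟩
    rw [← FracBessel.bessel_congr lam hvu hx]
    refine (FracBessel.tendsto_fracHeat_one hl hv hM hvC hx).congr' ?_
    filter_upwards [Ioo_mem_nhdsLT (show (0 : ℝ) < 1 by norm_num)] with σ hσ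
    have hk := key σ hσ.1 hσ.2
    exact hk.eqOn hk.fracBessel hx
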